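/- Let $p\in(\tfrac32,\infty)$, let $1\le i\le m-1$ be integers, let $T_*\in(0,1)$, and let $q_0\in\mathbb R$ be a constant. For $q\in L^p([0,1],\mathbb R)$ let $\lambda_1(q)<\lambda_2(q)<\cdots$ be the eigenvalues of $-y''+q(x)y=\lambda y$, $y(0)=y(1)=0$, and let $T_{i,m}(q)$ be the $i$-th zero in $(0,1)$ of an eigenfunction belonging to $\lambda_m(q)$. Problem (P) asks for a potential $\hat q\in L^p([0,1],\mathbb R)$ with $T_{i,m}(\hat q)=T_*$ and $$\|\hat q-q_0\|_{L^p}=\min\{\|q-q_0\|_{L^p}: q\in L^p([0,1],\mathbb R),\ T_{i,m}(q)=T_*\}.$$ Let $p^*=p/(p-1)$, and for $\sigma\in\{1,-1\}$ let $D_{1}=(0,1)$, $D_{-1}=(0,\infty)$ and, for $\alpha\in D_\sigma$, $$\mathbf T_{\sigma}(\alpha)=\int_0^1\frac{dt}{\sqrt{1-t^2-\sigma\frac{\alpha}{p^*}(1-t^{2p^*})}},\qquad \mathbf V_{\sigma}(\alpha)=\alpha^{p-1}\int_0^1\frac{t^2\,dt}{\sqrt{1-t^2-\sigma\frac{\alpha}{p^*}(1-t^{2p^*})}};$$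 $\mathbf T_\sigma$ is strictly monotone on $D_\sigma$, and $\mathbf T_\sigma^{-1}$ denotes its inverse, defined on the range $\mathbf T_\sigma(D_\sigma)$. Let $\varepsilon=-1$ if $T_*<\frac im$ and $\varepsilon=+1$ if $T_*>\frac im$. (a) If $T_*\neq\frac im$, then there is exactly one $\lambda>0$ for which $\frac{\sqrt\lambda\,T_*}{2i}\in\mathbf T_{\varepsilon}(D_{\varepsilon})$, $\frac{\sqrt\lambda(1-T_*)}{2(m-i)}\in\mathbf T_{-\varepsilon}(D_{-\varepsilon})$ and $$i\,\mathbf V_{\varepsilon}\Big(\mathbf T_{\varepsilon}^{-1}\Big(\tfrac{\sqrt{\lambda}\,T_*}{2i}\Big)\Big)=(m-i)\,\mathbf V_{-\varepsilon}\Big(\mathbf T_{-\varepsilon}^{-1}\Big(\tfrac{\sqrt{\lambda}\,(1-T_*)}{2(m-i)}\Big)\Big).$$ (b) Problem (P) has exactly one solution $\hat q\in L^p([0,1],\mathbb R)$. (c) If $T_*\ne\frac im$, then the number $\lambda$ of (a) and the potential $\hat q$ of (b) satisfy $\lambda_m(\hat q)=q_0+\lambda$. -/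

import Mathlib

open MeasureTheory Set

/-- Lebesgue measure on the unit interval `[0, 1]`. -/
noncomputable abbrev unitVolume : Measure ℝ := volume.restrict (Icc (0 : ℝ) 1)

/-- The real Lebesgue space `L^p([0, 1])`. -/
abbrev LpUnit (p : ℝ) : Type := Lp ℝ (ENNReal.ofReal p) unitVolume

/-- `y` is a nontrivial solution on `[0, 1]` of `-y'' + q y = lam y`, `y(0) = y(1) = 0`, in the sense
of Carathéodory: `y` is continuously differentiable, its derivative `y' = z` is absolutely
continuous, and `z' = (q - lam) y` almost everywhere (written as an integral equation). -/
def IsDirichletEigenfunction (q : ℝ → ℝ) (lam : ℝ) (y : ℝ → ℝ) : Prop :=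
  (∃ z : ℝ → ℝ,
    (∀ x ∈ Icc (0 : ℝ) 1, HasDerivWithinAt y (z x) (Icc 0 1) x) ∧
    (∀ x ∈ Icc (0 : ℝ) 1, z x = z 0 + ∫ t in (0 : ℝ)..x, (q t - lam) * y t)) ∧
  y 0 = 0 ∧ y 1 = 0 ∧ ∃ x ∈ Icc (0 : ℝ) 1, y x ≠ 0

/-- `lam` is an eigenvalue of `-d²/dx² + q` on `[0, 1]` with Dirichlet boundary conditions. -/
def IsDirichletEigenvalue (q : ℝ → ℝ) (lam : ℝ) : Prop :=
  ∃ y : ℝ → ℝ, IsDirichletEigenfunction q lam y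

/-- `lam = λ_m(q)`: `lam` is an eigenvalue with exactly `m - 1` eigenvalues below it. -/
def IsNthEigenvalue (q : ℝ → ℝ) (m : ℕ) (lam : ℝ) : Prop :=
  IsDirichletEigenvalue q lam ∧
    {nu : ℝ | IsDirichletEigenvalue q nu ∧ nu < lam}.encard + 1 = (m : ℕ∞)

/-- `t = T_{i,m}(q)`: `t` is the `i`-th zero in `(0, 1)` of an eigenfunction for `λ_m(q)`. -/
def IsNode (q : ℝ → ℝ) (i m : ℕ) (t : ℝ) : Prop :=
  ∃ (lam : ℝ) (y : ℝ → ℝ), IsNthEigenvalue q m lam ∧ IsDirichletEigenfunction q lam y ∧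
    t ∈ Ioo (0 : ℝ) 1 ∧ y t = 0 ∧ {s ∈ Ioo (0 : ℝ) t | y s = 0}.encard + 1 = (i : ℕ∞)

/-- `qhat` solves Problem (P) with node data `(i, m, T)` and target `q₀`: among all potentials in
`L^p` whose `(i, m)`-th node is `T`, it has the least `L^p`-distance to `q₀`. -/
def SolvesProblemP (p : ℝ) (i m : ℕ) (T : ℝ) (q₀ qhat : LpUnit p) : Prop :=
  IsNode qhat i m T ∧ ∀ q : LpUnit p, IsNode q i m T → ‖qhat - q₀‖ ≤ ‖q - q₀‖

/-- The radicand `1 - t² - σ (α / p*) (1 - t^(2 p*))`, with `p* = p / (p - 1)`. -/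
noncomputable def radicand (p σ α t : ℝ) : ℝ :=
  1 - t ^ 2 - σ * (α / p.conjExponent) * (1 - t ^ (2 * p.conjExponent))

/-- The function `T_p`; the lower one is `charT p ε`, the upper one is `charT p (-ε)`. -/
noncomputable def charT (p σ α : ℝ) : ℝ :=
  ∫ t in (0 : ℝ)..1, 1 / √(radicand p σ α t)

/-- The function `V_p`; the lower one is `charV p ε`, the upper one is `charV p (-ε)`. -/
noncomputable def charV (p σ α : ℝ) : ℝ :=
  α ^ (p - 1) * ∫ t in (0 : ℝ)..1, t ^ 2 / √(radicand p σ α t)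

/-- The parameter domain of `charT p σ` and `charV p σ`: `(0, 1)` if `σ = 1` and
`(0, ∞)` if `σ = -1`. -/
noncomputable def charDomain (σ : ℝ) : Set ℝ :=
  open Classical in if σ = 1 then Ioo 0 1 else Ioi 0

/-- The inverse of `charT p σ` on its parameter domain. -/
noncomputable def charTInv (p σ : ℝ) : ℝ → ℝ :=
  Function.invFunOn (charT p σ) (charDomain σ)

/-- The sign `ε`: `-1` if `T < i / m`, and `+1` if `T > i / m`. -/
noncomputable def nodeSign (i m : ℕ) (T : ℝ) : ℝ :=
  open Classical in if T < (i : ℝ) / m then -1 else 1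

/-- `lam > 0` solves the scalar equation
`i V_low (T_low⁻¹ (√lam T / (2 i))) = (m - i) V_up (T_up⁻¹ (√lam (1 - T) / (2 (m - i))))`;
the first two membership conditions say that both inverse functions are defined at their
arguments. -/
def SolvesLambdaEquation (p : ℝ) (i m : ℕ) (T lam : ℝ) : Prop :=
  0 < lam ∧
  √lam * T / (2 * i) ∈ charT p (nodeSign i m T) '' charDomain (nodeSign i m T) ∧
  √lam * (1 - T) / (2 * ((m : ℝ) - i)) ∈
    charT p (-nodeSign i m T) '' charDomain (-nodeSign i m T) ∧
  (i : ℝ) * charV p (nodeSign i m T) (charTInv p (nodeSign i m T) (√lam * T / (2 * i))) =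
    ((m : ℝ) - i) * charV p (-nodeSign i m T)
      (charTInv p (-nodeSign i m T) (√lam * (1 - T) / (2 * ((m : ℝ) - i))))

/-! In Prüfer coordinates `y = r sin θ`, `y' = r cos θ` the angle solves `θ' = cos² θ + (ν - q) sin²
θ`, and prescribing the node amounts to `θ 0 = 0`, `θ T = i π`, `θ 1 = m π` with `ν` free
(`isNode_iff`). With `Q = q - q₀` and `μ = ν - q₀`, the task is to minimize `∫ |Q|^p` over all such
`(Q, μ, θ)`.

The Euler–Lagrange equation makes `|Q|^(p-2) Q` proportional to `y²`. On each of `[0, T]` and `[T,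
1]` the candidate is therefore an orbit of `y'' = -u² y + b u² |y|^(2p*-2) y`, scaled to height one,
with first integral `y'² = u² rad p b |y|`. The orbit is star-shaped about the origin of the phase
plane, so its potential is a function `orbitPot` of the polar angle alone. Bounding `|Q|^p` from
below by its tangent line at `orbitPot θ` yields an expression in which `θ'` occurs only through a
multiple of `R(θ) θ'`, whose integral depends only on the endpoints. Hence for `μ = u²` and every `b
< 1` one gets `∫ |Q|^p ≥ p * lobeEnergy`, with equality only if `Q` is the potential along the orbit
(`lobeEnergy_le`, `ae_eq_orbitPot`). The bound is attained when exactly `n` lobes fit into the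
length `L`, that is `quarterT p b = u L / (2 n)`; since `quarterT p` is an increasing bijection of
`(-∞, 1)` onto `(0, ∞)`, there is exactly one such `b`. No compactness argument is needed.

What remains is a scalar minimization over the frequency `u`. By the envelope theorem the minimal
energy has derivative `4 u^(2p-2) * balance` (`hasDerivAt_totalEnergy`). The function `balance` is
strictly increasing because `signedV` is, which is where `p > 3/2` matters, and it has a zero `v`;
so the energy has a strict minimum at `v`. Values `μ ≤ 0` are excluded by comparison with a small
`u` for which both parameters `b` are nonpositive (`totalEnergy_lt_of_ne`). Thus the minimizer is
unique and has `μ = v²`. At `v` the two parameters `b` have opposite signs when `T ≠ i/m`, and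
separating them turns `balance = 0` into the equation of (a), so `λ = v²`. -/

/-! ### Calculus of absolutely continuous functions. -/

/-- `f` is the absolutely continuous primitive of `f'` on `[a, b]`. -/
structure IsPrimitiveOn (f f' : ℝ → ℝ) (a b : ℝ) : Prop where
  integrable : IntervalIntegrable f' volume a b
  eq_add : ∀ x ∈ Icc a b, f x = f a + ∫ t in a..x, f' t

theorem AbsolutelyContinuousOnInterval.congr {f g : ℝ → ℝ} {a b : ℝ}
    (hf : AbsolutelyContinuousOnInterval f a b) (h : EqOn f g (uIcc a b)) :
    AbsolutelyContinuousOnInterval g a b := by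
  rw [absolutelyContinuousOnInterval_iff] at hf ⊢
  intro ε hε
  obtain ⟨δ, hδ, H⟩ := hf ε hε
  refine ⟨δ, hδ, fun E hE hl => ?_⟩
  convert H E hE hl using 1
  refine Finset.sum_congr rfl fun i hi => ?_
  rw [h (hE.1 i hi).1, h (hE.1 i hi).2]

theorem LipschitzOnWith.comp_absolutelyContinuousOnInterval {Φ f : ℝ → ℝ} {a b : ℝ} {s : Set ℝ}
    {K : NNReal} (hΦ : LipschitzOnWith K Φ s) (hf : AbsolutelyContinuousOnInterval f a b)
    (hs : MapsTo f (uIcc a b) s) : AbsolutelyContinuousOnInterval (fun x => Φ (f x)) a b := by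
  rw [absolutelyContinuousOnInterval_iff] at hf ⊢
  intro ε hε
  obtain ⟨δ, hδ, H⟩ := hf (ε / (K + 1)) (by positivity)
  refine ⟨δ, hδ, fun E hE hl => ?_⟩
  calc _ ≤ ∑ i ∈ Finset.range E.1, (K : ℝ) * dist (f (E.2 i).1) (f (E.2 i).2) :=
        Finset.sum_le_sum fun i hi => hΦ.dist_le_mul _ (hs (hE.1 i hi).1) _ (hs (hE.1 i hi).2)
    _ ≤ (K + 1) * ∑ i ∈ Finset.range E.1, dist (f (E.2 i).1) (f (E.2 i).2) := by
        rw [← Finset.mul_sum]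
        have : 0 ≤ ∑ i ∈ Finset.range E.1, dist (f (E.2 i).1) (f (E.2 i).2) :=
          Finset.sum_nonneg fun _ _ => dist_nonneg
        gcongr; linarith
    _ < (K + 1) * (ε / (K + 1)) := by
        have := H E hE hl
        gcongr
    _ = ε := by field_simp

namespace IsPrimitiveOn

variable {f f' g g' : ℝ → ℝ} {a b : ℝ}

theorem absolutelyContinuous (h : IsPrimitiveOn f f' a b) (hab : a ≤ b) :
    AbsolutelyContinuousOnInterval f a b := by
  have h1 := h.integrable.absolutelyContinuousOnInterval_intervalIntegral (c := a) (by simp)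
  have h2 : AbsolutelyContinuousOnInterval (fun _ : ℝ => f a) a b :=
    (LipschitzOnWith.absolutelyContinuousOnInterval (K := 0) (LipschitzWith.const _).lipschitzOnWith)
  refine (h2.add h1).congr fun x hx => ?_
  rw [uIcc_of_le hab] at hx
  simp [h.eq_add x hx]

theorem continuousOn (h : IsPrimitiveOn f f' a b) (hab : a ≤ b) : ContinuousOn f (Icc a b) := by
  simpa [uIcc_of_le hab] using (h.absolutelyContinuous hab).continuousOn

theorem ae_hasDerivAt (h : IsPrimitiveOn f f' a b) :
    ∀ᵐ x, x ∈ Ioo a b → HasDerivAt f (f' x) x := by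
  filter_upwards [h.integrable.ae_hasDerivAt_integral] with x hx hxm
  have hab : a ≤ b := (hxm.1.trans hxm.2).le
  have h1 := (hx (by rw [uIcc_of_le hab]; exact Ioo_subset_Icc_self hxm) a (by simp)).const_add (f a)
  refine h1.congr_of_eventuallyEq ?_
  filter_upwards [Icc_mem_nhds hxm.1 hxm.2] with y hy using h.eq_add y hy

/-- An absolutely continuous function is the integral of its a.e. derivative. The sum, product and
chain rules below reduce to this, since each operation preserves absolute continuity and the
derivative is computed pointwise. -/
theorem of_ae_hasDerivAt (hab : a ≤ b) (hf : AbsolutelyContinuousOnInterval f a b)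
    (hd : ∀ᵐ x, x ∈ Ioo a b → HasDerivAt f (f' x) x) : IsPrimitiveOn f f' a b := by
  have hae : ∀ᵐ x, x ∈ uIoc a b → deriv f x = f' x := by
    filter_upwards [hd, compl_mem_ae_iff.2 (measure_singleton b)] with x hx hxb hxm
    rw [uIoc_of_le hab] at hxm
    exact (hx ⟨hxm.1, lt_of_le_of_ne hxm.2 hxb⟩).deriv
  refine ⟨hf.intervalIntegrable_deriv.congr_ae
    ((ae_restrict_iff' measurableSet_uIoc).2 hae), fun x hx => ?_⟩
  have h1 := (hf.mono (c := a) (d := x) (by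
    rw [uIcc_of_le hab, uIcc_of_le hx.1]; exact Icc_subset_Icc_right hx.2)).integral_deriv_eq_sub
  have h2 : ∫ t in a..x, deriv f t = ∫ t in a..x, f' t := by
    refine intervalIntegral.integral_congr_ae ?_
    filter_upwards [hae] with t ht htm
    refine ht ?_
    rw [uIoc_of_le hx.1] at htm
    rw [uIoc_of_le hab]
    exact Ioc_subset_Ioc_right hx.2 htm
  rw [← h2, h1]; ring

theorem mul (hf : IsPrimitiveOn f f' a b) (hg : IsPrimitiveOn g g' a b) (hab : a ≤ b) :
    IsPrimitiveOn (fun x => f x * g x) (fun x => f' x * g x + f x * g' x) a b := by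
  refine of_ae_hasDerivAt hab
    ((hf.absolutelyContinuous hab).mul (hg.absolutelyContinuous hab)) ?_
  filter_upwards [hf.ae_hasDerivAt, hg.ae_hasDerivAt] with x h1 h2 hx using (h1 hx).mul (h2 hx)

theorem add (hf : IsPrimitiveOn f f' a b) (hg : IsPrimitiveOn g g' a b) (hab : a ≤ b) :
    IsPrimitiveOn (fun x => f x + g x) (fun x => f' x + g' x) a b := by
  refine of_ae_hasDerivAt hab
    ((hf.absolutelyContinuous hab).add (hg.absolutelyContinuous hab)) ?_
  filter_upwards [hf.ae_hasDerivAt, hg.ae_hasDerivAt] with x h1 h2 hx using (h1 hx).add (h2 hx)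

theorem sub (hf : IsPrimitiveOn f f' a b) (hg : IsPrimitiveOn g g' a b) (hab : a ≤ b) :
    IsPrimitiveOn (fun x => f x - g x) (fun x => f' x - g' x) a b := by
  refine of_ae_hasDerivAt hab
    ((hf.absolutelyContinuous hab).sub (hg.absolutelyContinuous hab)) ?_
  filter_upwards [hf.ae_hasDerivAt, hg.ae_hasDerivAt] with x h1 h2 hx using (h1 hx).sub (h2 hx)

theorem comp {Φ Φ' : ℝ → ℝ} (hΦ : ∀ x, HasDerivAt Φ (Φ' x) x) (hc : Continuous Φ')
    (hf : IsPrimitiveOn f f' a b) (hab : a ≤ b) :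
    IsPrimitiveOn (fun x => Φ (f x)) (fun x => Φ' (f x) * f' x) a b := by
  have hC1 : ContDiff ℝ 1 Φ := by
    rw [contDiff_one_iff_deriv]
    refine ⟨fun x => (hΦ x).differentiableAt, ?_⟩
    rwa [show deriv Φ = Φ' from funext fun x => (hΦ x).deriv]
  have hac := hf.absolutelyContinuous hab
  -- A `C¹` function is Lipschitz only locally; boundedness of `f` confines it to a compact
  -- interval.
  obtain ⟨C, hC⟩ := hac.exists_bound
  obtain ⟨K, hK⟩ := hC1.contDiffOn.exists_lipschitzOnWith (s := Icc (-C) C) (by decide)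
    (convex_Icc _ _) isCompact_Icc
  refine of_ae_hasDerivAt hab (hK.comp_absolutelyContinuousOnInterval hac
    fun x hx => abs_le.1 (hC x hx)) ?_
  filter_upwards [hf.ae_hasDerivAt] with x h1 hx using (hΦ (f x)).comp x (h1 hx)

theorem mono {c d : ℝ} (hf : IsPrimitiveOn f f' a b) (hac : a ≤ c) (hcd : c ≤ d) (hdb : d ≤ b) :
    IsPrimitiveOn f f' c d := by
  have hi : ∀ x ∈ Icc c d, ∀ y ∈ Icc a d, IntervalIntegrable f' volume y x := fun x hx y hy =>
    hf.integrable.mono_set (by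
      rw [uIcc_of_le (hac.trans (hcd.trans hdb))]
      exact uIcc_subset_Icc ⟨hy.1, hy.2.trans hdb⟩ ⟨hac.trans hx.1, hx.2.trans hdb⟩)
  refine ⟨hi d ⟨hcd, le_rfl⟩ c ⟨hac, hcd⟩, fun x hx => ?_⟩
  rw [hf.eq_add x ⟨hac.trans hx.1, hx.2.trans hdb⟩, hf.eq_add c ⟨hac, hcd.trans hdb⟩, add_assoc,
    intervalIntegral.integral_add_adjacent_intervals (hi c ⟨le_rfl, hcd⟩ a ⟨le_rfl, hac.trans hcd⟩)
      (hi x hx c ⟨hac, hcd⟩)]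

theorem congr_ae {f₁' : ℝ → ℝ} (hf : IsPrimitiveOn f f' a b) (hab : a ≤ b)
    (h : ∀ᵐ x, x ∈ Ioo a b → f' x = f₁' x) : IsPrimitiveOn f f₁' a b := by
  refine of_ae_hasDerivAt hab (hf.absolutelyContinuous hab) ?_
  filter_upwards [hf.ae_hasDerivAt, h] with x h1 h2 hx
  rw [← h2 hx]; exact h1 hx

theorem integral_eq_sub (hf : IsPrimitiveOn f f' a b) (hab : a ≤ b) :
    ∫ t in a..b, f' t = f b - f a := by
  rw [hf.eq_add b ⟨hab, le_rfl⟩]; ring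

theorem of_integrable (h : IntervalIntegrable f' volume a b) (c : ℝ) :
    IsPrimitiveOn (fun x => c + ∫ t in a..x, f' t) f' a b :=
  ⟨h, fun x _ => by simp⟩

theorem of_hasDerivWithinAt (hab : a ≤ b) (h : ∀ x ∈ Icc a b, HasDerivWithinAt f (f' x) (Icc a b) x)
    (hc : ContinuousOn f' (Icc a b)) : IsPrimitiveOn f f' a b := by
  have hi : IntervalIntegrable f' volume a b :=
    ContinuousOn.intervalIntegrable (by rwa [uIcc_of_le hab])
  refine ⟨hi, fun x hx => ?_⟩
  have hxs : Icc a x ⊆ Icc a b := Icc_subset_Icc_right hx.2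
  rw [intervalIntegral.integral_eq_sub_of_hasDerivAt_of_le hx.1
    (fun y hy => ((h y (hxs hy)).continuousWithinAt).mono hxs)
    (fun y hy => (h y (hxs (Ioo_subset_Icc_self hy))).hasDerivAt
      (Icc_mem_nhds hy.1 (hy.2.trans_le hx.2)))
    (hi.mono_set (by rw [uIcc_of_le hab, uIcc_of_le hx.1]; exact hxs))]
  ring

theorem hasDerivWithinAt (h : IsPrimitiveOn f f' a b) (hab : a < b)
    (hc : ContinuousOn f' (Icc a b)) {x : ℝ} (hx : x ∈ Icc a b) :
    HasDerivWithinAt f (f' x) (Icc a b) x := by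
  -- Extending `f'` by its endpoint values makes it continuous on the line, so that the fundamental
  -- theorem applies at the endpoints as well.
  let F := IccExtend hab.le (domRestrict (Icc a b) f')
  have hF : Continuous F := (continuousOn_iff_continuous_domRestrict.1 hc).Icc_extend'
  have hFx : ∀ y ∈ Icc a b, F y = f' y := fun y hy => IccExtend_of_mem hab.le _ hy
  have h1 : HasDerivWithinAt (fun y => f a + ∫ t in a..y, F t) (f' x) (Icc a b) x := by
    rw [← hFx x hx]
    exact ((hF.integral_hasStrictDerivAt a x).hasDerivAt.const_add (f a)).hasDerivWithinAt
  have heq : ∀ y ∈ Icc a b, f y = f a + ∫ t in a..y, F t := fun y hy => by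
    rw [h.eq_add y hy]
    congr 1
    refine intervalIntegral.integral_congr fun t ht => ?_
    rw [uIcc_of_le hy.1] at ht
    exact (hFx t ⟨ht.1, ht.2.trans hy.2⟩).symm
  exact h1.congr heq (heq x hx)

/-- Concatenation of two primitives. -/
theorem trans {c : ℝ} (h₁ : IsPrimitiveOn f f' a c) (h₂ : IsPrimitiveOn f f' c b) (hac : a ≤ c)
    (hcb : c ≤ b) : IsPrimitiveOn f f' a b := by
  refine ⟨h₁.integrable.trans h₂.integrable, fun x hx => ?_⟩
  rcases le_total x c with hxc | hxc
  · exact h₁.eq_add x ⟨hx.1, hxc⟩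
  · rw [h₂.eq_add x ⟨hxc, hx.2⟩, h₁.eq_add c ⟨hac, le_rfl⟩, add_assoc,
      intervalIntegral.integral_add_adjacent_intervals h₁.integrable
        (h₂.integrable.mono_set (by
          rw [uIcc_of_le hxc, uIcc_of_le hcb]; exact Icc_subset_Icc_right hx.2))]

theorem congr {g : ℝ → ℝ} (h : IsPrimitiveOn f f' a b) (hab : a ≤ b) (hfg : EqOn f g (Icc a b)) :
    IsPrimitiveOn g f' a b :=
  ⟨h.integrable, fun x hx => by
    rw [← hfg hx, ← hfg ⟨le_rfl, hab⟩]; exact h.eq_add x hx⟩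

/-- A primitive of an a.e. vanishing function is constant. -/
theorem eq_of_ae_eq_zero (h : IsPrimitiveOn f f' a b) (h0 : ∀ᵐ x, x ∈ Ioo a b → f' x = 0)
    {x : ℝ} (hx : x ∈ Icc a b) : f x = f a := by
  have h1 := h.congr_ae (f₁' := fun _ => 0) (hx.1.trans hx.2) h0
  simpa using h1.eq_add x hx

end IsPrimitiveOn

/-! ### Scalar linear equations with integrable coefficients. -/

/-- Take `E = exp (-∫ β)`. The two-sided bound gives positivity and, in the comparison of Prüfer
angles, constants depending only on `∫ |β|`. -/
theorem exists_integratingFactor {β : ℝ → ℝ} {a b : ℝ} (hab : a ≤ b)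
    (hβ : IntervalIntegrable β volume a b) :
    ∃ E : ℝ → ℝ, E a = 1 ∧ IsPrimitiveOn E (fun x => -β x * E x) a b ∧
      ∀ x ∈ Icc a b, Real.exp (-∫ t in a..b, |β t|) ≤ E x ∧ E x ≤ Real.exp (∫ t in a..b, |β t|) := by
  have hB := (IsPrimitiveOn.of_integrable hβ.neg 0)
  refine ⟨_, ?_, (hB.comp Real.hasDerivAt_exp Real.continuous_exp hab).congr_ae hab
    (Filter.Eventually.of_forall fun x _ => ?_), fun x hx => ?_⟩
  · simp
  · simp [mul_comm]
  · have h1 : |∫ t in a..x, -β t| ≤ ∫ t in a..b, |β t| := by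
      calc |∫ t in a..x, -β t| ≤ ∫ t in a..x, |β t| := by
            simpa using intervalIntegral.abs_integral_le_integral_abs (f := fun t => -β t)
              (μ := volume) hx.1
        _ ≤ ∫ t in a..b, |β t| :=
            intervalIntegral.integral_mono_interval le_rfl hx.1 hx.2
              (Filter.Eventually.of_forall fun t => abs_nonneg _) hβ.abs
    rw [abs_le] at h1
    simp only [Pi.neg_apply, zero_add]
    exact ⟨Real.exp_le_exp.2 h1.1, Real.exp_le_exp.2 h1.2⟩

/-- Variation of constants for a scalar linear equation `δ' = β δ + γ`. -/
theorem IsPrimitiveOn.mul_integratingFactor {δ δ' β γ E : ℝ → ℝ} {a b : ℝ} (hab : a ≤ b)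
    (hδ : IsPrimitiveOn δ δ' a b) (hE : IsPrimitiveOn E (fun x => -β x * E x) a b)
    (h : ∀ x ∈ Ioo a b, δ' x = β x * δ x + γ x) :
    IsPrimitiveOn (fun x => δ x * E x) (fun x => γ x * E x) a b :=
  (hδ.mul hE hab).congr_ae hab (Filter.Eventually.of_forall fun x hx => by rw [h x hx]; ring)

theorem abs_sin_sq_sub_sin_sq_le (a b : ℝ) : |Real.sin a ^ 2 - Real.sin b ^ 2| ≤ |a - b| := by
  have h : Real.sin a ^ 2 - Real.sin b ^ 2 = Real.sin (a - b) * Real.sin (a + b) := by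
    rw [Real.sin_sub, Real.sin_add]
    have h1 := Real.sin_sq_add_cos_sq a
    have h2 := Real.sin_sq_add_cos_sq b
    linear_combination Real.sin b ^ 2 * h1 - Real.sin a ^ 2 * h2
  rw [h, abs_mul]
  have h1 : |Real.sin (a - b)| ≤ |a - b| := Real.abs_sin_le_abs
  have h2 := Real.abs_sin_le_one (a + b)
  nlinarith [abs_nonneg (Real.sin (a - b)), abs_nonneg (a - b)]

/-- The difference quotient of `sin²`. -/
noncomputable def sinSqSlope (a b : ℝ) : ℝ := (Real.sin a ^ 2 - Real.sin b ^ 2) / (a - b)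

theorem abs_sinSqSlope_le (a b : ℝ) : |sinSqSlope a b| ≤ 1 := by
  rw [sinSqSlope, abs_div]
  exact div_le_one_of_le₀ (abs_sin_sq_sub_sin_sq_le a b) (abs_nonneg _)

/-- This linearizes the difference of two Prüfer equations exactly. When the angles coincide the
quotient is `0 / 0 = 0`, which is harmless; only measurability and the bound by one are needed of
it. -/
theorem sinSqSlope_mul (a b : ℝ) :
    sinSqSlope a b * (a - b) = Real.sin a ^ 2 - Real.sin b ^ 2 := by
  rcases eq_or_ne a b with rfl | h
  · simp
  · exact div_mul_cancel₀ _ (sub_ne_zero.2 h)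

theorem IntervalIntegrable.mul_sinSqSlope {g θ φ : ℝ → ℝ} {a b : ℝ} (hab : a ≤ b)
    (hg : IntervalIntegrable g volume a b) (hθ : ContinuousOn θ (Icc a b))
    (hφ : ContinuousOn φ (Icc a b)) :
    IntervalIntegrable (fun t => g t * sinSqSlope (θ t) (φ t)) volume a b := by
  rw [intervalIntegrable_iff_integrableOn_Icc_of_le hab] at hg ⊢
  refine Integrable.mul_bdd (c := 1) hg ?_ (Filter.Eventually.of_forall fun t => ?_)
  · have h1 := hθ.aestronglyMeasurable (μ := volume) measurableSet_Icc
    have h2 := hφ.aestronglyMeasurable (μ := volume) measurableSet_Icc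
    have h3 : Measurable (fun x : ℝ => Real.sin x ^ 2) := by fun_prop
    exact ((((h3.comp_aemeasurable h1.aemeasurable).sub (h3.comp_aemeasurable h2.aemeasurable)).div
      (h1.aemeasurable.sub h2.aemeasurable))).aestronglyMeasurable
  · exact abs_sinSqSlope_le _ _

/-! ### The Prüfer angle: existence, uniqueness, dependence on the spectral parameter. -/

/-- `θ` is the Prüfer angle on `[0, 1]` of the solution of `-y'' + q y = ν y`, `y(0) = 0`. -/
structure IsPruferAngle (q : ℝ → ℝ) (ν : ℝ) (θ : ℝ → ℝ) : Prop where
  primitive : IsPrimitiveOn θ (fun t => Real.cos (θ t) ^ 2 + (ν - q t) * Real.sin (θ t) ^ 2) 0 1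
  zero : θ 0 = 0

theorem cos_sq_add_mul_sin_sq (ν q x : ℝ) :
    Real.cos x ^ 2 + (ν - q) * Real.sin x ^ 2 = 1 + (ν - 1 - q) * Real.sin x ^ 2 := by
  rw [Real.cos_sq']; ring

/-- Picard iteration in an exponentially weighted sup norm: the weight makes the integral operator a
contraction on all of `[0, 1]` at once, although `q` is merely integrable. -/
theorem IsPruferAngle.exists {q : ℝ → ℝ} (hq : IntervalIntegrable q volume 0 1) (ν : ℝ) :
    ∃ θ, IsPruferAngle q ν θ := by
  set g : ℝ → ℝ := fun t => ν - 1 - q t with hgdef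
  have hg : IntervalIntegrable g volume 0 1 := intervalIntegrable_const.sub hq
  -- Here `E x = exp (2 ∫₀ˣ |g|)`, hence `∫₀ˣ |g| E = (E x - 1) / 2`; this is the source of the
  -- contraction constant `1/2`.
  obtain ⟨E, hE0, hE, hEb⟩ := exists_integratingFactor (β := fun t => -(2 * |g t|)) zero_le_one
    (hg.abs.const_mul 2).neg
  have hEpos : ∀ x ∈ Icc (0 : ℝ) 1, 0 < E x := fun x hx => (Real.exp_pos _).trans_le (hEb x hx).1
  have hEc := hE.continuousOn zero_le_one
  let ext : C(Icc (0 : ℝ) 1, ℝ) → ℝ → ℝ := fun η x => η (projIcc 0 1 zero_le_one x)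
  have hext : ∀ η, Continuous (ext η) := fun η => η.continuous.comp continuous_projIcc
  let G : C(Icc (0 : ℝ) 1, ℝ) → ℝ → ℝ := fun η t => 1 + g t * Real.sin (E t * ext η t) ^ 2
  have hG : ∀ η, IntervalIntegrable (G η) volume 0 1 := fun η => by
    refine intervalIntegrable_const.add (hg.mul_continuousOn ?_)
    rw [uIcc_of_le zero_le_one]
    have := (hext η).continuousOn (s := Icc 0 1)
    fun_prop
  have hGx : ∀ η, ∀ x ∈ Icc (0 : ℝ) 1, IntervalIntegrable (G η) volume 0 x := fun η x hx =>
    (hG η).mono_set (by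
      rw [uIcc_of_le hx.1, uIcc_of_le zero_le_one]; exact Icc_subset_Icc_right hx.2)
  -- The unknown is `η = θ / E`, so the ordinary sup norm of `η` is the weighted norm of `θ`.
  let K : C(Icc (0 : ℝ) 1, ℝ) → C(Icc (0 : ℝ) 1, ℝ) := fun η =>
    ⟨fun x => (E x)⁻¹ * (0 + ∫ t in (0 : ℝ)..x, G η t), by
      have h1 := ((IsPrimitiveOn.of_integrable (hG η) 0).continuousOn zero_le_one)
      have h2 := (hEc.inv₀ fun x hx => (hEpos x hx).ne').mul h1
      exact continuousOn_iff_continuous_domRestrict.1 h2⟩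
  have hK : ContractingWith (1 / 2) K := by
    refine ⟨by norm_num, LipschitzWith.of_dist_le_mul fun η₁ η₂ => ?_⟩
    rw [ContinuousMap.dist_le (by positivity)]
    intro x
    have hx := x.2
    have hd : ∀ t ∈ Icc (0 : ℝ) x, |G η₁ t - G η₂ t| ≤ (2⁻¹ * dist η₁ η₂) * (2 * |g t| * E t) := by
      intro t ht
      have ht' : t ∈ Icc (0 : ℝ) 1 := ⟨ht.1, ht.2.trans hx.2⟩
      have h1 : G η₁ t - G η₂ t =
          g t * (Real.sin (E t * ext η₁ t) ^ 2 - Real.sin (E t * ext η₂ t) ^ 2) := by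
        simp only [G]; ring
      rw [h1, abs_mul]
      have h2 := abs_sin_sq_sub_sin_sq_le (E t * ext η₁ t) (E t * ext η₂ t)
      rw [← mul_sub, abs_mul, abs_of_pos (hEpos t ht')] at h2
      have h3 : |ext η₁ t - ext η₂ t| ≤ dist η₁ η₂ :=
        ContinuousMap.dist_apply_le_dist (f := η₁) (g := η₂) (projIcc 0 1 zero_le_one t)
      calc _ ≤ |g t| * (E t * dist η₁ η₂) := by
            have := (hEpos t ht').le
            gcongr; exact h2.trans (by gcongr)
        _ = _ := by ring
    have hE' := hE.mono (c := 0) (d := x) le_rfl hx.1 hx.2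
    have hEi : ∫ t in (0 : ℝ)..x, 2 * |g t| * E t = E x - 1 := by
      have h1 := hE'.integral_eq_sub hx.1
      rw [hE0] at h1
      rw [← h1]
      simp
    have hint : IntervalIntegrable (fun t => 2 * |g t| * E t) volume 0 x := by
      simpa using hE'.integrable
    have hEx := hEpos x hx
    have key : |∫ t in (0 : ℝ)..x, (G η₁ t - G η₂ t)| ≤ (2⁻¹ * dist η₁ η₂) * (E x - 1) := by
      rw [← hEi, ← intervalIntegral.integral_const_mul]
      refine (intervalIntegral.abs_integral_le_integral_abs hx.1).trans ?_
      exact intervalIntegral.integral_mono_on hx.1 ((hGx η₁ x hx).sub (hGx η₂ x hx)).abs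
        (hint.const_mul _) hd
    have : (K η₁ x - K η₂ x) = (E x)⁻¹ * ∫ t in (0 : ℝ)..x, (G η₁ t - G η₂ t) := by
      rw [intervalIntegral.integral_sub (hGx η₁ x hx) (hGx η₂ x hx)]
      change (E x)⁻¹ * (0 + _) - (E x)⁻¹ * (0 + _) = _
      ring
    rw [Real.dist_eq, this, abs_mul, abs_of_pos (inv_pos.2 hEx), inv_mul_le_iff₀ hEx]
    refine key.trans ?_
    have : (0 : ℝ) ≤ dist η₁ η₂ := dist_nonneg
    push_cast
    nlinarith
  obtain ⟨η, hη⟩ : ∃ η, K η = η := ⟨hK.fixedPoint K, hK.fixedPoint_isFixedPt⟩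
  have hfix : ∀ x ∈ Icc (0 : ℝ) 1, E x * ext η x = 0 + ∫ t in (0 : ℝ)..x, G η t := by
    intro x hx
    have h1 : ext η x = (E x)⁻¹ * (0 + ∫ t in (0 : ℝ)..x, G η t) := by
      have h2 : ext η x = K η ⟨x, hx⟩ := by
        rw [hη]; simp only [ext]; rw [projIcc_of_mem _ hx]
      rw [h2]; rfl
    rw [h1, mul_inv_cancel_left₀ (hEpos x hx).ne']
  have h0 : E 0 * ext η 0 = 0 := by simpa using hfix 0 (by simp)
  refine ⟨fun x => E x * ext η x, ?_, h0⟩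
  refine ((IsPrimitiveOn.of_integrable (hG η) 0).congr zero_le_one
    fun x hx => (hfix x hx).symm).congr_ae zero_le_one (Filter.Eventually.of_forall fun x _ => ?_)
  simp only [G, hgdef]
  rw [cos_sq_add_mul_sin_sq]

namespace IsPruferAngle

variable {q θ φ : ℝ → ℝ} {ν ν' : ℝ}

theorem continuousOn (h : IsPruferAngle q ν θ) : ContinuousOn θ (Icc 0 1) :=
  h.primitive.continuousOn zero_le_one

/-- The difference `δ = φ - θ` solves `δ' = (ν - 1 - q) s δ + (ν' - ν) sin² φ`, where `s` is the
slope of `sin²`. Uniqueness, Lipschitz dependence on `ν` and strict monotonicity in `ν` all follow.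
-/
theorem sub_mul_integratingFactor (hq : IntervalIntegrable q volume 0 1)
    (h : IsPruferAngle q ν θ) (h' : IsPruferAngle q ν' φ) :
    ∃ E : ℝ → ℝ, (∀ x ∈ Icc (0 : ℝ) 1, Real.exp (-∫ t in (0 : ℝ)..1, |ν - 1 - q t|) ≤ E x ∧
        E x ≤ Real.exp (∫ t in (0 : ℝ)..1, |ν - 1 - q t|)) ∧ ContinuousOn E (Icc 0 1) ∧
      IsPrimitiveOn (fun x => (φ x - θ x) * E x)
        (fun x => (ν' - ν) * Real.sin (φ x) ^ 2 * E x) 0 1 := by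
  have hg : IntervalIntegrable (fun t => ν - 1 - q t) volume 0 1 := intervalIntegrable_const.sub hq
  have hβ := hg.mul_sinSqSlope zero_le_one h'.continuousOn h.continuousOn
  obtain ⟨E, -, hE, hEb⟩ := exists_integratingFactor zero_le_one hβ
  -- Since the slope is at most one in absolute value, the bounds on `E` do not involve `ν'`.
  have hle : ∫ t in (0 : ℝ)..1, |(ν - 1 - q t) * sinSqSlope (φ t) (θ t)| ≤
      ∫ t in (0 : ℝ)..1, |ν - 1 - q t| := by
    refine intervalIntegral.integral_mono_on zero_le_one hβ.abs hg.abs fun t _ => ?_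
    rw [abs_mul]
    exact mul_le_of_le_one_right (abs_nonneg _) (abs_sinSqSlope_le _ _)
  refine ⟨E, fun x hx => ⟨(Real.exp_le_exp.2 (neg_le_neg hle)).trans (hEb x hx).1,
    (hEb x hx).2.trans (Real.exp_le_exp.2 hle)⟩, hE.continuousOn zero_le_one,
    (h'.primitive.sub h.primitive zero_le_one).mul_integratingFactor zero_le_one hE fun x _ => ?_⟩
  rw [cos_sq_add_mul_sin_sq, cos_sq_add_mul_sin_sq, mul_assoc, sinSqSlope_mul]
  ring

theorem unique (hq : IntervalIntegrable q volume 0 1) (h : IsPruferAngle q ν θ)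
    (h' : IsPruferAngle q ν φ) : EqOn θ φ (Icc 0 1) := by
  intro x hx
  obtain ⟨E, hEb, -, hE⟩ := sub_mul_integratingFactor hq h h'
  have h1 := hE.eq_of_ae_eq_zero (Filter.Eventually.of_forall fun x _ => by simp) hx
  simp only [h.zero, h'.zero, sub_self, zero_mul] at h1
  have h2 := (Real.exp_pos _).trans_le (hEb x hx).1
  rcases mul_eq_zero.1 h1 with h3 | h3 <;> linarith

theorem abs_sub_le (hq : IntervalIntegrable q volume 0 1) (h : IsPruferAngle q ν θ)
    (h' : IsPruferAngle q ν' φ) :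
    |φ 1 - θ 1| ≤ |ν' - ν| * Real.exp (2 * ∫ t in (0 : ℝ)..1, |ν - 1 - q t|) := by
  obtain ⟨E, hEb, hEc, hE⟩ := sub_mul_integratingFactor hq h h'
  set L := ∫ t in (0 : ℝ)..1, |ν - 1 - q t|
  have h1 := hE.integral_eq_sub zero_le_one
  simp only [h.zero, h'.zero, sub_self, zero_mul, sub_zero] at h1
  have h2 : |∫ x in (0 : ℝ)..1, (ν' - ν) * Real.sin (φ x) ^ 2 * E x| ≤
      |ν' - ν| * Real.exp L * |1 - 0| := by
    rw [← Real.norm_eq_abs]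
    refine intervalIntegral.norm_integral_le_of_norm_le_const fun x hx => ?_
    rw [uIoc_of_le zero_le_one] at hx
    have h3 := hEb x ⟨hx.1.le, hx.2⟩
    have h4 := (Real.exp_pos _).trans_le h3.1
    rw [Real.norm_eq_abs, abs_mul, abs_mul, abs_of_pos h4, abs_of_nonneg (sq_nonneg (Real.sin (φ x)))]
    have := Real.sin_sq_le_one (φ x)
    have := abs_nonneg (ν' - ν)
    calc _ ≤ |ν' - ν| * 1 * Real.exp L := by gcongr; exact h3.2
      _ = _ := by ring
  rw [h1, abs_mul] at h2
  have h3 := (hEb 1 (by simp)).1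
  have h4 := (Real.exp_pos _).trans_le h3
  rw [abs_of_pos h4] at h2
  have h5 : |φ 1 - θ 1| * Real.exp (-L) ≤ |ν' - ν| * Real.exp L := by
    calc _ ≤ |φ 1 - θ 1| * E 1 := by gcongr
      _ ≤ _ := by simpa using h2
  rw [Real.exp_neg, ← div_eq_mul_inv, div_le_iff₀ (Real.exp_pos _)] at h5
  rwa [two_mul, Real.exp_add, ← mul_assoc]

/-- The Prüfer angle crosses the multiples of `π` only upwards. -/
theorem sub_mul_pos (hq : IntervalIntegrable q volume 0 1) (h : IsPruferAngle q ν θ) {n : ℤ}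
    {x₀ x₁ : ℝ} (h₀ : x₀ ∈ Icc (0 : ℝ) 1) (h₁ : x₁ ∈ Icc (0 : ℝ) 1)
    (hlt : x₀ < x₁) : (θ x₀ = n * Real.pi → n * Real.pi < θ x₁) ∧
      (θ x₁ = n * Real.pi → θ x₀ < n * Real.pi) := by
  have hg : IntervalIntegrable (fun t => ν - 1 - q t) volume 0 1 := intervalIntegrable_const.sub hq
  have hβ := hg.mul_sinSqSlope (φ := fun _ => n * Real.pi) zero_le_one h.continuousOn
    continuousOn_const
  obtain ⟨E, -, hE, hEb⟩ := exists_integratingFactor zero_le_one hβ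
  have hEpos : ∀ x ∈ Icc (0 : ℝ) 1, 0 < E x := fun x hx => (Real.exp_pos _).trans_le (hEb x hx).1
  have hc : IsPrimitiveOn (fun _ => n * Real.pi) (fun _ => 0) 0 1 := ⟨by simp, by simp⟩
  -- Because `sin (n π) = 0`, the difference `θ - n π` solves a linear equation with source term
  -- `1`; hence `(θ - n π) E` is strictly increasing.
  have hP := (h.primitive.sub hc zero_le_one).mul_integratingFactor (γ := fun _ => 1)
    zero_le_one hE fun x _ => by
      rw [cos_sq_add_mul_sin_sq, mul_assoc, sinSqSlope_mul, Real.sin_int_mul_pi]; ring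
  have hP' := hP.mono h₀.1 hlt.le h₁.2
  have hpos : 0 < ∫ t in x₀..x₁, 1 * E t := by
    refine intervalIntegral.intervalIntegral_pos_of_pos_on hP'.integrable (fun t ht => ?_) hlt
    rw [one_mul]
    exact hEpos t ⟨h₀.1.trans ht.1.le, ht.2.le.trans h₁.2⟩
  rw [hP'.integral_eq_sub hlt.le] at hpos
  constructor
  · intro h2
    rw [h2, sub_self, zero_mul, sub_zero] at hpos
    linarith [(pos_iff_pos_of_mul_pos hpos).2 (hEpos _ h₁)]
  · intro h2
    rw [h2, sub_self, zero_mul, zero_sub] at hpos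
    have := hEpos _ h₀
    nlinarith

theorem pos (hq : IntervalIntegrable q volume 0 1) (h : IsPruferAngle q ν θ) {x : ℝ}
    (hx : x ∈ Ioc (0 : ℝ) 1) : 0 < θ x := by
  simpa using (h.sub_mul_pos hq (n := 0) (by simp) ⟨hx.1.le, hx.2⟩ hx.1).1 (by simp [h.zero])

theorem lt_of_lt (hq : IntervalIntegrable q volume 0 1) (h : IsPruferAngle q ν θ)
    (h' : IsPruferAngle q ν' φ) (hν : ν < ν') : θ 1 < φ 1 := by
  obtain ⟨E, hEb, hEc, hE⟩ := sub_mul_integratingFactor hq h h'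
  have hEpos : ∀ x ∈ Icc (0 : ℝ) 1, 0 < E x := fun x hx => (Real.exp_pos _).trans_le (hEb x hx).1
  have h1 := hE.integral_eq_sub zero_le_one
  simp only [h.zero, h'.zero, sub_self, zero_mul, sub_zero] at h1
  -- The source `(ν' - ν) sin² φ` must be nonzero somewhere: `φ` takes the value `min (φ 1) (π/2)`,
  -- which lies in `(0, π)`.
  obtain ⟨c, hc, hcs⟩ : ∃ c ∈ Icc (0 : ℝ) 1, 0 < Real.sin (φ c) ^ 2 := by
    obtain ⟨c, hc, hc'⟩ : (min (φ 1) (Real.pi / 2)) ∈ φ '' Icc 0 1 :=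
      intermediate_value_Icc zero_le_one h'.continuousOn
        ⟨by rw [h'.zero]; exact le_min (h'.pos hq (by simp)).le (by positivity), min_le_left _ _⟩
    refine ⟨c, hc, ?_⟩
    have : 0 < Real.sin (φ c) := by
      rw [hc']
      refine Real.sin_pos_of_pos_of_lt_pi (lt_min (h'.pos hq (by simp)) (by positivity)) ?_
      exact (min_le_right _ _).trans_lt (by linarith [Real.pi_pos])
    positivity
  have h2 : 0 < ∫ x in (0 : ℝ)..1, (ν' - ν) * Real.sin (φ x) ^ 2 * E x := by
    refine intervalIntegral.integral_pos zero_lt_one ?_ (fun x hx => ?_) ⟨c, hc, ?_⟩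
    · have := h'.continuousOn
      fun_prop
    · have := (hEpos x ⟨hx.1.le, hx.2⟩).le
      have := sub_pos.2 hν
      positivity
    · have := hEpos c hc
      have := sub_pos.2 hν
      positivity
  rw [h1] at h2
  linarith [(pos_iff_pos_of_mul_pos h2).2 (hEpos 1 (by simp))]

end IsPruferAngle

/-! ### From the angle back to solutions and eigenfunctions. -/

namespace IsPruferAngle

variable {q θ φ : ℝ → ℝ} {ν ν' : ℝ}

/-- The function is the logarithmic derivative of the Prüfer radius. -/
theorem intervalIntegrable_amplitude (hq : IntervalIntegrable q volume 0 1)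
    (h : IsPruferAngle q ν θ) : IntervalIntegrable
      (fun x => (1 + q x - ν) * (Real.sin (θ x) * Real.cos (θ x))) volume 0 1 := by
  refine ((intervalIntegrable_const.add hq).sub intervalIntegrable_const).mul_continuousOn ?_
  rw [uIcc_of_le zero_le_one]
  have := h.continuousOn
  fun_prop

/-- The solution with Prüfer angle `θ`, in polar coordinates. -/
theorem exists_solution (hq : IntervalIntegrable q volume 0 1) (h : IsPruferAngle q ν θ) :
    ∃ r : ℝ → ℝ, (∀ x ∈ Icc (0 : ℝ) 1, 0 < r x) ∧
      IsPrimitiveOn (fun x => r x * Real.sin (θ x)) (fun x => r x * Real.cos (θ x)) 0 1 ∧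
      IsPrimitiveOn (fun x => r x * Real.cos (θ x))
        (fun x => (q x - ν) * (r x * Real.sin (θ x))) 0 1 := by
  obtain ⟨r, -, hr, hrb⟩ := exists_integratingFactor zero_le_one
    (h.intervalIntegrable_amplitude hq).neg
  refine ⟨r, fun x hx => (Real.exp_pos _).trans_le (hrb x hx).1, ?_, ?_⟩
  · refine (hr.mul (h.primitive.comp Real.hasDerivAt_sin Real.continuous_cos zero_le_one)
      zero_le_one).congr_ae zero_le_one (Filter.Eventually.of_forall fun x _ => ?_)
    simp only [Pi.neg_apply]
    linear_combination (r x * Real.cos (θ x)) * Real.sin_sq_add_cos_sq (θ x)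
  · refine (hr.mul (h.primitive.comp (Φ' := fun x => -Real.sin x) Real.hasDerivAt_cos
      (by fun_prop) zero_le_one) zero_le_one).congr_ae zero_le_one
      (Filter.Eventually.of_forall fun x _ => ?_)
    simp only [Pi.neg_apply]
    linear_combination ((q x - ν) * r x * Real.sin (θ x)) * Real.sin_sq_add_cos_sq (θ x)

theorem exists_eigenfunction (hq : IntervalIntegrable q volume 0 1) (h : IsPruferAngle q ν θ)
    (h1 : Real.sin (θ 1) = 0) : ∃ y : ℝ → ℝ, IsDirichletEigenfunction q ν y := by
  obtain ⟨r, hr, hy, hz⟩ := h.exists_solution hq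
  refine ⟨fun x => r x * Real.sin (θ x), ⟨fun x => r x * Real.cos (θ x), fun x hx =>
    hy.hasDerivWithinAt zero_lt_one (hz.continuousOn zero_le_one) hx, hz.eq_add⟩,
    by simp [h.zero], by simp [h1], ?_⟩
  obtain ⟨c, hc, hc'⟩ : (min (θ 1) (Real.pi / 2)) ∈ θ '' Icc 0 1 :=
    intermediate_value_Icc zero_le_one h.continuousOn
      ⟨by rw [h.zero]; exact le_min (h.pos hq (by simp)).le (by positivity), min_le_left _ _⟩
  refine ⟨c, hc, mul_ne_zero (hr c hc).ne' ?_⟩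
  rw [hc']
  refine (Real.sin_pos_of_pos_of_lt_pi (lt_min (h.pos hq (by simp)) (by positivity)) ?_).ne'
  exact (min_le_right _ _).trans_lt (by linarith [Real.pi_pos])

/-- An eigenfunction vanishes exactly where the sine of the Prüfer angle does. -/
theorem eigenfunction_eq_zero_iff (hq : IntervalIntegrable q volume 0 1) (h : IsPruferAngle q ν θ)
    {y : ℝ → ℝ} (hy : IsDirichletEigenfunction q ν y) {x : ℝ} (hx : x ∈ Icc (0 : ℝ) 1) :
    y x = 0 ↔ Real.sin (θ x) = 0 := by
  obtain ⟨⟨z, hyz, hz⟩, hy0, -, x₁, hx₁, hyx₁⟩ := hy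
  have hyc : ContinuousOn y (Icc 0 1) := fun x hx => (hyz x hx).continuousWithinAt
  have hzp : IsPrimitiveOn z (fun t => (q t - ν) * y t) 0 1 := by
    refine ⟨(hq.sub intervalIntegrable_const).mul_continuousOn ?_, hz⟩
    rwa [uIcc_of_le zero_le_one]
  have hyp : IsPrimitiveOn y z 0 1 :=
    IsPrimitiveOn.of_hasDerivWithinAt zero_le_one hyz (hzp.continuousOn zero_le_one)
  have hS := h.primitive.comp Real.hasDerivAt_sin Real.continuous_cos zero_le_one
  have hC := h.primitive.comp (Φ' := fun x => -Real.sin x) Real.hasDerivAt_cos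
      (by fun_prop) zero_le_one
  obtain ⟨E, hE0, hE, hEb⟩ := exists_integratingFactor zero_le_one
    (h.intervalIntegrable_amplitude hq)
  obtain ⟨F, hF0, hF, hFb⟩ := exists_integratingFactor zero_le_one
    (h.intervalIntegrable_amplitude hq).neg
  have hEpos : ∀ x ∈ Icc (0 : ℝ) 1, 0 < E x := fun x hx => (Real.exp_pos _).trans_le (hEb x hx).1
  have hFpos : ∀ x ∈ Icc (0 : ℝ) 1, 0 < F x := fun x hx => (Real.exp_pos _).trans_le (hFb x hx).1
  -- Rotate `(y, z)` into the Prüfer frame. The component `y cos θ - z sin θ` solves a homogeneous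
  -- linear equation with zero initial value, so it vanishes; the radial component is then a nowhere
  -- vanishing factor times `z 0`.
  have hκ := ((hyp.mul hC zero_le_one).sub (hzp.mul hS zero_le_one) zero_le_one).mul hF zero_le_one
  have hρ := ((hyp.mul hS zero_le_one).add (hzp.mul hC zero_le_one) zero_le_one).mul hE zero_le_one
  have hκ0 : ∀ x ∈ Icc (0 : ℝ) 1, y x * Real.cos (θ x) - z x * Real.sin (θ x) = 0 := by
    intro x hx
    have h1 := hκ.eq_of_ae_eq_zero (Filter.Eventually.of_forall fun x _ => by
      simp only [Pi.neg_apply]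
      linear_combination (-(F x * (z x * Real.cos (θ x) - (q x - ν) * y x * Real.sin (θ x)))) *
        Real.sin_sq_add_cos_sq (θ x)) hx
    simp only [hy0, h.zero, Real.sin_zero, zero_mul, mul_zero, sub_zero] at h1
    exact (mul_eq_zero.1 h1).resolve_right (hFpos x hx).ne'
  have hρ0 : ∀ x ∈ Icc (0 : ℝ) 1, (y x * Real.sin (θ x) + z x * Real.cos (θ x)) * E x = z 0 := by
    intro x hx
    have h1 := hρ.eq_of_ae_eq_zero (Filter.Eventually.of_forall fun x hx => by
      linear_combination (-(E x * (z x * Real.sin (θ x) + (q x - ν) * y x * Real.cos (θ x)))) *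
        Real.sin_sq_add_cos_sq (θ x) + ((1 + q x - ν) * (Real.cos (θ x) ^ 2 -
          Real.sin (θ x) ^ 2) * E x) * hκ0 x (Ioo_subset_Icc_self hx)) hx
    simpa [hy0, h.zero, hE0] using h1
  have hy_eq : ∀ x ∈ Icc (0 : ℝ) 1,
      y x = (y x * Real.sin (θ x) + z x * Real.cos (θ x)) * Real.sin (θ x) := fun x hx => by
    linear_combination (-y x) * Real.sin_sq_add_cos_sq (θ x) + Real.cos (θ x) * hκ0 x hx
  have hz0 : z 0 ≠ 0 := by
    intro h0
    refine hyx₁ ?_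
    have h1 := hρ0 x₁ hx₁
    rw [h0] at h1
    rw [hy_eq x₁ hx₁, (mul_eq_zero.1 h1).resolve_right (hEpos x₁ hx₁).ne', zero_mul]
  have hne : y x * Real.sin (θ x) + z x * Real.cos (θ x) ≠ 0 := by
    intro h0
    exact hz0 (by rw [← hρ0 x hx, h0, zero_mul])
  refine ⟨fun h0 => ?_, fun h0 => by rw [hy_eq x hx, h0, mul_zero]⟩
  have h1 := hy_eq x hx
  rw [h0] at h1 hne
  exact (mul_eq_zero.1 h1.symm).resolve_left hne

theorem isDirichletEigenvalue_iff (hq : IntervalIntegrable q volume 0 1)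
    (h : IsPruferAngle q ν θ) : IsDirichletEigenvalue q ν ↔ Real.sin (θ 1) = 0 :=
  ⟨fun ⟨_, hy⟩ => (h.eigenfunction_eq_zero_iff hq hy (by simp)).1 hy.2.2.1,
    h.exists_eigenfunction hq⟩

/-- For sufficiently negative spectral parameter, the Prüfer angle stays below `π`. -/
theorem lt_pi_of_neg (hq : IntervalIntegrable q volume 0 1) {k : ℝ}
    (hk : ∫ t in (0 : ℝ)..1, |q t| < k) (h : IsPruferAngle q (-k ^ 2) θ) : θ 1 < Real.pi := by
  have hk0 : 0 < k := (intervalIntegral.integral_nonneg zero_le_one fun t _ => abs_nonneg _).trans_lt hk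
  by_contra! hge
  obtain ⟨x₁, hx₁, hθ₁⟩ : Real.pi ∈ θ '' Icc 0 1 :=
    intermediate_value_Icc zero_le_one h.continuousOn ⟨by rw [h.zero]; positivity, hge⟩
  obtain ⟨r, hr, hy, hz⟩ := h.exists_solution hq
  set y := fun x => r x * Real.sin (θ x) with hydef
  set z := fun x => r x * Real.cos (θ x) with hzdef
  have hy0 : y 0 = 0 := by simp [hydef, h.zero]
  have hy1 : y x₁ = 0 := by simp [hydef, hθ₁]
  have hx₁0 := hx₁.1
  have hyc := (hy.continuousOn zero_le_one).mono (Icc_subset_Icc_right hx₁.2)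
  have hzc := (hz.continuousOn zero_le_one).mono (Icc_subset_Icc_right hx₁.2)
  -- The contradiction comes from estimating the energy in terms of the maximum `y c ^ 2`: it is at
  -- least `k * y c ^ 2` and at most `(∫ |q|) * y c ^ 2`, while `∫ |q| < k`.
  obtain ⟨c, hc, hcmax⟩ := isCompact_Icc.exists_isMaxOn (nonempty_Icc.2 hx₁0) (hyc.pow 2)
  have hqx : IntervalIntegrable q volume 0 x₁ := hq.mono_set (by
    rw [uIcc_of_le hx₁0, uIcc_of_le zero_le_one]; exact Icc_subset_Icc_right hx₁.2)
  have hi1 : IntervalIntegrable (fun x => z x ^ 2 + k ^ 2 * y x ^ 2) volume 0 x₁ :=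
    ContinuousOn.intervalIntegrable (by rw [uIcc_of_le hx₁0]; fun_prop)
  have hi2 : IntervalIntegrable (fun x => q x * y x ^ 2) volume 0 x₁ :=
    hqx.mul_continuousOn (by rw [uIcc_of_le hx₁0]; fun_prop)
  have hyz := ((hy.mul hz zero_le_one).mono le_rfl hx₁0 hx₁.2).integral_eq_sub hx₁0
  -- This is `∫ (y z)' = 0`, as `y` vanishes at both ends.
  have henergy : (∫ x in (0 : ℝ)..x₁, (z x ^ 2 + k ^ 2 * y x ^ 2)) =
      - ∫ x in (0 : ℝ)..x₁, q x * y x ^ 2 := by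
    rw [eq_neg_iff_add_eq_zero, ← intervalIntegral.integral_add hi1 hi2]
    refine Eq.trans (intervalIntegral.integral_congr fun x _ => ?_) (hyz.trans ?_)
    · simp only [hydef, hzdef]; ring
    · change y x₁ * z x₁ - y 0 * z 0 = 0
      rw [hy0, hy1]; ring
  have hbound : - ∫ x in (0 : ℝ)..x₁, q x * y x ^ 2 ≤ (∫ t in (0 : ℝ)..1, |q t|) * y c ^ 2 := by
    calc - ∫ x in (0 : ℝ)..x₁, q x * y x ^ 2 ≤ ∫ x in (0 : ℝ)..x₁, |q x| * y c ^ 2 := by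
          rw [← intervalIntegral.integral_neg]
          refine intervalIntegral.integral_mono_on hx₁0 hi2.neg (hqx.abs.mul_const _) fun x hx => ?_
          calc -(q x * y x ^ 2) = (-q x) * y x ^ 2 := by ring
            _ ≤ |q x| * y x ^ 2 := by gcongr; exact neg_le_abs _
            _ ≤ |q x| * y c ^ 2 := by gcongr 1; exact hcmax hx
      _ = (∫ x in (0 : ℝ)..x₁, |q x|) * y c ^ 2 := intervalIntegral.integral_mul_const _ _
      _ ≤ _ := by
          gcongr
          exact intervalIntegral.integral_mono_interval le_rfl hx₁0 hx₁.2
            (Filter.Eventually.of_forall fun t => abs_nonneg _) hq.abs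
  have hcx := ((hy.mul hy zero_le_one).mono le_rfl hc.1 (hc.2.trans hx₁.2))
  -- Integrate `k (y²)' = 2 k y z ≤ z² + k² y²` from `0` to `c`.
  have hpt : k * y c ^ 2 ≤ ∫ x in (0 : ℝ)..x₁, (z x ^ 2 + k ^ 2 * y x ^ 2) := by
    have h1 := hcx.integral_eq_sub hc.1
    have h2 : k * y c ^ 2 = ∫ x in (0 : ℝ)..c, k * (z x * y x + y x * z x) := by
      rw [intervalIntegral.integral_const_mul]
      change ∫ x in (0 : ℝ)..c, (z x * y x + y x * z x) = y c * y c - y 0 * y 0 at h1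
      rw [h1, hy0]; ring
    have hsub : Icc 0 c ⊆ Icc 0 x₁ := Icc_subset_Icc_right hc.2
    have hyc' := hyc.mono hsub
    have hzc' := hzc.mono hsub
    calc k * y c ^ 2 ≤ ∫ x in (0 : ℝ)..c, (z x ^ 2 + k ^ 2 * y x ^ 2) := by
          rw [h2]
          refine intervalIntegral.integral_mono_on hc.1
            (ContinuousOn.intervalIntegrable (by rw [uIcc_of_le hc.1]; fun_prop))
            (ContinuousOn.intervalIntegrable (by rw [uIcc_of_le hc.1]; fun_prop)) fun x _ => ?_
          nlinarith [sq_nonneg (z x - k * y x)]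
      _ ≤ _ := intervalIntegral.integral_mono_interval le_rfl hc.1 hc.2
            (Filter.Eventually.of_forall fun t => by positivity) hi1
  have hyc0 : y c ^ 2 ≤ 0 := by
    by_contra! hpos
    have := henergy ▸ hpt
    nlinarith
  obtain ⟨d, hd, hd'⟩ : (Real.pi / 2) ∈ θ '' Icc 0 x₁ :=
    intermediate_value_Icc hx₁0 (h.continuousOn.mono (Icc_subset_Icc_right hx₁.2))
      ⟨by rw [h.zero]; positivity, by rw [hθ₁]; linarith [Real.pi_pos]⟩
  have h1 : y d ^ 2 ≤ y c ^ 2 := hcmax hd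
  have h2 : y d = r d := by simp [hydef, hd']
  have h3 := hr d ⟨hd.1, hd.2.trans hx₁.2⟩
  rw [h2] at h1
  nlinarith [pow_pos h3 2]

end IsPruferAngle

/-! ### Counting zeros and eigenvalues. -/

theorem encard_add_one_of_image_eq {S : Set ℝ} {g : ℝ → ℝ} {n : ℕ} (hn : 0 < n) (hg : InjOn g S)
    (h : g '' S = (fun k : ℕ => (k : ℝ) * Real.pi) '' Ioo 0 n) : S.encard + 1 = n := by
  have h2 : InjOn (fun k : ℕ => (k : ℝ) * Real.pi) (Ioo 0 n) := fun a _ b _ hab => by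
    have := mul_right_cancel₀ Real.pi_ne_zero hab
    exact_mod_cast this
  rw [← hg.encard_image, h, h2.encard_image, ← Finset.coe_Ioo, encard_coe_eq_coe_finsetCard,
    Nat.card_Ioo]
  have : n - 0 - 1 + 1 = n := by omega
  exact_mod_cast this

theorem exists_nat_mul_pi_of_sin_eq_zero {x : ℝ} (hx : 0 < x) (h : Real.sin x = 0) :
    ∃ n : ℕ, 0 < n ∧ x = n * Real.pi := by
  obtain ⟨k, hk⟩ := Real.sin_eq_zero_iff.1 h
  have hk0 : 0 < k := by
    by_contra! hk0
    have : (k : ℝ) ≤ 0 := by exact_mod_cast hk0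
    nlinarith [Real.pi_pos]
  lift k to ℕ using hk0.le
  exact ⟨k, by exact_mod_cast hk0, by rw [← hk]; simp⟩

namespace IsPruferAngle

variable {q θ φ : ℝ → ℝ} {ν ν' : ℝ}

/-- The angle need not be monotone, but it passes multiples of `π` only upwards. It is therefore
injective on the zeros, with values exactly `k π` for `0 < k < n`, each attained by the intermediate
value theorem. -/
theorem encard_zeros (hq : IntervalIntegrable q volume 0 1) (h : IsPruferAngle q ν θ) {n : ℕ}
    {t : ℝ} (ht : t ∈ Ioc (0 : ℝ) 1) (hn : θ t = n * Real.pi) :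
    {s ∈ Ioo (0 : ℝ) t | Real.sin (θ s) = 0}.encard + 1 = (n : ℕ∞) := by
  have hn0 : 0 < n := by
    have h1 := h.pos hq ht
    rw [hn] at h1
    exact_mod_cast (pos_iff_pos_of_mul_pos h1).2 Real.pi_pos
  have hsub : ∀ s ∈ Ioo (0 : ℝ) t, s ∈ Icc (0 : ℝ) 1 := fun s hs => ⟨hs.1.le, hs.2.le.trans ht.2⟩
  refine encard_add_one_of_image_eq (g := θ) hn0 ?_ ?_
  · have key : ∀ a ∈ Ioo (0 : ℝ) t, ∀ b ∈ Ioo (0 : ℝ) t, Real.sin (θ a) = 0 → a < b →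
        θ a < θ b := by
      intro a ha b hb hsa hab
      obtain ⟨k, hk⟩ := Real.sin_eq_zero_iff.1 hsa
      rw [← hk]
      exact (h.sub_mul_pos hq (hsub a ha) (hsub b hb) hab).1 hk.symm
    rintro a ⟨ha, hsa⟩ b ⟨hb, hsb⟩ hab
    rcases lt_trichotomy a b with hlt | heq | hgt
    · exact absurd hab (key a ha b hb hsa hlt).ne
    · exact heq
    · exact absurd hab (key b hb a ha hsb hgt).ne'
  · ext v
    constructor
    · rintro ⟨s, ⟨hs, hss⟩, rfl⟩
      obtain ⟨k, hk0, hk⟩ := exists_nat_mul_pi_of_sin_eq_zero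
        (h.pos hq ⟨hs.1, (hsub s hs).2⟩) hss
      refine ⟨k, ⟨hk0, ?_⟩, hk.symm⟩
      have h1 := (h.sub_mul_pos hq (n := n) (hsub s hs) ⟨ht.1.le, ht.2⟩ hs.2).2 (by simp [hn])
      rw [hk] at h1
      have := lt_of_mul_lt_mul_right h1 Real.pi_pos.le
      exact_mod_cast this
    · rintro ⟨k, ⟨hk0, hkn⟩, rfl⟩
      have hk0' : (0 : ℝ) < k := by exact_mod_cast hk0
      have hkn' : (k : ℝ) < n := by exact_mod_cast hkn
      obtain ⟨s, hs, hs'⟩ : (k : ℝ) * Real.pi ∈ θ '' Ioo 0 t :=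
        intermediate_value_Ioo ht.1.le (h.continuousOn.mono (Icc_subset_Icc_right ht.2))
          ⟨by rw [h.zero]; positivity, by rw [hn]; gcongr⟩
      exact ⟨s, ⟨hs, by rw [hs']; exact Real.sin_nat_mul_pi k⟩, hs'⟩

/-- The value at `1` of the angle is continuous and strictly increasing in the spectral parameter
and below `π` far to the left, so the eigenvalues below `ν` correspond to the levels `k π` with `0 <
k < n`. -/
theorem encard_eigenvalues (hq : IntervalIntegrable q volume 0 1) (h : IsPruferAngle q ν θ) {n : ℕ}
    (hn : θ 1 = n * Real.pi) :
    {μ : ℝ | IsDirichletEigenvalue q μ ∧ μ < ν}.encard + 1 = (n : ℕ∞) := by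
  have hn0 : 0 < n := by
    have h1 := h.pos hq (x := 1) (by simp)
    rw [hn] at h1
    exact_mod_cast (pos_iff_pos_of_mul_pos h1).2 Real.pi_pos
  choose Θ hΘ using IsPruferAngle.exists hq
  have hmono : StrictMono fun μ => Θ μ 1 := fun a b hab => (hΘ a).lt_of_lt hq (hΘ b) hab
  have hcont : Continuous fun μ => Θ μ 1 := by
    refine continuous_iff_continuousAt.2 fun μ => ?_
    rw [ContinuousAt, tendsto_iff_dist_tendsto_zero]
    refine squeeze_zero (fun _ => dist_nonneg) (fun μ' => (hΘ μ).abs_sub_le hq (hΘ μ')) ?_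
    have : Continuous fun μ' : ℝ =>
        |μ' - μ| * Real.exp (2 * ∫ t in (0 : ℝ)..1, |μ - 1 - q t|) := by fun_prop
    simpa using this.tendsto μ
  have hν : Θ ν 1 = n * Real.pi := by
    rw [(hΘ ν).unique hq h (by simp), hn]
  refine encard_add_one_of_image_eq (g := fun μ => Θ μ 1) hn0 hmono.injective.injOn ?_
  ext v
  constructor
  · rintro ⟨μ, ⟨hμ, hμν⟩, rfl⟩
    obtain ⟨k, hk0, hk⟩ := exists_nat_mul_pi_of_sin_eq_zero ((hΘ μ).pos hq (by simp))
      (((hΘ μ).isDirichletEigenvalue_iff hq).1 hμ)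
    refine ⟨k, ⟨hk0, ?_⟩, hk.symm⟩
    have h1 := hmono hμν
    simp only [hν, hk] at h1
    have := lt_of_mul_lt_mul_right h1 Real.pi_pos.le
    exact_mod_cast this
  · rintro ⟨k, ⟨hk0, hkn⟩, rfl⟩
    have hk0' : (1 : ℝ) ≤ k := by exact_mod_cast hk0
    have hkn' : (k : ℝ) < n := by exact_mod_cast hkn
    obtain ⟨a, ha⟩ := exists_gt (max (∫ t in (0 : ℝ)..1, |q t|) 0)
    have h1 := (hΘ (-a ^ 2)).lt_pi_of_neg hq ((le_max_left _ _).trans_lt ha)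
    have hle : -a ^ 2 ≤ ν := by
      by_contra! hlt
      have h2 := hmono hlt
      simp only [hν] at h2
      have : (1 : ℝ) ≤ n := by exact_mod_cast hn0
      nlinarith [Real.pi_pos]
    obtain ⟨μ, hμ, hμ'⟩ : (k : ℝ) * Real.pi ∈ (fun μ => Θ μ 1) '' Ico (-a ^ 2) ν :=
      intermediate_value_Ico hle hcont.continuousOn
        ⟨by nlinarith [Real.pi_pos], by simp only [hν]; gcongr⟩
    refine ⟨μ, ⟨((hΘ μ).isDirichletEigenvalue_iff hq).2 ?_, hμ.2⟩, hμ'⟩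
    simp only at hμ'
    rw [hμ']
    exact Real.sin_nat_mul_pi k

theorem isNthEigenvalue_iff (hq : IntervalIntegrable q volume 0 1) (h : IsPruferAngle q ν θ)
    {m : ℕ} : IsNthEigenvalue q m ν ↔ θ 1 = m * Real.pi := by
  constructor
  · rintro ⟨he, hc⟩
    obtain ⟨k, -, hk⟩ := exists_nat_mul_pi_of_sin_eq_zero (h.pos hq (by simp))
      ((h.isDirichletEigenvalue_iff hq).1 he)
    have h1 := h.encard_eigenvalues hq hk
    rw [hc] at h1
    rw [hk, Nat.cast_inj.1 h1]
  · intro hm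
    exact ⟨(h.isDirichletEigenvalue_iff hq).2 (by rw [hm]; exact Real.sin_nat_mul_pi m),
      h.encard_eigenvalues hq hm⟩

end IsPruferAngle

/-- This removes eigenfunctions and counting from the problem: the constraint becomes a three-point
condition on the angle, with the spectral parameter free. -/
theorem isNode_iff {q : ℝ → ℝ} (hq : IntervalIntegrable q volume 0 1) {i m : ℕ} {t : ℝ}
    (ht : t ∈ Ioo (0 : ℝ) 1) :
    IsNode q i m t ↔ ∃ ν θ, IsPruferAngle q ν θ ∧ θ t = i * Real.pi ∧ θ 1 = m * Real.pi := by
  have hset : ∀ {ν θ y}, IsPruferAngle q ν θ → IsDirichletEigenfunction q ν y →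
      {s ∈ Ioo (0 : ℝ) t | y s = 0} = {s ∈ Ioo (0 : ℝ) t | Real.sin (θ s) = 0} := by
    intro ν θ y hθ hy
    ext s
    exact and_congr_right fun hs =>
      hθ.eigenfunction_eq_zero_iff hq hy ⟨hs.1.le, (hs.2.trans ht.2).le⟩
  have ht' : t ∈ Icc (0 : ℝ) 1 := Ioo_subset_Icc_self ht
  constructor
  · rintro ⟨ν, y, hν, hy, -, hyt, hc⟩
    obtain ⟨θ, hθ⟩ := IsPruferAngle.exists hq ν
    refine ⟨ν, θ, hθ, ?_, (hθ.isNthEigenvalue_iff hq).1 hν⟩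
    obtain ⟨k, -, hk⟩ := exists_nat_mul_pi_of_sin_eq_zero (hθ.pos hq ⟨ht.1, ht.2.le⟩)
      ((hθ.eigenfunction_eq_zero_iff hq hy ht').1 hyt)
    have h1 := hθ.encard_zeros hq ⟨ht.1, ht.2.le⟩ hk
    rw [← hset hθ hy, hc] at h1
    rw [hk, Nat.cast_inj.1 h1]
  · rintro ⟨ν, θ, hθ, hi, hm⟩
    obtain ⟨y, hy⟩ := hθ.exists_eigenfunction hq (by rw [hm]; exact Real.sin_nat_mul_pi m)
    refine ⟨ν, y, (hθ.isNthEigenvalue_iff hq).2 hm, hy, ht,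
      (hθ.eigenfunction_eq_zero_iff hq hy ht').2 (by rw [hi]; exact Real.sin_nat_mul_pi i), ?_⟩
    rw [hset hθ hy]
    exact hθ.encard_zeros hq ⟨ht.1, ht.2.le⟩ hi

/-! ### Signed powers and strict convexity of `|x|^p`. -/

/-- The odd power function `x ↦ sgn(x) |x|^a`. -/
noncomputable def sgnPow (a x : ℝ) : ℝ := if 0 ≤ x then x ^ a else -(-x) ^ a

section SgnPow

variable {a x y : ℝ}

theorem sgnPow_of_nonneg (hx : 0 ≤ x) : sgnPow a x = x ^ a := if_pos hx

theorem sgnPow_of_neg (hx : x < 0) : sgnPow a x = -(-x) ^ a := if_neg hx.not_ge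

theorem sgnPow_zero (ha : 0 < a) : sgnPow a 0 = 0 := by
  rw [sgnPow_of_nonneg le_rfl, Real.zero_rpow ha.ne']

theorem sgnPow_neg (ha : 0 < a) : sgnPow a (-x) = -sgnPow a x := by
  rcases lt_trichotomy x 0 with h | rfl | h
  · rw [sgnPow_of_neg h, sgnPow_of_nonneg (by linarith), neg_neg]
  · simp [sgnPow_zero ha]
  · rw [sgnPow_of_nonneg h.le, sgnPow_of_neg (by linarith), neg_neg]

theorem sgnPow_pos (hx : 0 < x) : 0 < sgnPow a x := by
  rw [sgnPow_of_nonneg hx.le]; exact Real.rpow_pos_of_pos hx a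

theorem sgnPow_neg_of_neg (hx : x < 0) : sgnPow a x < 0 := by
  rw [sgnPow_of_neg hx]; exact neg_neg_of_pos (Real.rpow_pos_of_pos (neg_pos.2 hx) a)

theorem continuous_sgnPow (ha : 0 < a) : Continuous (sgnPow a) := by
  refine Continuous.if_le (Real.continuous_rpow_const ha.le)
    ((Real.continuous_rpow_const ha.le).comp continuous_neg).neg continuous_const continuous_id ?_
  rintro x rfl
  simp [Real.zero_rpow ha.ne']

theorem sgnPow_mul_of_nonneg (hy : 0 < y) : sgnPow a (x * y) = sgnPow a x * y ^ a := by
  rcases le_or_gt 0 x with h | h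
  · rw [sgnPow_of_nonneg h, sgnPow_of_nonneg (by positivity), Real.mul_rpow h hy.le]
  · rw [sgnPow_of_neg h, sgnPow_of_neg (by nlinarith), ← neg_mul, Real.mul_rpow (by linarith) hy.le]
    ring

theorem sgnPow_mul_self (ha : 0 < a) : sgnPow a x * x = |x| ^ (a + 1) := by
  rcases le_or_gt 0 x with h | h
  · rw [sgnPow_of_nonneg h, abs_of_nonneg h, Real.rpow_add_one' h (by linarith)]
  · rw [sgnPow_of_neg h, abs_of_neg h, Real.rpow_add_one' (by linarith) (by linarith)]
    ring

/-- Strict Bernoulli for `s ≥ 0`; for `s < 0` the left side is below `1 - p < 0`. -/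
theorem one_add_mul_sub_lt_abs_rpow {p s : ℝ} (hp : 1 < p) (hs : s ≠ 1) :
    1 + p * (s - 1) < |s| ^ p := by
  rcases le_or_gt 0 s with h | h
  · have := one_add_mul_self_lt_rpow_one_add (s := s - 1) (by linarith) (sub_ne_zero.2 hs) hp
    rw [add_sub_cancel] at this
    rwa [abs_of_nonneg h]
  · have : 0 < |s| ^ p := Real.rpow_pos_of_pos (abs_pos.2 h.ne) p
    nlinarith

/-- Strict convexity of `|x|^p`: it lies strictly above its tangent lines. -/
theorem tangent_lt_abs_rpow {p : ℝ} (hp : 1 < p) (hxy : x ≠ y) :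
    p * sgnPow (p - 1) y * x - (p - 1) * |y| ^ p < |x| ^ p := by
  -- For `y > 0` homogeneity reduces the claim to Bernoulli at `s = x / y`; negative `y` follow by
  -- odd symmetry.
  have key : ∀ y > 0, ∀ x, x ≠ y →
      p * sgnPow (p - 1) y * x - (p - 1) * |y| ^ p < |x| ^ p := by
    intro y hy x hxy
    have h1 := one_add_mul_sub_lt_abs_rpow (s := x / y) hp (by rwa [Ne, div_eq_one_iff_eq hy.ne'])
    have h2 : |y| ^ p = y ^ (p - 1) * y := by
      rw [abs_of_pos hy, ← Real.rpow_add_one hy.ne', sub_add_cancel]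
    have h3 : |x| ^ p = |x / y| ^ p * |y| ^ p := by
      rw [← Real.mul_rpow (abs_nonneg _) (abs_nonneg _), ← abs_mul, div_mul_cancel₀ _ hy.ne']
    have h4 : 0 < |y| ^ p := Real.rpow_pos_of_pos (abs_pos.2 hy.ne') p
    have h5 := mul_lt_mul_of_pos_right h1 h4
    rw [← h3] at h5
    refine lt_of_eq_of_lt ?_ h5
    rw [h2, sgnPow_of_nonneg hy.le]
    field_simp
    ring
  rcases lt_trichotomy y 0 with h | rfl | h
  · have := key (-y) (neg_pos.2 h) (-x) (by simpa using hxy)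
    rw [sgnPow_neg (by linarith), abs_neg, abs_neg] at this
    linarith
  · rw [sgnPow_zero (by linarith), abs_zero, Real.zero_rpow (by linarith)]
    simpa using Real.rpow_pos_of_pos (abs_pos.2 hxy) p
  · exact key y h x hxy

theorem tangent_eq_abs_rpow {p : ℝ} (hp : 1 < p) :
    p * sgnPow (p - 1) y * y - (p - 1) * |y| ^ p = |y| ^ p := by
  rw [mul_assoc, sgnPow_mul_self (by linarith), sub_add_cancel]; ring

end SgnPow

/-! ### The dual exponent, the radicand and its singular integrals. -/

section ConjExponent

variable {p : ℝ}

theorem one_lt_conjExponent (hp : 3 / 2 < p) : 1 < p.conjExponent :=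
  (Real.HolderConjugate.conjExponent (by linarith)).symm.lt

theorem conjExponent_lt_three (hp : 3 / 2 < p) : p.conjExponent < 3 := by
  rw [Real.conjExponent, div_lt_iff₀ (by linarith)]; linarith

theorem sub_one_mul_conjExponent (hp : 3 / 2 < p) : (p - 1) * p.conjExponent = p := by
  rw [Real.conjExponent]; field_simp [show p - 1 ≠ 0 by linarith]

theorem inv_conjExponent (hp : 3 / 2 < p) : p.conjExponent⁻¹ = 1 - p⁻¹ := by
  rw [Real.conjExponent, inv_div]; field_simp [show p ≠ 0 by linarith]

end ConjExponent

/-- The radicand with signed parameter `b = σ α`. -/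
noncomputable def rad (p b t : ℝ) : ℝ :=
  1 - t ^ 2 - b / p.conjExponent * (1 - t ^ (2 * p.conjExponent))

/-- Integrals against the weight `1 / √rad`. -/
noncomputable def radIntegral (p : ℝ) (w : ℝ → ℝ) (b : ℝ) : ℝ :=
  ∫ t in (0 : ℝ)..1, w t / √(rad p b t)

section Rad

variable {p b b₁ b₂ t : ℝ}

theorem rpow_two_mul_eq (ht : 0 ≤ t) (r : ℝ) : t ^ (2 * r) = (t ^ 2) ^ r := by
  rw [Real.rpow_mul ht, Real.rpow_two]

theorem one_sub_rpow_le (hp : 3 / 2 < p) (ht : 0 ≤ t) :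
    1 - t ^ (2 * p.conjExponent) ≤ p.conjExponent * (1 - t ^ 2) := by
  have h := one_add_mul_self_le_rpow_one_add (s := t ^ 2 - 1) (by nlinarith)
    (one_lt_conjExponent hp).le
  rw [add_sub_cancel] at h
  rw [rpow_two_mul_eq ht]
  linarith

theorem one_sub_sq_le (hp : 3 / 2 < p) (ht : t ∈ Icc (0 : ℝ) 1) :
    1 - t ^ 2 ≤ 1 - t ^ (2 * p.conjExponent) := by
  have h := Real.rpow_le_rpow_of_exponent_ge' ht.1 ht.2 zero_le_two
    (show (2 : ℝ) ≤ 2 * p.conjExponent by linarith [one_lt_conjExponent hp])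
  rw [Real.rpow_two] at h
  linarith

theorem rad_anti (hp : 3 / 2 < p) (ht : t ∈ Icc (0 : ℝ) 1) (h : b₁ ≤ b₂) :
    rad p b₂ t ≤ rad p b₁ t := by
  have h1 := one_lt_conjExponent hp
  have h2 := one_sub_sq_le hp ht
  have h3 : t ^ 2 ≤ 1 := by nlinarith [ht.1, ht.2]
  have h4 : b₁ / p.conjExponent ≤ b₂ / p.conjExponent := by gcongr
  rw [rad, rad]
  nlinarith

theorem rad_strictAnti (hp : 3 / 2 < p) (ht : t ∈ Ico (0 : ℝ) 1) (h : b₁ < b₂) :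
    rad p b₂ t < rad p b₁ t := by
  have h1 := one_lt_conjExponent hp
  have h2 := one_sub_sq_le hp ⟨ht.1, ht.2.le⟩
  have h3 : t ^ 2 < 1 := by nlinarith [ht.1, ht.2]
  have h4 : b₁ / p.conjExponent < b₂ / p.conjExponent := by gcongr
  rw [rad, rad]
  nlinarith

/-- For `b < 1` the radicand vanishes at `t = 1` no faster than a multiple of `1 - t²`, so `1 /
√rad` has only an arcsine singularity. The constant degenerates as `b → 1`. -/
theorem le_rad (hp : 3 / 2 < p) (hb : 0 ≤ b) (ht : t ∈ Icc (0 : ℝ) 1) :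
    (1 - b) * (1 - t ^ 2) ≤ rad p b t := by
  have h1 := one_lt_conjExponent hp
  have h2 := one_sub_rpow_le hp ht.1
  have h3 : b / p.conjExponent * (1 - t ^ (2 * p.conjExponent)) ≤ b * (1 - t ^ 2) := by
    calc _ ≤ b / p.conjExponent * (p.conjExponent * (1 - t ^ 2)) := by gcongr
      _ = _ := by field_simp
  rw [rad]
  linarith

theorem le_rad_of_nonpos (hp : 3 / 2 < p) (hb : b ≤ 0) (ht : t ∈ Icc (0 : ℝ) 1) :
    (1 - b / p.conjExponent) * (1 - t ^ 2) ≤ rad p b t := by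
  have h1 := one_lt_conjExponent hp
  have h2 := one_sub_sq_le hp ht
  have h3 : b / p.conjExponent ≤ 0 := div_nonpos_of_nonpos_of_nonneg hb (by linarith)
  rw [rad]
  nlinarith

theorem rad_pos (hp : 3 / 2 < p) (hb : b < 1) (ht : t ∈ Ico (0 : ℝ) 1) : 0 < rad p b t := by
  have h3 : t ^ 2 < 1 := by nlinarith [ht.1, ht.2]
  calc 0 < (1 - max b 0) * (1 - t ^ 2) :=
        mul_pos (by simp [hb]) (by linarith)
    _ ≤ rad p (max b 0) t := le_rad hp (le_max_right _ _) ⟨ht.1, ht.2.le⟩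
    _ ≤ _ := rad_anti hp ⟨ht.1, ht.2.le⟩ (le_max_left _ _)

theorem rad_one : rad p b 1 = 0 := by simp [rad]

theorem continuous_rpow_conj (hp : 3 / 2 < p) :
    Continuous fun t : ℝ => t ^ (2 * p.conjExponent) :=
  Real.continuous_rpow_const (by linarith [one_lt_conjExponent hp])

theorem continuous_rad (hp : 3 / 2 < p) (b : ℝ) : Continuous (rad p b) := by
  have := continuous_rpow_conj hp
  unfold rad
  fun_prop

/-- The integrand is the nonnegative derivative of `arcsin`, which is continuous up to `1`. -/
theorem intervalIntegrable_one_div_sqrt :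
    IntervalIntegrable (fun t : ℝ => 1 / √(1 - t ^ 2)) volume 0 1 := by
  refine intervalIntegral.intervalIntegrable_deriv_of_nonneg Real.continuous_arcsin.continuousOn
    (fun x hx => ?_) fun x _ => by positivity
  rw [min_eq_left zero_le_one, max_eq_right zero_le_one] at hx
  exact Real.hasDerivAt_arcsin (by linarith [hx.1]) hx.2.ne

theorem one_div_sqrt_rad_le (hp : 3 / 2 < p) (hb : b ≤ b₂) (hb0 : 0 ≤ b₂) (hb1 : b₂ < 1)
    (ht : t ∈ Icc (0 : ℝ) 1) : 1 / √(rad p b t) ≤ 1 / √(1 - b₂) * (1 / √(1 - t ^ 2)) := by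
  rcases eq_or_lt_of_le ht.2 with rfl | h
  -- At `t = 1` both sides are zero by the convention `1 / 0 = 0`.
  · simp [rad_one]
  have h3 : t ^ 2 < 1 := by nlinarith [ht.1, ht.2]
  rw [one_div_mul_one_div, ← Real.sqrt_mul (by linarith)]
  have h4 : 0 < (1 - b₂) * (1 - t ^ 2) := mul_pos (by linarith) (by linarith)
  have h5 := (le_rad hp hb0 ht).trans (rad_anti hp ht hb)
  have := Real.sqrt_pos.2 h4
  gcongr

theorem intervalIntegrable_div_sqrt_rad (hp : 3 / 2 < p) (hb : b < 1) {w : ℝ → ℝ}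
    (hw : Continuous w) : IntervalIntegrable (fun t => w t / √(rad p b t)) volume 0 1 := by
  have h1 : IntervalIntegrable (fun t => 1 / √(rad p b t)) volume 0 1 := by
    refine (intervalIntegrable_one_div_sqrt.const_mul (1 / √(1 - max b 0))).mono_fun' ?_ ?_
    · have := continuous_rad hp b
      exact Measurable.aestronglyMeasurable (by fun_prop)
    · refine (ae_restrict_iff' measurableSet_uIoc).2 (Filter.Eventually.of_forall fun t ht => ?_)
      rw [uIoc_of_le zero_le_one] at ht
      beta_reduce
      rw [Real.norm_of_nonneg (by positivity)]
      exact one_div_sqrt_rad_le hp (le_max_left _ _) (le_max_right _ _) (by simp [hb])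
        ⟨ht.1.le, ht.2⟩
  simpa [div_eq_mul_inv] using h1.continuousOn_mul hw.continuousOn

/-- Dominated convergence; one arcsine density dominates for all parameters below a fixed `b₂ < 1`.
-/
theorem continuousOn_radIntegral (hp : 3 / 2 < p) {w : ℝ → ℝ} (hw : Continuous w) :
    ContinuousOn (radIntegral p w) (Iio 1) := by
  intro b hb
  refine ContinuousAt.continuousWithinAt ?_
  obtain ⟨b₂, hb₂, hb₂1⟩ := exists_between (max_lt hb zero_lt_one : max b 0 < 1)
  have hev : ∀ᶠ x in nhds b, x < b₂ := Iio_mem_nhds ((le_max_left _ _).trans_lt hb₂)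
  refine intervalIntegral.continuousAt_of_dominated_interval
    (bound := fun t => |w t| * (1 / √(1 - b₂) * (1 / √(1 - t ^ 2)))) ?_ ?_ ?_ ?_
  · refine Filter.Eventually.of_forall fun x => ?_
    have := continuous_rad hp x
    exact Measurable.aestronglyMeasurable (by fun_prop)
  · filter_upwards [hev] with x hx
    refine Filter.Eventually.of_forall fun t ht => ?_
    rw [uIoc_of_le zero_le_one] at ht
    rw [Real.norm_eq_abs, div_eq_mul_one_div, abs_mul, abs_of_nonneg (a := 1 / √_) (by positivity)]
    gcongr
    exact one_div_sqrt_rad_le hp hx.le ((le_max_right _ _).trans hb₂.le) hb₂1 ⟨ht.1.le, ht.2⟩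
  · exact (intervalIntegrable_one_div_sqrt.const_mul _).continuousOn_mul hw.abs.continuousOn
  · filter_upwards [compl_mem_ae_iff.2 (measure_singleton (1 : ℝ))] with t ht1 ht
    rw [uIoc_of_le zero_le_one] at ht
    have h1 : 0 < rad p b t := rad_pos hp hb ⟨ht.1.le, lt_of_le_of_ne ht.2 ht1⟩
    have h2 : Continuous fun x => rad p x t := by unfold rad; fun_prop
    exact continuousAt_const.div (Real.continuous_sqrt.comp h2).continuousAt (Real.sqrt_pos.2 h1).ne'

theorem radIntegral_pos (hp : 3 / 2 < p) (hb : b < 1) {w : ℝ → ℝ} (hw : Continuous w)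
    (hpos : ∀ t ∈ Ioo (0 : ℝ) 1, 0 < w t) : 0 < radIntegral p w b := by
  refine intervalIntegral.intervalIntegral_pos_of_pos_on (intervalIntegrable_div_sqrt_rad hp hb hw)
    (fun t ht => ?_) zero_lt_one
  exact div_pos (hpos t ht) (Real.sqrt_pos.2 (rad_pos hp hb ⟨ht.1.le, ht.2⟩))

theorem radIntegral_strictMonoOn (hp : 3 / 2 < p) {w : ℝ → ℝ} (hw : Continuous w)
    (hpos : ∀ t ∈ Ioo (0 : ℝ) 1, 0 < w t) : StrictMonoOn (radIntegral p w) (Iio 1) := by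
  intro b₁ hb₁ b₂ hb₂ hlt
  have h1 := intervalIntegrable_div_sqrt_rad hp hb₁ hw
  have h2 := intervalIntegrable_div_sqrt_rad hp hb₂ hw
  rw [← sub_pos, radIntegral, radIntegral, ← intervalIntegral.integral_sub h2 h1]
  refine intervalIntegral.intervalIntegral_pos_of_pos_on (h2.sub h1) (fun t ht => ?_) zero_lt_one
  have h3 := rad_pos hp hb₂ ⟨ht.1.le, ht.2⟩
  have h4 := Real.sqrt_lt_sqrt h3.le (rad_strictAnti hp ⟨ht.1.le, ht.2⟩ hlt)
  exact sub_pos.2 (div_lt_div_of_pos_left (hpos t ht) (Real.sqrt_pos.2 h3) h4)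

end Rad

/-! ### Quarter period and moments as functions of the signed parameter. -/

/-- The quarter period `T`. -/
noncomputable def quarterT (p : ℝ) : ℝ → ℝ := radIntegral p fun _ => 1

/-- The moment `∫ t² / √rad`. -/
noncomputable def momentX (p : ℝ) : ℝ → ℝ := radIntegral p fun t => t ^ 2

/-- The moment `∫ t^(2 p*) / √rad`. -/
noncomputable def momentY (p : ℝ) : ℝ → ℝ := radIntegral p fun t => t ^ (2 * p.conjExponent)

/-- The signed function `V`. -/
noncomputable def signedV (p b : ℝ) : ℝ := sgnPow (p - 1) b * momentX p b

/-- Twice the action over a quarter period. -/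
noncomputable def actionK (p b : ℝ) : ℝ :=
  (1 - b / p.conjExponent) * quarterT p b - b / p * momentY p b

section Rad

variable {p b t : ℝ}

/-- Bernoulli for concave powers after splitting off `x` (if `p* ≤ 2`) or `x²` (if `2 < p* < 3`). It
bounds the radicand above by `(1 - t²)(1 - b + (1 - t²))`, uniformly up to `b = 1`, where the zero
at `t = 1` becomes double. -/
theorem rpow_le_quadratic (hp : 3 / 2 < p) {x : ℝ} (hx : x ∈ Icc (0 : ℝ) 1) :
    x ^ p.conjExponent ≤
      1 - p.conjExponent * (1 - x) + p.conjExponent * (1 - x) ^ 2 := by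
  have hr1 := one_lt_conjExponent hp
  have hr3 := conjExponent_lt_three hp
  set r := p.conjExponent
  obtain ⟨hx0, hx1⟩ := hx
  rcases le_or_gt r 2 with h | h
  · have h1 := rpow_one_add_le_one_add_mul_self (s := x - 1) (by linarith) (p := r - 1)
      (by linarith) (by linarith)
    rw [add_sub_cancel] at h1
    have h2 : x ^ r = x ^ (r - 1) * x := by
      rw [← Real.rpow_add_one' hx0 (by linarith), sub_add_cancel]
    rw [h2]
    nlinarith [mul_le_mul_of_nonneg_right h1 hx0, sq_nonneg (1 - x)]
  · have h1 := rpow_one_add_le_one_add_mul_self (s := x - 1) (by linarith) (p := r - 2)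
      (by linarith) (by linarith)
    rw [add_sub_cancel] at h1
    have h2 : x ^ r = x ^ (r - 2) * x ^ 2 := by
      rw [← Real.rpow_two, ← Real.rpow_add' hx0 (by linarith), sub_add_cancel]
    rw [h2]
    have h3 := mul_le_mul_of_nonneg_right h1 (sq_nonneg x)
    have h4 : 0 ≤ (3 - r) * (1 - x) ^ 2 := mul_nonneg (by linarith) (sq_nonneg _)
    have h5 : 0 ≤ (r - 2) * (1 - x) ^ 3 :=
      mul_nonneg (by linarith) (pow_nonneg (by linarith) 3)
    nlinarith

theorem rad_le (hp : 3 / 2 < p) (hb : b ∈ Icc (0 : ℝ) 1) (ht : t ∈ Icc (0 : ℝ) 1) :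
    rad p b t ≤ (1 - t ^ 2) * (1 - b + (1 - t ^ 2)) := by
  have hr1 := one_lt_conjExponent hp
  have h1 := rpow_le_quadratic hp (x := t ^ 2) ⟨sq_nonneg t, by nlinarith [ht.1, ht.2]⟩
  have h2 : b * ((1 - t ^ 2) - (1 - t ^ 2) ^ 2) ≤
      b / p.conjExponent * (1 - t ^ (2 * p.conjExponent)) := by
    rw [rpow_two_mul_eq ht.1, div_mul_eq_mul_div, le_div_iff₀ (by linarith), mul_assoc]
    refine mul_le_mul_of_nonneg_left ?_ hb.1
    linarith
  rw [rad]
  nlinarith [mul_nonneg (sub_nonneg.2 hb.2) (sq_nonneg (1 - t ^ 2))]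

/-- As `b → 1` the near-double zero produces a logarithmic divergence: away from a `δ`-neighbourhood
of `1` one has `√rad ≤ 3 (1 - t)`. -/
theorem le_quarterT (hp : 3 / 2 < p) {δ : ℝ} (hδ : δ ∈ Ioo (0 : ℝ) 1) :
    -Real.log δ / 3 ≤ quarterT p (1 - δ) := by
  have hint := intervalIntegrable_div_sqrt_rad hp (b := 1 - δ) (by linarith [hδ.1])
    (w := fun _ => 1) continuous_const
  have h01 : (0 : ℝ) ≤ 1 - δ := by linarith [hδ.2]
  have hlog : ∫ t in (0 : ℝ)..(1 - δ), (1 - t)⁻¹ = -Real.log δ := by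
    rw [intervalIntegral.integral_comp_sub_left fun x => x⁻¹, integral_inv_of_pos] <;>
      simp [hδ.1]
  have hc : ContinuousOn (fun t : ℝ => (1 - t)⁻¹) (uIcc 0 (1 - δ)) := by
    refine ContinuousOn.inv₀ (by fun_prop) fun t ht => ?_
    rw [uIcc_of_le h01] at ht
    have := ht.2
    have := hδ.1
    linarith
  calc -Real.log δ / 3 = ∫ t in (0 : ℝ)..(1 - δ), (1 - t)⁻¹ * (1 / 3) := by
        rw [intervalIntegral.integral_mul_const, hlog]; ring
    _ ≤ ∫ t in (0 : ℝ)..(1 - δ), 1 / √(rad p (1 - δ) t) := by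
        refine intervalIntegral.integral_mono_on h01 (hc.intervalIntegrable.mul_const _)
          (hint.mono_set ?_) fun t ht => ?_
        · rw [uIcc_of_le h01, uIcc_of_le zero_le_one]
          exact Icc_subset_Icc_right (by linarith [hδ.1])
        · have ht1 : t < 1 := by linarith [ht.2, hδ.1]
          have h1 := rad_le hp (b := 1 - δ) ⟨h01, by linarith [hδ.1]⟩ ⟨ht.1, ht1.le⟩
          have h2 := rad_pos hp (b := 1 - δ) (by linarith [hδ.1]) ⟨ht.1, ht1⟩
          have h3 : √(rad p (1 - δ) t) ≤ 3 * (1 - t) := by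
            rw [Real.sqrt_le_left (by linarith)]
            refine h1.trans ?_
            have h4 : δ ≤ 1 - t := by linarith [ht.2]
            have h5 : 1 - t ^ 2 ≤ 2 * (1 - t) := by nlinarith [sq_nonneg (1 - t)]
            have h6 : 0 ≤ 1 - t ^ 2 := by nlinarith [ht.1]
            have h7 : 1 - (1 - δ) + (1 - t ^ 2) ≤ 3 * (1 - t) := by linarith
            calc _ ≤ 2 * (1 - t) * (3 * (1 - t)) := by
                  gcongr
                  linarith [hδ.1]
              _ ≤ _ := by nlinarith [sq_nonneg (1 - t)]
          have h8 := Real.sqrt_pos.2 h2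
          calc (1 - t)⁻¹ * (1 / 3) = 1 / (3 * (1 - t)) := by
                field_simp
            _ ≤ _ := by gcongr
    _ ≤ _ := intervalIntegral.integral_mono_interval le_rfl h01 (by linarith [hδ.1])
        (Filter.Eventually.of_forall fun t => by positivity) hint

theorem quarterT_le (hp : 3 / 2 < p) (hb : b ≤ 0) :
    quarterT p b ≤ 1 / √(1 - b / p.conjExponent) * ∫ t in (0 : ℝ)..1, 1 / √(1 - t ^ 2) := by
  have hr1 := one_lt_conjExponent hp
  have h0 : b / p.conjExponent ≤ 0 := div_nonpos_of_nonpos_of_nonneg hb (by linarith)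
  rw [← intervalIntegral.integral_const_mul]
  refine intervalIntegral.integral_mono_on zero_le_one
    (intervalIntegrable_div_sqrt_rad hp (by linarith) continuous_const)
    (intervalIntegrable_one_div_sqrt.const_mul _) fun t ht => ?_
  rcases eq_or_lt_of_le ht.2 with rfl | h
  · simp [rad_one]
  have h3 : t ^ 2 < 1 := by nlinarith [ht.1, ht.2]
  rw [one_div_mul_one_div, ← Real.sqrt_mul (by linarith)]
  have h4 : 0 < (1 - b / p.conjExponent) * (1 - t ^ 2) := mul_pos (by linarith) (by linarith)
  have h5 := le_rad_of_nonpos hp hb ht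
  have := Real.sqrt_pos.2 h4
  gcongr

theorem quarterT_pos (hp : 3 / 2 < p) (hb : b < 1) : 0 < quarterT p b :=
  radIntegral_pos hp hb continuous_const fun _ _ => one_pos

theorem momentX_pos (hp : 3 / 2 < p) (hb : b < 1) : 0 < momentX p b :=
  radIntegral_pos hp hb (by fun_prop) fun t ht => by have := ht.1; positivity

theorem quarterT_strictMonoOn (hp : 3 / 2 < p) : StrictMonoOn (quarterT p) (Iio 1) :=
  radIntegral_strictMonoOn hp continuous_const fun _ _ => one_pos

theorem continuousOn_quarterT (hp : 3 / 2 < p) : ContinuousOn (quarterT p) (Iio 1) :=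
  continuousOn_radIntegral hp continuous_const

theorem image_quarterT (hp : 3 / 2 < p) : quarterT p '' Iio 1 = Ioi 0 := by
  have hr1 := one_lt_conjExponent hp
  refine Subset.antisymm (image_subset_iff.2 fun b hb => quarterT_pos hp hb) fun y hy => ?_
  rw [mem_Ioi] at hy
  obtain ⟨b₁, hb₁, hy₁⟩ : ∃ b < 1, y ≤ quarterT p b := by
    -- With `δ = exp (-3y)` the logarithmic lower bound is exactly `y`.
    refine ⟨1 - Real.exp (-(3 * y)), by simp [Real.exp_pos], ?_⟩
    refine le_trans (le_of_eq ?_) (le_quarterT hp ⟨Real.exp_pos _, ?_⟩)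
    · rw [Real.log_exp]; ring
    · rw [Real.exp_lt_one_iff]; linarith
  obtain ⟨b₂, hb₂, hy₂⟩ : ∃ b < 1, quarterT p b ≤ y := by
    set C := ∫ t in (0 : ℝ)..1, 1 / √(1 - t ^ 2)
    have hC : 0 ≤ C := intervalIntegral.integral_nonneg zero_le_one fun t _ => by positivity
    -- For `b = -p* z` the upper bound is `C / √(1 + z)`, which is at most `y` for this `z`.
    set z := (C / y) ^ 2 with hz
    have hz0 : 0 ≤ z := sq_nonneg _
    refine ⟨-(p.conjExponent * z), by nlinarith, (quarterT_le hp (by nlinarith)).trans ?_⟩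
    rw [neg_div, mul_div_cancel_left₀ _ (by linarith), sub_neg_eq_add, one_div, inv_mul_le_iff₀
      (Real.sqrt_pos.2 (by linarith)), ← div_le_iff₀ hy]
    exact Real.le_sqrt_of_sq_le (by linarith)
  have := (isPreconnected_Iio.image _ (continuousOn_quarterT hp)).ordConnected.out
    (mem_image_of_mem _ hb₂) (mem_image_of_mem _ hb₁)
  exact this ⟨hy₂, hy₁⟩

/-- The inverse of `quarterT`. -/
noncomputable def quarterTInv (p : ℝ) : ℝ → ℝ := Function.invFunOn (quarterT p) (Iio 1)

theorem quarterTInv_lt (hp : 3 / 2 < p) {y : ℝ} (hy : 0 < y) : quarterTInv p y < 1 :=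
  Function.invFunOn_mem (by rwa [← mem_image, image_quarterT hp])

theorem quarterT_quarterTInv (hp : 3 / 2 < p) {y : ℝ} (hy : 0 < y) :
    quarterT p (quarterTInv p y) = y :=
  Function.invFunOn_eq (by rwa [← mem_image, image_quarterT hp])

theorem quarterTInv_quarterT (hp : 3 / 2 < p) (hb : b < 1) :
    quarterTInv p (quarterT p b) = b :=
  (quarterT_strictMonoOn hp).injOn (quarterTInv_lt hp (quarterT_pos hp hb)) hb
    (quarterT_quarterTInv hp (quarterT_pos hp hb))

theorem quarterTInv_strictMonoOn (hp : 3 / 2 < p) : StrictMonoOn (quarterTInv p) (Ioi 0) := by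
  intro x hx y hy hxy
  rw [← (quarterT_strictMonoOn hp).lt_iff_lt (quarterTInv_lt hp hx) (quarterTInv_lt hp hy),
    quarterT_quarterTInv hp hx, quarterT_quarterTInv hp hy]
  exact hxy

theorem continuousOn_quarterTInv (hp : 3 / 2 < p) : ContinuousOn (quarterTInv p) (Ioi 0) := by
  intro y hy
  refine (continuousAt_of_monotoneOn_of_image_mem_nhds (quarterTInv_strictMonoOn hp).monotoneOn
    (Ioi_mem_nhds hy) ?_).continuousWithinAt
  refine Filter.mem_of_superset (Iio_mem_nhds (quarterTInv_lt hp hy)) fun b hb => ?_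
  exact ⟨_, quarterT_pos hp hb, quarterTInv_quarterT hp hb⟩

theorem continuousOn_momentX (hp : 3 / 2 < p) : ContinuousOn (momentX p) (Iio 1) :=
  continuousOn_radIntegral hp (by fun_prop)

theorem continuousOn_signedV (hp : 3 / 2 < p) : ContinuousOn (signedV p) (Iio 1) :=
  (continuous_sgnPow (by linarith)).continuousOn.mul (continuousOn_momentX hp)

theorem continuousOn_actionK (hp : 3 / 2 < p) : ContinuousOn (actionK p) (Iio 1) := by
  have h1 := continuousOn_quarterT hp
  have h2 : ContinuousOn (momentY p) (Iio 1) := continuousOn_radIntegral hp (continuous_rpow_conj hp)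
  unfold actionK
  fun_prop

/-- Pointwise, `rad p (-a) t / a = (1 - t²) / a + (1 - t^(2p*)) / p*` does not increase with `a`. -/
theorem sqrt_mul_momentX_neg_le (hp : 3 / 2 < p) {a₁ a₂ : ℝ} (h₁ : 0 < a₁) (h : a₁ ≤ a₂) :
    √a₁ * momentX p (-a₁) ≤ √a₂ * momentX p (-a₂) := by
  have hint : ∀ a > 0, IntervalIntegrable (fun t => t ^ 2 / √(rad p (-a) t)) volume 0 1 :=
    fun a ha => intervalIntegrable_div_sqrt_rad hp (by linarith) (by fun_prop)
  rw [momentX, radIntegral, ← intervalIntegral.integral_const_mul, radIntegral,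
    ← intervalIntegral.integral_const_mul]
  refine intervalIntegral.integral_mono_on zero_le_one ((hint a₁ h₁).const_mul _)
    ((hint a₂ (h₁.trans_le h)).const_mul _) fun t ht => ?_
  rcases eq_or_lt_of_le ht.2 with rfl | ht1
  · simp [rad_one]
  have hr1 := rad_pos hp (b := -a₁) (by linarith) ⟨ht.1, ht1⟩
  have hr2 := rad_pos hp (b := -a₂) (by linarith) ⟨ht.1, ht1⟩
  have key : √a₁ * √(rad p (-a₂) t) ≤ √a₂ * √(rad p (-a₁) t) := by
    rw [← Real.sqrt_mul h₁.le, ← Real.sqrt_mul (h₁.le.trans h)]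
    refine Real.sqrt_le_sqrt ?_
    have : 0 ≤ 1 - t ^ 2 := by nlinarith [ht.1]
    rw [rad, rad]
    have h3 := mul_le_mul_of_nonneg_right h this
    linear_combination h3
  have e1 := Real.sqrt_pos.2 hr1
  have e2 := Real.sqrt_pos.2 hr2
  rw [mul_div_assoc', mul_div_assoc', div_le_div_iff₀ e1 e2]
  nlinarith [mul_le_mul_of_nonneg_left key (sq_nonneg t)]

/-- For `b ≥ 0` both factors increase. For `b < 0` the moment decreases as `|b|` grows, but `√|b| *
momentX` does not, and the remaining power `|b|^(p - 3/2)` is strictly increasing since `p > 3/2`.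
-/
theorem signedV_strictMonoOn (hp : 3 / 2 < p) : StrictMonoOn (signedV p) (Iio 1) := by
  intro b₁ hb₁ b₂ hb₂ h
  have hX := radIntegral_strictMonoOn hp (w := fun t => t ^ 2) (by fun_prop)
    (fun t ht => by have := ht.1; positivity) hb₁ hb₂ h
  change momentX p b₁ < momentX p b₂ at hX
  have hX1 := momentX_pos hp hb₁
  have hX2 := momentX_pos hp hb₂
  rcases le_or_gt 0 b₁ with h1 | h1
  · rw [signedV, signedV, sgnPow_of_nonneg h1, sgnPow_of_nonneg (h1.trans h.le)]
    have := Real.rpow_lt_rpow h1 h (show 0 < p - 1 by linarith)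
    have h0 : 0 ≤ b₁ ^ (p - 1) := Real.rpow_nonneg h1 _
    nlinarith
  · have hneg1 : signedV p b₁ < 0 := mul_neg_of_neg_of_pos (sgnPow_neg_of_neg h1) hX1
    rcases le_or_gt 0 b₂ with h2 | h2
    · refine hneg1.trans_le ?_
      rw [signedV, sgnPow_of_nonneg h2]
      have := Real.rpow_nonneg h2 (p - 1)
      positivity
    · have h3 := sqrt_mul_momentX_neg_le hp (a₁ := -b₂) (a₂ := -b₁) (by linarith) (by linarith)
      rw [neg_neg, neg_neg] at h3
      have e : ∀ b < 0, signedV p b = -((-b) ^ (p - 3 / 2) * (√(-b) * momentX p b)) := by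
        intro b hb
        rw [signedV, sgnPow_of_neg hb, Real.sqrt_eq_rpow, ← mul_assoc,
          ← Real.rpow_add (by linarith)]
        ring_nf
      rw [e b₁ h1, e b₂ h2, neg_lt_neg_iff]
      have h4 := Real.rpow_lt_rpow (neg_nonneg.2 h2.le) (neg_lt_neg h)
        (show 0 < p - 3 / 2 by linarith)
      have h5 : 0 < √(-b₂) * momentX p b₂ :=
        mul_pos (Real.sqrt_pos.2 (by linarith)) hX2
      have h6 : 0 ≤ (-b₁) ^ (p - 3 / 2) := Real.rpow_nonneg (by linarith) _
      nlinarith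

theorem signedV_zero (hp : 3 / 2 < p) : signedV p 0 = 0 := by
  rw [signedV, sgnPow_zero (by linarith), zero_mul]

theorem hasDerivAt_rad (hp : 3 / 2 < p) (b t : ℝ) :
    HasDerivAt (rad p b) (-(2 * t) + 2 * b * t ^ (2 * p.conjExponent - 1)) t := by
  have hr := one_lt_conjExponent hp
  have h1 := Real.hasDerivAt_rpow_const (x := t) (p := 2 * p.conjExponent) (Or.inr (by linarith))
  have h2 := ((hasDerivAt_const t (1 : ℝ)).sub (hasDerivAt_pow 2 t)).sub
    (((hasDerivAt_const t (1 : ℝ)).sub h1).const_mul (b / p.conjExponent))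
  convert! h2 using 1
  have : p.conjExponent ≠ 0 := by linarith
  field_simp
  ring

/-- The identity obtained by integrating the derivative of `t √rad`. -/
theorem two_mul_momentX (hp : 3 / 2 < p) (hb : b < 1) :
    2 * momentX p b = (1 - b / p.conjExponent) * quarterT p b +
      (1 + p.conjExponent⁻¹) * (b * momentY p b) := by
  have hr := one_lt_conjExponent hp
  have i1 := intervalIntegrable_div_sqrt_rad hp hb (w := fun _ => 1) continuous_const
  have i2 := intervalIntegrable_div_sqrt_rad hp hb (w := fun t => t ^ 2) (by fun_prop)
  have i3 := intervalIntegrable_div_sqrt_rad hp hb (continuous_rpow_conj hp)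
  have hI := ((i1.const_mul (1 - b / p.conjExponent)).sub (i2.const_mul 2)).add
    (i3.const_mul ((1 + p.conjExponent⁻¹) * b))
  have hd := intervalIntegral.integral_eq_sub_of_hasDerivAt_of_le (f := fun t => t * √(rad p b t))
    zero_le_one (by have := continuous_rad hp b; fun_prop) (fun t ht => ?_) hI
  · rw [intervalIntegral.integral_add ((i1.const_mul _).sub (i2.const_mul _)) (i3.const_mul _),
      intervalIntegral.integral_sub (i1.const_mul _) (i2.const_mul _),
      intervalIntegral.integral_const_mul, intervalIntegral.integral_const_mul,
      intervalIntegral.integral_const_mul] at hd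
    simp only [rad_one, Real.sqrt_zero, zero_mul, mul_zero, sub_zero] at hd
    rw [momentX, quarterT, momentY, radIntegral, radIntegral, radIntegral]
    linarith
  · have hpos := rad_pos hp hb ⟨ht.1.le, ht.2⟩
    have h1 := (hasDerivAt_id t).mul ((hasDerivAt_rad hp b t).sqrt hpos.ne')
    convert! h1 using 1
    have h2 : t ^ (2 * p.conjExponent) = t ^ (2 * p.conjExponent - 1) * t := by
      rw [← Real.rpow_add_one ht.1.ne', sub_add_cancel]
    have h3 := Real.sqrt_pos.2 hpos
    have h4 := Real.sq_sqrt hpos.le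
    simp only [id, one_mul]
    have h5 : √(rad p b t) = rad p b t / √(rad p b t) := by
      rw [eq_div_iff h3.ne', ← sq, h4]
    rw [show √(rad p b t) + t * ((-(2 * t) + 2 * b * t ^ (2 * p.conjExponent - 1)) /
      (2 * √(rad p b t))) = rad p b t / √(rad p b t) + t * ((-(2 * t) + 2 * b *
        t ^ (2 * p.conjExponent - 1)) / (2 * √(rad p b t))) by rw [← h5]]
    have : rad p b t = 1 - t ^ 2 - b / p.conjExponent * (1 - t ^ (2 * p.conjExponent)) := rfl
    generalize √(rad p b t) = s at *
    rw [this, h2]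
    field_simp
    ring

/-- Eliminates `momentY`. Once `u L = 2 n quarterT`, the left side is, up to an explicit factor, the
derivative of `lobeEnergy` in `u` with `b` frozen. -/
theorem envelope_identity (hp : 3 / 2 < p) (hb : b < 1) :
    2 * p * ((1 - b / p.conjExponent) * quarterT p b) - (2 * p - 1) * actionK p b =
      2 * momentX p b := by
  rw [two_mul_momentX hp hb, actionK, inv_conjExponent hp]
  have : p ≠ 0 := by linarith
  field_simp
  ring

end Rad

/-! ### The normalized orbit in polar coordinates. -/

/-- Squared radius of the normalized orbit at height `t`. -/
noncomputable def orbitRho (p u b t : ℝ) : ℝ := t ^ 2 + u ^ 2 * rad p b t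

/-- The square of the sine of the polar angle of the normalized orbit at height `t`. -/
noncomputable def orbitSinSq (p u b t : ℝ) : ℝ := t ^ 2 / orbitRho p u b t

/-- The angular momentum flux of the normalized orbit. -/
noncomputable def orbitFlux (p b t : ℝ) : ℝ :=
  1 - b / p.conjExponent - b / p * t ^ (2 * p.conjExponent)

/-- Height of the normalized orbit in the direction with polar angle `θ`. -/
noncomputable def orbitTau (p u b θ : ℝ) : ℝ :=
  Function.invFunOn (orbitSinSq p u b) (Icc 0 1) (Real.sin θ ^ 2)

/-- Squared radius of the normalized orbit in the direction `θ`. -/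
noncomputable def orbitR (p u b θ : ℝ) : ℝ := orbitRho p u b (orbitTau p u b θ)

/-- The potential realized along the orbit. -/
noncomputable def orbitPot (p u b θ : ℝ) : ℝ :=
  b * u ^ 2 * orbitTau p u b θ ^ (2 * (p.conjExponent - 1))

/-- Angular speed along the orbit. -/
noncomputable def orbitSpeed (p u b θ : ℝ) : ℝ :=
  u ^ 2 * orbitFlux p b (orbitTau p u b θ) / orbitR p u b θ

section Orbit

variable {p u b t θ : ℝ}

theorem orbitRho_pos (hp : 3 / 2 < p) (hu : 0 < u) (hb : b < 1) (ht : t ∈ Icc (0 : ℝ) 1) :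
    0 < orbitRho p u b t := by
  rw [orbitRho]
  rcases eq_or_lt_of_le ht.2 with rfl | h
  · rw [rad_one]; norm_num
  · have := rad_pos hp hb ⟨ht.1, h⟩
    positivity

/-- For `b ≥ 0` the flux is at least `1 - b`, because `1/p + 1/p* = 1`; for `b < 0` every correction
is nonnegative. -/
theorem orbitFlux_pos (hp : 3 / 2 < p) (hb : b < 1) (ht : t ∈ Icc (0 : ℝ) 1) :
    0 < orbitFlux p b t := by
  have hr := one_lt_conjExponent hp
  have hp0 : 0 < p := by linarith
  have h1 : t ^ (2 * p.conjExponent) ≤ 1 := Real.rpow_le_one ht.1 ht.2 (by linarith)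
  have h2 : 0 ≤ t ^ (2 * p.conjExponent) := Real.rpow_nonneg ht.1 _
  have h3 := inv_conjExponent hp
  rw [orbitFlux, div_eq_mul_inv, h3, div_eq_mul_inv]
  have h4 : 0 < p⁻¹ := inv_pos.2 hp0
  have h5 : p⁻¹ < 1 := inv_lt_one_of_one_lt₀ (by linarith)
  rcases le_or_gt 0 b with h | h
  · have : b * p⁻¹ * t ^ (2 * p.conjExponent) ≤ b * p⁻¹ * 1 := by gcongr
    nlinarith
  · nlinarith [mul_nonneg (mul_nonneg (neg_nonneg.2 h.le) h4.le) h2]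

/-- Up to the factor `u²`, the left side is `y'² - y y''` on the orbit, which is squared radius
times angular speed. -/
theorem rad_add_sq_sub (hp : 3 / 2 < p) (b t : ℝ) :
    rad p b t + t ^ 2 - b * t ^ (2 * p.conjExponent) = orbitFlux p b t := by
  rw [rad, orbitFlux, div_eq_mul_inv, inv_conjExponent hp]
  field_simp
  ring

theorem continuous_orbitRho (hp : 3 / 2 < p) : Continuous (orbitRho p u b) := by
  have := continuous_rad hp b
  unfold orbitRho
  fun_prop

theorem continuous_orbitFlux (hp : 3 / 2 < p) : Continuous (orbitFlux p b) := by
  have := continuous_rpow_conj hp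
  unfold orbitFlux
  fun_prop

theorem continuousOn_orbitSinSq (hp : 3 / 2 < p) (hu : 0 < u) (hb : b < 1) :
    ContinuousOn (orbitSinSq p u b) (Icc 0 1) :=
  (continuous_pow 2).continuousOn.div (continuous_orbitRho hp).continuousOn
    fun _ ht => (orbitRho_pos hp hu hb ht).ne'

/-- The derivative is a positive multiple of the flux. This is star-shapedness of the orbit: the
direction determines the height, which makes `orbitTau` a genuine inverse. -/
theorem orbitSinSq_strictMonoOn (hp : 3 / 2 < p) (hu : 0 < u) (hb : b < 1) :
    StrictMonoOn (orbitSinSq p u b) (Icc 0 1) := by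
  refine strictMonoOn_of_deriv_pos (convex_Icc 0 1) (continuousOn_orbitSinSq hp hu hb) ?_
  intro t ht
  rw [interior_Icc] at ht
  have hρ := orbitRho_pos hp hu hb (Ioo_subset_Icc_self ht)
  have hfl := orbitFlux_pos hp hb (Ioo_subset_Icc_self ht)
  have h1 := (hasDerivAt_pow 2 t).add ((hasDerivAt_rad hp b t).const_mul (u ^ 2))
  have h2 : HasDerivAt (orbitSinSq p u b) _ t := (hasDerivAt_pow 2 t).div h1 hρ.ne'
  rw [h2.deriv]
  refine div_pos ?_ (pow_pos hρ 2)
  have h3 : t ^ (2 * p.conjExponent) = t ^ (2 * p.conjExponent - 1) * t := by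
    rw [← Real.rpow_add_one ht.1.ne', sub_add_cancel]
  have h4 := rad_add_sq_sub hp b t
  rw [h3] at h4
  have h5 : 0 < 2 * t * u ^ 2 * orbitFlux p b t := by have := ht.1; positivity
  rw [← h4] at h5
  refine h5.trans_eq ?_
  rw [orbitRho]
  push_cast
  ring

theorem orbitSinSq_zero : orbitSinSq p u b 0 = 0 := by simp [orbitSinSq]

theorem orbitSinSq_one : orbitSinSq p u b 1 = 1 := by simp [orbitSinSq, orbitRho, rad_one]

theorem image_orbitSinSq (hp : 3 / 2 < p) (hu : 0 < u) (hb : b < 1) :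
    orbitSinSq p u b '' Icc 0 1 = Icc 0 1 := by
  refine Subset.antisymm (image_subset_iff.2 fun t ht => ?_) ?_
  · have hm := (orbitSinSq_strictMonoOn hp hu hb).monotoneOn
    have h0 := hm ⟨le_rfl, zero_le_one⟩ ht ht.1
    have h1 := hm ht ⟨zero_le_one, le_rfl⟩ ht.2
    rw [orbitSinSq_zero] at h0
    rw [orbitSinSq_one] at h1
    exact ⟨h0, h1⟩
  · have := intermediate_value_Icc zero_le_one (continuousOn_orbitSinSq hp hu hb)
    rwa [orbitSinSq_zero, orbitSinSq_one] at this

theorem sin_sq_mem_Icc (θ : ℝ) : Real.sin θ ^ 2 ∈ Icc (0 : ℝ) 1 :=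
  ⟨sq_nonneg _, Real.sin_sq_le_one θ⟩

theorem orbitTau_mem (hp : 3 / 2 < p) (hu : 0 < u) (hb : b < 1) (θ : ℝ) :
    orbitTau p u b θ ∈ Icc (0 : ℝ) 1 :=
  Function.invFunOn_mem (by
    rw [← mem_image, image_orbitSinSq hp hu hb]; exact sin_sq_mem_Icc θ)

theorem orbitSinSq_orbitTau (hp : 3 / 2 < p) (hu : 0 < u) (hb : b < 1) (θ : ℝ) :
    orbitSinSq p u b (orbitTau p u b θ) = Real.sin θ ^ 2 :=
  Function.invFunOn_eq (by
    rw [← mem_image, image_orbitSinSq hp hu hb]; exact sin_sq_mem_Icc θ)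

theorem orbitTau_eq (hp : 3 / 2 < p) (hu : 0 < u) (hb : b < 1) (ht : t ∈ Icc (0 : ℝ) 1)
    (h : orbitSinSq p u b t = Real.sin θ ^ 2) : orbitTau p u b θ = t :=
  (orbitSinSq_strictMonoOn hp hu hb).injOn (orbitTau_mem hp hu hb θ) ht
    ((orbitSinSq_orbitTau hp hu hb θ).trans h.symm)

theorem continuous_orbitTau (hp : 3 / 2 < p) (hu : 0 < u) (hb : b < 1) :
    Continuous (orbitTau p u b) := by
  have hbij : BijOn (orbitSinSq p u b) (Icc 0 1) (Icc 0 1) := by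
    have := (orbitSinSq_strictMonoOn hp hu hb).injOn.bijOn_image
    rwa [image_orbitSinSq hp hu hb] at this
  let e : Icc (0 : ℝ) 1 ≃ Icc (0 : ℝ) 1 := hbij.equiv
  have he : Continuous e := (continuousOn_orbitSinSq hp hu hb).mapsToRestrict hbij.mapsTo
  let E := he.homeoOfEquivCompactToT2
  have hcont : Continuous fun θ => ((E.symm ⟨Real.sin θ ^ 2, sin_sq_mem_Icc θ⟩ : Icc (0 : ℝ) 1) : ℝ) :=
    continuous_subtype_val.comp (E.symm.continuous.comp (by fun_prop))
  refine hcont.congr fun θ => (orbitTau_eq hp hu hb (Subtype.prop _) ?_).symm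
  exact congrArg Subtype.val (E.apply_symm_apply ⟨Real.sin θ ^ 2, sin_sq_mem_Icc θ⟩)

theorem orbitTau_congr {θ₁ θ₂ : ℝ} (h : Real.sin θ₁ ^ 2 = Real.sin θ₂ ^ 2) :
    orbitTau p u b θ₁ = orbitTau p u b θ₂ := by
  rw [orbitTau, orbitTau, h]

theorem orbitTau_add_nat_mul_pi (θ : ℝ) (n : ℕ) :
    orbitTau p u b (θ + n * Real.pi) = orbitTau p u b θ := by
  refine orbitTau_congr ?_
  rw [Real.sin_add_nat_mul_pi, mul_pow, ← pow_mul, mul_comm n 2, pow_mul]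
  simp

theorem orbitR_pos (hp : 3 / 2 < p) (hu : 0 < u) (hb : b < 1) (θ : ℝ) : 0 < orbitR p u b θ :=
  orbitRho_pos hp hu hb (orbitTau_mem hp hu hb θ)

theorem continuous_orbitR (hp : 3 / 2 < p) (hu : 0 < u) (hb : b < 1) :
    Continuous (orbitR p u b) :=
  (continuous_orbitRho hp).comp (continuous_orbitTau hp hu hb)

theorem orbitR_mul_sin_sq (hp : 3 / 2 < p) (hu : 0 < u) (hb : b < 1) (θ : ℝ) :
    orbitR p u b θ * Real.sin θ ^ 2 = orbitTau p u b θ ^ 2 := by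
  rw [← orbitSinSq_orbitTau hp hu hb θ, orbitSinSq, ← orbitR,
    mul_div_cancel₀ _ (orbitR_pos hp hu hb θ).ne']

theorem orbitR_mul_cos_sq (hp : 3 / 2 < p) (hu : 0 < u) (hb : b < 1) (θ : ℝ) :
    orbitR p u b θ * Real.cos θ ^ 2 = u ^ 2 * rad p b (orbitTau p u b θ) := by
  rw [Real.cos_sq', mul_sub, orbitR_mul_sin_sq hp hu hb, orbitR, orbitRho]
  ring

theorem continuous_orbitPot (hp : 3 / 2 < p) (hu : 0 < u) (hb : b < 1) :
    Continuous (orbitPot p u b) := by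
  have h1 : Continuous fun t : ℝ => t ^ (2 * (p.conjExponent - 1)) :=
    Real.continuous_rpow_const (by linarith [one_lt_conjExponent hp])
  exact continuous_const.mul (h1.comp (continuous_orbitTau hp hu hb))

theorem continuous_orbitSpeed (hp : 3 / 2 < p) (hu : 0 < u) (hb : b < 1) :
    Continuous (orbitSpeed p u b) :=
  (continuous_const.mul ((continuous_orbitFlux hp).comp (continuous_orbitTau hp hu hb))).div
    (continuous_orbitR hp hu hb) fun θ => (orbitR_pos hp hu hb θ).ne'

theorem orbitSpeed_pos (hp : 3 / 2 < p) (hu : 0 < u) (hb : b < 1) (θ : ℝ) :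
    0 < orbitSpeed p u b θ := by
  have h1 := orbitFlux_pos hp hb (orbitTau_mem hp hu hb θ)
  have h2 := orbitR_pos hp hu hb θ
  unfold orbitSpeed
  positivity

theorem orbitPot_mul_tau_sq (hp : 3 / 2 < p) (hu : 0 < u) (hb : b < 1) (θ : ℝ) :
    orbitPot p u b θ * orbitTau p u b θ ^ 2 =
      b * u ^ 2 * orbitTau p u b θ ^ (2 * p.conjExponent) := by
  have hr := one_lt_conjExponent hp
  have h : orbitTau p u b θ ^ (2 * p.conjExponent) =
      orbitTau p u b θ ^ (2 * (p.conjExponent - 1)) * orbitTau p u b θ ^ (2 : ℝ) := by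
    rw [← Real.rpow_add' (orbitTau_mem hp hu hb θ).1 (by linarith)]
    ring_nf
  rw [h, Real.rpow_two, orbitPot, mul_assoc]

/-- The orbit obeys the Prüfer equation with spectral parameter `u²` and potential `orbitPot`. -/
theorem orbitSpeed_eq (hp : 3 / 2 < p) (hu : 0 < u) (hb : b < 1) (θ : ℝ) :
    orbitSpeed p u b θ =
      Real.cos θ ^ 2 + (u ^ 2 - orbitPot p u b θ) * Real.sin θ ^ 2 := by
  have h2 := orbitR_pos hp hu hb θ
  rw [orbitSpeed, div_eq_iff h2.ne', ← rad_add_sq_sub hp]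
  linear_combination -(orbitR_mul_cos_sq hp hu hb θ) -
    (u ^ 2 - orbitPot p u b θ) * orbitR_mul_sin_sq hp hu hb θ + orbitPot_mul_tau_sq hp hu hb θ

/-- The polar angle as a function of the height. -/
noncomputable def orbitAngle (p u b t : ℝ) : ℝ := Real.arctan (t / (u * √(rad p b t)))

theorem sin_sq_orbitAngle (hp : 3 / 2 < p) (hu : 0 < u) (hb : b < 1) (ht : t ∈ Ico (0 : ℝ) 1) :
    Real.sin (orbitAngle p u b t) ^ 2 = orbitSinSq p u b t := by
  have h1 := rad_pos hp hb ht
  have h2 := Real.sq_sqrt h1.le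
  rw [orbitAngle, Real.sin_sq_arctan, orbitSinSq, orbitRho, div_pow, mul_pow, h2]
  field_simp
  ring

theorem orbitTau_orbitAngle (hp : 3 / 2 < p) (hu : 0 < u) (hb : b < 1) (ht : t ∈ Ico (0 : ℝ) 1) :
    orbitTau p u b (orbitAngle p u b t) = t :=
  orbitTau_eq hp hu hb ⟨ht.1, ht.2.le⟩ (sin_sq_orbitAngle hp hu hb ht).symm

theorem image_orbitAngle (hp : 3 / 2 < p) (hu : 0 < u) (hb : b < 1) :
    orbitAngle p u b '' Ioo 0 1 = Ioo 0 (Real.pi / 2) := by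
  refine Subset.antisymm (image_subset_iff.2 fun t ht => ⟨?_, Real.arctan_lt_pi_div_two _⟩) ?_
  · have h1 := Real.sqrt_pos.2 (rad_pos hp hb ⟨ht.1.le, ht.2⟩)
    have h2 := ht.1
    exact Real.arctan_pos.2 (by positivity)
  · intro θ hθ
    have hs : 0 < Real.sin θ := Real.sin_pos_of_pos_of_lt_pi hθ.1 (by linarith [hθ.2, Real.pi_pos])
    have hc : 0 < Real.cos θ := Real.cos_pos_of_mem_Ioo ⟨by linarith [hθ.1, Real.pi_pos], hθ.2⟩
    have hR := orbitR_pos hp hu hb θ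
    have h1 := orbitR_mul_sin_sq hp hu hb θ
    have h2 := orbitR_mul_cos_sq hp hu hb θ
    have hm := orbitTau_mem hp hu hb θ
    set τ := orbitTau p u b θ
    have hτ0 : 0 < τ := by
      refine lt_of_le_of_ne hm.1 fun h => ?_
      rw [← h] at h1
      have : 0 < orbitR p u b θ * Real.sin θ ^ 2 := by positivity
      simp [h1] at this
    have hτ1 : τ < 1 := by
      refine lt_of_le_of_ne hm.2 fun h => ?_
      rw [h, rad_one, mul_zero] at h2
      have : 0 < orbitR p u b θ * Real.cos θ ^ 2 := by positivity
      simp [h2] at this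
    refine ⟨τ, ⟨hτ0, hτ1⟩, ?_⟩
    have h3 : τ = √(orbitR p u b θ) * Real.sin θ := by
      rw [← Real.sqrt_sq hm.1, ← h1, Real.sqrt_mul hR.le, Real.sqrt_sq hs.le]
    have h4 : u * √(rad p b τ) = √(orbitR p u b θ) * Real.cos θ := by
      rw [← Real.sqrt_sq hc.le, ← Real.sqrt_mul hR.le, h2, Real.sqrt_mul (sq_nonneg u),
        Real.sqrt_sq hu.le]
    rw [orbitAngle, h4]
    nth_rewrite 1 [h3]
    rw [mul_div_mul_left _ _ (Real.sqrt_pos.2 hR).ne', ← Real.tan_eq_sin_div_cos,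
      Real.arctan_tan (by linarith [hθ.1, Real.pi_pos]) hθ.2]

theorem hasDerivAt_orbitAngle (hp : 3 / 2 < p) (hu : 0 < u) (hb : b < 1)
    (ht : t ∈ Ioo (0 : ℝ) 1) : HasDerivAt (orbitAngle p u b)
      (u * orbitFlux p b t / (orbitRho p u b t * √(rad p b t))) t := by
  have hpos := rad_pos hp hb ⟨ht.1.le, ht.2⟩
  have hs := Real.sqrt_pos.2 hpos
  have h1 := ((hasDerivAt_id t).div (((hasDerivAt_rad hp b t).sqrt hpos.ne').const_mul u)
    (by positivity)).arctan
  convert! h1 using 1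
  have h2 : t ^ (2 * p.conjExponent) = t ^ (2 * p.conjExponent - 1) * t := by
    rw [← Real.rpow_add_one ht.1.ne', sub_add_cancel]
  have h4 := Real.sq_sqrt hpos.le
  have h5 := orbitRho_pos hp hu hb (Ioo_subset_Icc_self ht)
  simp only [Pi.div_apply, id, one_mul]
  rw [orbitRho] at h5 ⊢
  rw [← rad_add_sq_sub hp, h2]
  generalize hS : √(rad p b t) = s at *
  rw [← h4] at h5 ⊢
  have h6 : 1 + (t / (u * s)) ^ 2 ≠ 0 := by positivity
  field_simp
  ring

/-- Substitution `θ = orbitAngle t`. The image formula on the open interval suffices; at `t = 1` the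
formula for `orbitAngle` divides by zero and its value is meaningless. -/
theorem integral_comp_orbitTau (hp : 3 / 2 < p) (hu : 0 < u) (hb : b < 1) (h : ℝ → ℝ) :
    ∫ θ in (0 : ℝ)..(Real.pi / 2), h (orbitTau p u b θ) =
      ∫ t in (0 : ℝ)..1, u * orbitFlux p b t / (orbitRho p u b t * √(rad p b t)) * h t := by
  have hinj : InjOn (orbitAngle p u b) (Ioo 0 1) := fun t₁ h₁ t₂ h₂ h12 => by
    rw [← orbitTau_orbitAngle hp hu hb ⟨h₁.1.le, h₁.2⟩, h12,
      orbitTau_orbitAngle hp hu hb ⟨h₂.1.le, h₂.2⟩]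
  have key := integral_image_eq_integral_abs_deriv_smul measurableSet_Ioo
    (fun t ht => (hasDerivAt_orbitAngle hp hu hb ht).hasDerivWithinAt) hinj
    fun θ => h (orbitTau p u b θ)
  rw [image_orbitAngle hp hu hb] at key
  rw [intervalIntegral.integral_of_le (by positivity), integral_Ioc_eq_integral_Ioo, key,
    intervalIntegral.integral_of_le zero_le_one, integral_Ioc_eq_integral_Ioo]
  refine setIntegral_congr_fun measurableSet_Ioo fun t ht => ?_
  have h1 := Real.sqrt_pos.2 (rad_pos hp hb ⟨ht.1.le, ht.2⟩)
  have h2 := orbitRho_pos hp hu hb (Ioo_subset_Icc_self ht)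
  have h3 := orbitFlux_pos hp hb (Ioo_subset_Icc_self ht)
  simp only [smul_eq_mul]
  rw [orbitTau_orbitAngle hp hu hb ⟨ht.1.le, ht.2⟩, abs_of_pos (by positivity)]

theorem integral_pi_comp_orbitTau (h : ℝ → ℝ)
    (hc : Continuous fun θ => h (orbitTau p u b θ)) :
    ∫ θ in (0 : ℝ)..Real.pi, h (orbitTau p u b θ) =
      2 * ∫ θ in (0 : ℝ)..(Real.pi / 2), h (orbitTau p u b θ) := by
  rw [← intervalIntegral.integral_add_adjacent_intervals (hc.intervalIntegrable 0 (Real.pi / 2))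
    (hc.intervalIntegrable (Real.pi / 2) Real.pi), two_mul]
  congr 1
  have h1 := intervalIntegral.integral_comp_sub_left (a := Real.pi / 2) (b := Real.pi)
    (fun θ => h (orbitTau p u b θ)) Real.pi
  rw [sub_self, show Real.pi - Real.pi / 2 = Real.pi / 2 by ring] at h1
  rw [← h1]
  refine intervalIntegral.integral_congr fun θ _ => ?_
  rw [orbitTau_congr (by rw [Real.sin_pi_sub])]

/-- This is the time spent on one lobe. Radius and flux cancel against the Jacobian, leaving `1 / (u
√rad)`. -/
theorem integral_inv_orbitSpeed (hp : 3 / 2 < p) (hu : 0 < u) (hb : b < 1) :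
    ∫ θ in (0 : ℝ)..Real.pi, (orbitSpeed p u b θ)⁻¹ = 2 / u * quarterT p b := by
  have h1 : ∀ θ, (orbitSpeed p u b θ)⁻¹ =
      (fun t => orbitRho p u b t / (u ^ 2 * orbitFlux p b t)) (orbitTau p u b θ) := fun θ => by
    rw [orbitSpeed, inv_div, orbitR]
  have hc : Continuous fun θ => (orbitSpeed p u b θ)⁻¹ :=
    (continuous_orbitSpeed hp hu hb).inv₀ fun θ => (orbitSpeed_pos hp hu hb θ).ne'
  simp_rw [h1] at hc
  have h2 := integral_pi_comp_orbitTau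
    (fun t => orbitRho p u b t / (u ^ 2 * orbitFlux p b t)) hc
  simp_rw [← h1] at h2
  rw [h2]
  simp_rw [h1]
  rw [integral_comp_orbitTau hp hu hb
    fun t => orbitRho p u b t / (u ^ 2 * orbitFlux p b t), quarterT, radIntegral,
    ← intervalIntegral.integral_const_mul, ← intervalIntegral.integral_const_mul]
  refine intervalIntegral.integral_congr_ae ?_
  filter_upwards [compl_mem_ae_iff.2 (measure_singleton (1 : ℝ))] with t ht1 ht
  rw [uIoc_of_le zero_le_one] at ht
  have ht' : t ∈ Ico (0 : ℝ) 1 := ⟨ht.1.le, lt_of_le_of_ne ht.2 ht1⟩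
  have h1 := Real.sqrt_pos.2 (rad_pos hp hb ht')
  have h2 := orbitRho_pos hp hu hb ⟨ht.1.le, ht.2⟩
  have h3 := orbitFlux_pos hp hb ⟨ht.1.le, ht.2⟩
  field_simp

/-- Twice the area swept in a half turn. The radius cancels against the Jacobian, leaving `u *
orbitFlux / √rad`. -/
theorem integral_orbitR (hp : 3 / 2 < p) (hu : 0 < u) (hb : b < 1) :
    ∫ θ in (0 : ℝ)..Real.pi, orbitR p u b θ = 2 * u * actionK p b := by
  have hc := continuous_orbitR hp hu hb
  unfold orbitR at hc ⊢
  have hK : actionK p b = ∫ t in (0 : ℝ)..1, ((1 - b / p.conjExponent) * (1 / √(rad p b t)) -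
      b / p * (t ^ (2 * p.conjExponent) / √(rad p b t))) := by
    rw [intervalIntegral.integral_sub
      ((intervalIntegrable_div_sqrt_rad hp hb continuous_const).const_mul _)
      ((intervalIntegrable_div_sqrt_rad hp hb (continuous_rpow_conj hp)).const_mul _),
      intervalIntegral.integral_const_mul, intervalIntegral.integral_const_mul]
    rfl
  rw [integral_pi_comp_orbitTau _ hc, integral_comp_orbitTau hp hu hb, hK, mul_assoc,
    ← intervalIntegral.integral_const_mul u]
  congr 1
  refine intervalIntegral.integral_congr_ae ?_
  filter_upwards [compl_mem_ae_iff.2 (measure_singleton (1 : ℝ))] with t ht1 ht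
  rw [uIoc_of_le zero_le_one] at ht
  have ht' : t ∈ Ico (0 : ℝ) 1 := ⟨ht.1.le, lt_of_le_of_ne ht.2 ht1⟩
  have h1 := Real.sqrt_pos.2 (rad_pos hp hb ht')
  have h2 := orbitRho_pos hp hu hb ⟨ht.1.le, ht.2⟩
  rw [orbitFlux]
  field_simp

end Orbit

/-! ### Calibration: the lower bound for the energy. -/

theorem sgnPow_mul_rpow {a x c : ℝ} (ha : 0 < a) (hc : 0 ≤ c) :
    sgnPow a (x * c) = sgnPow a x * c ^ a := by
  rcases eq_or_lt_of_le hc with rfl | h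
  · rw [mul_zero, sgnPow_zero ha, Real.zero_rpow ha.ne', mul_zero]
  · exact sgnPow_mul_of_nonneg h

theorem sgnPow_mul_nonneg {a x y : ℝ} (ha : 0 < a) (h : 0 ≤ x * y) : 0 ≤ sgnPow a x * y := by
  rcases lt_trichotomy x 0 with hx | rfl | hx
  · have := sgnPow_neg_of_neg (a := a) hx
    have : y ≤ 0 := by by_contra! hy; nlinarith
    nlinarith
  · simp [sgnPow_zero ha]
  · have := sgnPow_pos (a := a) hx
    have : 0 ≤ y := nonneg_of_mul_nonneg_right h hx
    positivity

/-- The lower bound for the energy of `n` lobes on length `L` provided by the orbit with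
parameters `u`, `b`. -/
noncomputable def lobeEnergy (p L : ℝ) (n : ℕ) (u b : ℝ) : ℝ :=
  sgnPow (p - 1) (b * u ^ 2) *
    (u ^ 2 * (1 - b / p.conjExponent) * L - 2 * n * u * actionK p b)

/-- The energy density compared with `|Q|^p`. -/
noncomputable def calibration (p u b μ θ θ' : ℝ) : ℝ :=
  p * (sgnPow (p - 1) (b * u ^ 2) * (u ^ 2 * (1 - b / p.conjExponent) - orbitR p u b θ * θ' +
    (μ - u ^ 2) * orbitTau p u b θ ^ 2))

section Calibration

variable {p u b μ a c : ℝ} {n : ℕ} {θ Q : ℝ → ℝ}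

/-- Since `(p* - 1)(p - 1) = 1`, the slope `sgnPow (p - 1) (orbitPot θ)` is a constant times `τ² = R
sin² θ`. Hence the tangent line at `orbitPot θ`, linear in `Q`, can be rewritten through `R θ'`. -/
theorem calibration_eq (hp : 3 / 2 < p) (hu : 0 < u) (hb : b < 1) (μ θ Q : ℝ) :
    calibration p u b μ θ (Real.cos θ ^ 2 + (μ - Q) * Real.sin θ ^ 2) =
      p * sgnPow (p - 1) (orbitPot p u b θ) * Q - (p - 1) * |orbitPot p u b θ| ^ p := by
  have hr := one_lt_conjExponent hp
  have hm := orbitTau_mem hp hu hb θ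
  have h0 : 2 * (p.conjExponent - 1) * (p - 1) = 2 := by
    linear_combination 2 * sub_one_mul_conjExponent hp
  have h1 : sgnPow (p - 1) (orbitPot p u b θ) =
      sgnPow (p - 1) (b * u ^ 2) * orbitTau p u b θ ^ 2 := by
    rw [orbitPot, sgnPow_mul_rpow (by linarith) (Real.rpow_nonneg hm.1 _), ← Real.rpow_mul hm.1,
      h0, Real.rpow_two]
  have h2 : |orbitPot p u b θ| ^ p = sgnPow (p - 1) (b * u ^ 2) *
      (b * u ^ 2 * orbitTau p u b θ ^ (2 * p.conjExponent)) := by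
    rw [← orbitPot_mul_tau_sq hp hu hb, ← sub_add_cancel p 1, ← sgnPow_mul_self (by linarith),
      sub_add_cancel, h1]
    ring
  have h3 := orbitR_mul_sin_sq hp hu hb θ
  have h4 := orbitR_mul_cos_sq hp hu hb θ
  have e : orbitR p u b θ * (Real.cos θ ^ 2 + (μ - Q) * Real.sin θ ^ 2) =
      u ^ 2 * rad p b (orbitTau p u b θ) + (μ - Q) * orbitTau p u b θ ^ 2 := by
    linear_combination h4 + (μ - Q) * h3
  rw [h1, h2, calibration, e, rad]
  have h5 : p / p.conjExponent = p - 1 := by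
    rw [div_eq_iff (by linarith)]; exact (sub_one_mul_conjExponent hp).symm
  rw [← h5]
  ring

theorem calibration_le (hp : 3 / 2 < p) (hu : 0 < u) (hb : b < 1) (μ θ Q : ℝ) :
    calibration p u b μ θ (Real.cos θ ^ 2 + (μ - Q) * Real.sin θ ^ 2) ≤ |Q| ^ p := by
  rw [calibration_eq hp hu hb]
  rcases eq_or_ne Q (orbitPot p u b θ) with h | h
  · rw [h, tangent_eq_abs_rpow (by linarith)]
  · exact (tangent_lt_abs_rpow (by linarith) h).le

theorem eq_orbitPot_of_calibration_eq (hp : 3 / 2 < p) (hu : 0 < u) (hb : b < 1) {μ θ Q : ℝ}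
    (h : calibration p u b μ θ (Real.cos θ ^ 2 + (μ - Q) * Real.sin θ ^ 2) = |Q| ^ p) :
    Q = orbitPot p u b θ := by
  by_contra hne
  rw [calibration_eq hp hu hb] at h
  exact (tangent_lt_abs_rpow (by linarith) hne).ne h

theorem calibration_orbitPot (hp : 3 / 2 < p) (hu : 0 < u) (hb : b < 1) (θ : ℝ) :
    calibration p u b (u ^ 2) θ (orbitSpeed p u b θ) = |orbitPot p u b θ| ^ p := by
  rw [orbitSpeed_eq hp hu hb, calibration_eq hp hu hb, tangent_eq_abs_rpow (by linarith)]

theorem periodic_orbitR : Function.Periodic (orbitR p u b) Real.pi := fun θ => by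
  have := orbitTau_add_nat_mul_pi (p := p) (u := u) (b := b) θ 1
  rw [Nat.cast_one, one_mul] at this
  rw [orbitR, orbitR, this]

/-- The integrand is the derivative of an antiderivative of `R` composed with `θ`, so the integral
sees only the endpoints; by periodicity it is `n` times the integral over one period. -/
theorem integral_orbitR_comp (hp : 3 / 2 < p) (hu : 0 < u) (hb : b < 1) (hac : a ≤ c)
    {θ' : ℝ → ℝ} (hθ : IsPrimitiveOn θ θ' a c) (hn : θ c = θ a + n * Real.pi) :
    IntervalIntegrable (fun x => orbitR p u b (θ x) * θ' x) volume a c ∧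
      ∫ x in a..c, orbitR p u b (θ x) * θ' x = 2 * n * u * actionK p b := by
  have hc := continuous_orbitR hp hu hb
  have h1 := hθ.comp (Φ := fun y => ∫ t in (0 : ℝ)..y, orbitR p u b t)
    (fun y => (hc.integral_hasStrictDerivAt 0 y).hasDerivAt) hc hac
  refine ⟨h1.integrable, ?_⟩
  rw [h1.integral_eq_sub hac, intervalIntegral.integral_interval_sub_left
    (hc.intervalIntegrable _ _) (hc.intervalIntegrable _ _), hn]
  have h2 := (periodic_orbitR (p := p) (u := u) (b := b)).intervalIntegral_add_zsmul_eq n (θ a)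
  simp only [natCast_zsmul, nsmul_eq_mul] at h2
  rw [h2 fun _ _ => hc.intervalIntegrable _ _,
    (periodic_orbitR (p := p) (u := u) (b := b)).intervalIntegral_add_eq (θ a) 0, zero_add,
    integral_orbitR hp hu hb]
  ring

theorem integral_calibration (hp : 3 / 2 < p) (hu : 0 < u) (hb : b < 1) (hac : a ≤ c)
    {θ' : ℝ → ℝ} (hθ : IsPrimitiveOn θ θ' a c) (hn : θ c = θ a + n * Real.pi) (μ : ℝ) :
    IntervalIntegrable (fun x => calibration p u b μ (θ x) (θ' x)) volume a c ∧
      ∫ x in a..c, calibration p u b μ (θ x) (θ' x) = p * (lobeEnergy p (c - a) n u b +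
        sgnPow (p - 1) (b * u ^ 2) * (μ - u ^ 2) * ∫ x in a..c, orbitTau p u b (θ x) ^ 2) := by
  obtain ⟨h1, h2⟩ := integral_orbitR_comp hp hu hb hac hθ hn
  have h3 : IntervalIntegrable (fun x => orbitTau p u b (θ x) ^ 2) volume a c := by
    refine ContinuousOn.intervalIntegrable ?_
    rw [uIcc_of_le hac]
    exact ((continuous_orbitTau hp hu hb).pow 2).comp_continuousOn (hθ.continuousOn hac)
  have h4 : IntervalIntegrable (fun _ : ℝ => u ^ 2 * (1 - b / p.conjExponent)) volume a c :=
    intervalIntegrable_const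
  refine ⟨(((h4.sub h1).add (h3.const_mul (μ - u ^ 2))).const_mul _).const_mul p, ?_⟩
  unfold calibration
  rw [intervalIntegral.integral_const_mul, intervalIntegral.integral_const_mul,
    intervalIntegral.integral_add (h4.sub h1) (h3.const_mul _), intervalIntegral.integral_sub h4 h1,
    intervalIntegral.integral_const_mul (μ - u ^ 2), h2, intervalIntegral.integral_const, lobeEnergy,
    smul_eq_mul]
  ring

/-- For `μ ≠ u²` an extra term `(μ - u²) ∫ τ²` appears, with a coefficient of the sign of `b`; the
last hypothesis makes it nonnegative. This flexibility is what handles `μ ≤ 0`. -/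
theorem lobeEnergy_le (hp : 3 / 2 < p) (hu : 0 < u) (hb : b < 1) (hac : a ≤ c)
    (hQ : IntervalIntegrable (fun x => |Q x| ^ p) volume a c)
    (hθ : IsPrimitiveOn θ (fun x => Real.cos (θ x) ^ 2 + (μ - Q x) * Real.sin (θ x) ^ 2) a c)
    (hn : θ c = θ a + n * Real.pi) (hμ : 0 ≤ b * (μ - u ^ 2)) :
    p * lobeEnergy p (c - a) n u b ≤ ∫ x in a..c, |Q x| ^ p := by
  obtain ⟨h1, h2⟩ := integral_calibration hp hu hb hac hθ hn μ
  have h3 := intervalIntegral.integral_mono_on hac h1 hQ fun x _ => calibration_le hp hu hb _ _ _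
  rw [h2] at h3
  have h4 : 0 ≤ sgnPow (p - 1) (b * u ^ 2) * (μ - u ^ 2) :=
    sgnPow_mul_nonneg (by linarith) (by nlinarith [sq_nonneg u])
  have h5 : 0 ≤ ∫ x in a..c, orbitTau p u b (θ x) ^ 2 :=
    intervalIntegral.integral_nonneg hac fun x _ => sq_nonneg _
  nlinarith [mul_nonneg h4 h5]

theorem ae_eq_orbitPot (hp : 3 / 2 < p) (hu : 0 < u) (hb : b < 1) (hac : a ≤ c)
    (hQ : IntervalIntegrable (fun x => |Q x| ^ p) volume a c)
    (hθ : IsPrimitiveOn θ (fun x => Real.cos (θ x) ^ 2 + (u ^ 2 - Q x) * Real.sin (θ x) ^ 2) a c)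
    (hn : θ c = θ a + n * Real.pi)
    (heq : ∫ x in a..c, |Q x| ^ p ≤ p * lobeEnergy p (c - a) n u b) :
    ∀ᵐ x, x ∈ Ioo a c → Q x = orbitPot p u b (θ x) := by
  obtain ⟨h1, h2⟩ := integral_calibration hp hu hb hac hθ hn (u ^ 2)
  rw [sub_self, mul_zero, zero_mul, add_zero] at h2
  have h3 : ∫ x in a..c, (|Q x| ^ p - calibration p u b (u ^ 2) (θ x)
      (Real.cos (θ x) ^ 2 + (u ^ 2 - Q x) * Real.sin (θ x) ^ 2)) = 0 := by
    refine le_antisymm ?_ (intervalIntegral.integral_nonneg hac fun x _ =>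
      sub_nonneg.2 (calibration_le hp hu hb _ _ _))
    rw [intervalIntegral.integral_sub hQ h1, h2]
    linarith
  rw [intervalIntegral.integral_eq_zero_iff_of_le_of_nonneg_ae hac
    (Filter.Eventually.of_forall fun x => sub_nonneg.2 (calibration_le hp hu hb _ _ _))
    (hQ.sub h1)] at h3
  rw [Filter.EventuallyEq, ae_restrict_iff' measurableSet_Ioc] at h3
  filter_upwards [h3] with x hx hxm
  exact eq_orbitPot_of_calibration_eq hp hu hb (sub_eq_zero.1 (hx ⟨hxm.1, hxm.2.le⟩)).symm

end Calibration

/-! ### The orbit in time, and the envelope theorem. -/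

/-- Time needed to reach the polar angle `θ` along the orbit. -/
noncomputable def orbitTime (p u b θ : ℝ) : ℝ := ∫ φ in (0 : ℝ)..θ, (orbitSpeed p u b φ)⁻¹

section Reference

variable {p u b a c L : ℝ} {n : ℕ} {θ : ℝ → ℝ}

theorem hasDerivAt_orbitTime (hp : 3 / 2 < p) (hu : 0 < u) (hb : b < 1) (θ : ℝ) :
    HasDerivAt (orbitTime p u b) (orbitSpeed p u b θ)⁻¹ θ :=
  (((continuous_orbitSpeed hp hu hb).inv₀ fun θ =>
    (orbitSpeed_pos hp hu hb θ).ne').integral_hasStrictDerivAt 0 θ).hasDerivAt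

theorem orbitTime_strictMono (hp : 3 / 2 < p) (hu : 0 < u) (hb : b < 1) :
    StrictMono (orbitTime p u b) :=
  strictMono_of_deriv_pos fun θ => by
    rw [(hasDerivAt_orbitTime hp hu hb θ).deriv]
    exact inv_pos.2 (orbitSpeed_pos hp hu hb θ)

theorem orbitSpeed_add_nat_mul_pi (θ : ℝ) (n : ℕ) :
    orbitSpeed p u b (θ + n * Real.pi) = orbitSpeed p u b θ := by
  rw [orbitSpeed, orbitSpeed, orbitR, orbitR, orbitTau_add_nat_mul_pi]

theorem periodic_orbitSpeed_inv :
    Function.Periodic (fun θ => (orbitSpeed p u b θ)⁻¹) Real.pi := fun θ => by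
  have := orbitSpeed_add_nat_mul_pi (p := p) (u := u) (b := b) θ 1
  rw [Nat.cast_one, one_mul] at this
  simp only [this]

theorem orbitTime_int_mul_pi (hp : 3 / 2 < p) (hu : 0 < u) (hb : b < 1) (n : ℤ) :
    orbitTime p u b (n * Real.pi) = n * (2 / u * quarterT p b) := by
  have h := (periodic_orbitSpeed_inv (p := p) (u := u) (b := b)).intervalIntegral_add_zsmul_eq n 0
  simp only [zero_add, zsmul_eq_mul] at h
  have hci : Continuous fun θ => (orbitSpeed p u b θ)⁻¹ :=
    (continuous_orbitSpeed hp hu hb).inv₀ fun θ => (orbitSpeed_pos hp hu hb θ).ne'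
  rw [orbitTime, h fun _ _ => hci.intervalIntegrable _ _, integral_inv_orbitSpeed hp hu hb]

theorem orbitTime_surjective (hp : 3 / 2 < p) (hu : 0 < u) (hb : b < 1) :
    Function.Surjective (orbitTime p u b) := by
  intro y
  set ℓ := 2 / u * quarterT p b with hℓ
  have hℓ0 : 0 < ℓ := mul_pos (by positivity) (quarterT_pos hp hb)
  have hc : Continuous (orbitTime p u b) := continuous_iff_continuousAt.2 fun θ =>
    (hasDerivAt_orbitTime hp hu hb θ).continuousAt
  have h1 : orbitTime p u b (⌊y / ℓ⌋ * Real.pi) ≤ y := by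
    rw [orbitTime_int_mul_pi hp hu hb, ← hℓ, ← le_div_iff₀ hℓ0]
    exact Int.floor_le _
  have h2 : y ≤ orbitTime p u b (⌈y / ℓ⌉ * Real.pi) := by
    rw [orbitTime_int_mul_pi hp hu hb, ← hℓ, ← div_le_iff₀ hℓ0]
    exact Int.le_ceil _
  exact mem_range_of_exists_le_of_exists_ge hc ⟨_, h1⟩ ⟨_, h2⟩

/-- The polar angle along the orbit, as a function of time. -/
noncomputable def orbitPhase (p u b : ℝ) : ℝ → ℝ := Function.invFun (orbitTime p u b)

theorem orbitTime_orbitPhase (hp : 3 / 2 < p) (hu : 0 < u) (hb : b < 1) (x : ℝ) :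
    orbitTime p u b (orbitPhase p u b x) = x :=
  Function.rightInverse_invFun (orbitTime_surjective hp hu hb) x

theorem orbitPhase_orbitTime (hp : 3 / 2 < p) (hu : 0 < u) (hb : b < 1) (θ : ℝ) :
    orbitPhase p u b (orbitTime p u b θ) = θ :=
  (orbitTime_strictMono hp hu hb).injective (orbitTime_orbitPhase hp hu hb _)

theorem hasDerivAt_orbitPhase (hp : 3 / 2 < p) (hu : 0 < u) (hb : b < 1) (x : ℝ) :
    HasDerivAt (orbitPhase p u b) (orbitSpeed p u b (orbitPhase p u b x)) x := by
  have hmono : Monotone (orbitPhase p u b) := fun x y hxy => by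
    rwa [← (orbitTime_strictMono hp hu hb).le_iff_le, orbitTime_orbitPhase hp hu hb,
      orbitTime_orbitPhase hp hu hb]
  have hcont : Continuous (orbitPhase p u b) := hmono.continuous_of_surjective fun θ =>
    ⟨_, orbitPhase_orbitTime hp hu hb θ⟩
  have h := HasDerivAt.of_local_left_inverse hcont.continuousAt
    (hasDerivAt_orbitTime hp hu hb (orbitPhase p u b x))
    (inv_pos.2 (orbitSpeed_pos hp hu hb _)).ne'
    (Filter.Eventually.of_forall (orbitTime_orbitPhase hp hu hb))
  rwa [inv_inv] at h

theorem continuous_orbitPhase (hp : 3 / 2 < p) (hu : 0 < u) (hb : b < 1) :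
    Continuous (orbitPhase p u b) :=
  continuous_iff_continuousAt.2 fun x => (hasDerivAt_orbitPhase hp hu hb x).continuousAt

theorem orbitPhase_zero (hp : 3 / 2 < p) (hu : 0 < u) (hb : b < 1) : orbitPhase p u b 0 = 0 := by
  have := orbitPhase_orbitTime hp hu hb 0
  rwa [orbitTime, intervalIntegral.integral_same] at this

theorem orbitPhase_length (hp : 3 / 2 < p) (hu : 0 < u) (hb : b < 1) (hn : 0 < n)
    (hL : quarterT p b = u * L / (2 * n)) : orbitPhase p u b L = n * Real.pi := by
  rw [← orbitPhase_orbitTime hp hu hb (n * Real.pi)]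
  have := orbitTime_int_mul_pi hp hu hb n
  rw [Int.cast_natCast] at this
  rw [this, hL]
  congr 1
  have : (n : ℝ) ≠ 0 := by positivity
  field_simp

/-- The orbit, started at time `a` with the polar angle `k π`. -/
theorem isPrimitiveOn_orbitPhase (hp : 3 / 2 < p) (hu : 0 < u) (hb : b < 1) (hac : a ≤ c) (k : ℕ) :
    IsPrimitiveOn (fun x => orbitPhase p u b (x - a) + k * Real.pi)
      (fun x => orbitSpeed p u b (orbitPhase p u b (x - a) + k * Real.pi)) a c := by
  have h1 := continuous_orbitPhase hp hu hb
  have h2 := continuous_orbitSpeed hp hu hb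
  refine IsPrimitiveOn.of_hasDerivWithinAt hac (fun x _ => ?_) (by fun_prop)
  rw [orbitSpeed_add_nat_mul_pi]
  have h3 := (hasDerivAt_orbitPhase hp hu hb (x - a)).comp_sub_const x a
  exact (h3.add_const _).hasDerivWithinAt

/-- Separation of variables: `orbitTime` along any solution grows with slope one, and it is
injective. No Lipschitz bound on the speed is required. -/
theorem eq_orbitPhase (hp : 3 / 2 < p) (hu : 0 < u) (hb : b < 1) (hac : a ≤ c) {k : ℕ}
    (hθ : IsPrimitiveOn θ (fun x => orbitSpeed p u b (θ x)) a c) (hk : θ a = k * Real.pi) :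
    EqOn θ (fun x => orbitPhase p u b (x - a) + k * Real.pi) (Icc a c) := by
  have hci : Continuous fun θ => (orbitSpeed p u b θ)⁻¹ :=
    (continuous_orbitSpeed hp hu hb).inv₀ fun θ => (orbitSpeed_pos hp hu hb θ).ne'
  have key : ∀ φ : ℝ → ℝ, IsPrimitiveOn φ (fun x => orbitSpeed p u b (φ x)) a c →
      ∀ x ∈ Icc a c, orbitTime p u b (φ x) = orbitTime p u b (φ a) + (x - a) := by
    intro φ hφ x hx
    have h1 := ((hφ.comp (hasDerivAt_orbitTime hp hu hb) hci hac).congr_ae hac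
      (f₁' := fun _ => 1) (Filter.Eventually.of_forall fun x _ =>
        inv_mul_cancel₀ (orbitSpeed_pos hp hu hb _).ne')).eq_add x hx
    simpa using h1
  intro x hx
  refine (orbitTime_strictMono hp hu hb).injective ?_
  rw [key θ hθ x hx, key _ (isPrimitiveOn_orbitPhase hp hu hb hac k) x hx, hk, sub_self,
    orbitPhase_zero hp hu hb, zero_add]

theorem continuous_abs_orbitPot_rpow (hp : 3 / 2 < p) (hu : 0 < u) (hb : b < 1) :
    Continuous fun θ => |orbitPot p u b θ| ^ p :=
  (Real.continuous_rpow_const (by linarith)).comp (continuous_orbitPot hp hu hb).abs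

/-- The calibration bound is attained by the orbit. -/
theorem integral_orbitPot (hp : 3 / 2 < p) (hu : 0 < u) (hb : b < 1) (hn : 0 < n) (hac : a ≤ c)
    (hL : quarterT p b = u * (c - a) / (2 * n)) (k : ℕ) :
    ∫ x in a..c, |orbitPot p u b (orbitPhase p u b (x - a) + k * Real.pi)| ^ p =
      p * lobeEnergy p (c - a) n u b := by
  have h := (integral_calibration hp hu hb hac (n := n)
    (isPrimitiveOn_orbitPhase hp hu hb hac k) (by
      rw [orbitPhase_length hp hu hb hn hL, sub_self, orbitPhase_zero hp hu hb]; ring) (u ^ 2)).2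
  rw [sub_self, mul_zero, zero_mul, add_zero] at h
  rw [← h]
  exact intervalIntegral.integral_congr fun x _ => (calibration_orbitPot hp hu hb _).symm

/-- The minimal energy (divided by `p`) of `n` lobes on length `L` at frequency `u`. -/
noncomputable def maxEnergy (p L : ℝ) (n : ℕ) (u : ℝ) : ℝ :=
  lobeEnergy p L n u (quarterTInv p (u * L / (2 * n)))

/-- Apply the calibration bound with parameter `b` to the orbit that fits the interval, whose energy
is exactly `p * maxEnergy`. Optimality in `b` thus needs no differentiation in `b`. -/
theorem lobeEnergy_le_maxEnergy (hp : 3 / 2 < p) (hu : 0 < u) (hb : b < 1) (hn : 0 < n)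
    (hL : 0 < L) : lobeEnergy p L n u b ≤ maxEnergy p L n u := by
  have hpos : 0 < u * L / (2 * n) := by positivity
  set β := quarterTInv p (u * L / (2 * n)) with hβ
  have hβ1 : β < 1 := quarterTInv_lt hp hpos
  have hβT : quarterT p β = u * (L - 0) / (2 * n) := by
    rw [sub_zero]; exact quarterT_quarterTInv hp hpos
  have h1 := integral_orbitPot hp hu hβ1 hn hL.le hβT 0
  have h2 := isPrimitiveOn_orbitPhase hp hu hβ1 hL.le 0
  simp only [orbitSpeed_eq hp hu hβ1] at h2
  have h3 := lobeEnergy_le hp hu hb hL.le (n := n) (μ := u ^ 2) (Q := fun x =>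
    orbitPot p u β (orbitPhase p u β (x - 0) + (0 : ℕ) * Real.pi)) (Continuous.intervalIntegrable
      ((continuous_abs_orbitPot_rpow hp hu hβ1).comp
        (((continuous_orbitPhase hp hu hβ1).comp (continuous_sub_right 0)).add continuous_const)) _ _)
    h2 (by rw [orbitPhase_length hp hu hβ1 hn (L := L - 0) hβT, sub_self,
      orbitPhase_zero hp hu hβ1]; ring) (by simp)
  rw [h1, sub_zero] at h3
  exact le_of_mul_le_mul_left h3 (by linarith)

theorem lobeEnergy_eq (hu : 0 < u) : lobeEnergy p L n u b =
    sgnPow (p - 1) b * (1 - b / p.conjExponent) * L * u ^ (2 * p) -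
      sgnPow (p - 1) b * (2 * n * actionK p b) * u ^ (2 * p - 1) := by
  have h1 : u ^ (2 * p) = (u ^ 2) ^ (p - 1) * u ^ 2 := by
    rw [rpow_two_mul_eq hu.le, ← Real.rpow_add_one (by positivity), sub_add_cancel]
  have h2 : u ^ (2 * p - 1) = (u ^ 2) ^ (p - 1) * u := by
    rw [← rpow_two_mul_eq hu.le, ← Real.rpow_add_one hu.ne']
    ring_nf
  rw [lobeEnergy, sgnPow_mul_of_nonneg (by positivity), h1, h2]
  ring

/-- Envelope theorem for a maximum of functions that are bilinear in parameter-dependent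
coefficients and two fixed differentiable functions. -/
theorem hasDerivAt_envelope {P N f g : ℝ → ℝ} {f' g' x : ℝ}
    (hP : ContinuousAt P x) (hN : ContinuousAt N x) (hf : HasDerivAt f f' x)
    (hg : HasDerivAt g g' x) (h : ∀ᶠ y in nhds x,
      P x * f y - N x * g y ≤ P y * f y - N y * g y ∧
      P y * f x - N y * g x ≤ P x * f x - N x * g x) :
    HasDerivAt (fun y => P y * f y - N y * g y) (P x * f' - N x * g') x := by
  have hf' := hasDerivAt_iff_tendsto_slope.1 hf
  have hg' := hasDerivAt_iff_tendsto_slope.1 hg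
  have hP' := hP.tendsto.mono_left (nhdsWithin_le_nhds (s := {x}ᶜ))
  have hN' := hN.tendsto.mono_left (nhdsWithin_le_nhds (s := {x}ᶜ))
  have hA := (hf'.const_mul (P x)).sub (hg'.const_mul (N x))
  have hB := (hP'.mul hf').sub (hN'.mul hg')
  rw [hasDerivAt_iff_tendsto_slope]
  -- The difference quotient lies between the ones with coefficients frozen at `x` and at `y`; both
  -- tend to the same limit.
  have hmin := hA.min hB
  have hmax := hA.max hB
  rw [min_self] at hmin
  rw [max_self] at hmax
  refine tendsto_of_tendsto_of_tendsto_of_le_of_le' hmin hmax ?_ ?_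
  all_goals
    filter_upwards [nhdsWithin_le_nhds h, self_mem_nhdsWithin] with y hy hyx
    simp only [slope_def_field]
    rcases lt_or_gt_of_ne (show y ≠ x from hyx) with hlt | hgt
  · refine min_le_iff.2 (Or.inr ?_)
    have h0 : y - x < 0 := sub_neg.2 hlt
    rw [← mul_div_assoc, ← mul_div_assoc, ← sub_div, div_le_div_right_of_neg h0]
    linarith [hy.2]
  · refine min_le_iff.2 (Or.inl ?_)
    have h0 : 0 < y - x := sub_pos.2 hgt
    rw [← mul_div_assoc, ← mul_div_assoc, ← sub_div, div_le_div_iff_of_pos_right h0]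
    linarith [hy.1]
  · refine le_max_iff.2 (Or.inl ?_)
    have h0 : y - x < 0 := sub_neg.2 hlt
    rw [← mul_div_assoc, ← mul_div_assoc, ← sub_div, div_le_div_right_of_neg h0]
    linarith [hy.1]
  · refine le_max_iff.2 (Or.inr ?_)
    have h0 : 0 < y - x := sub_pos.2 hgt
    rw [← mul_div_assoc, ← mul_div_assoc, ← sub_div, div_le_div_iff_of_pos_right h0]
    linarith [hy.2]

/-- By optimality in `b` only the explicit dependence on `u` contributes, so continuity of the
optimal parameter is enough. -/
theorem hasDerivAt_maxEnergy (hp : 3 / 2 < p) (hu : 0 < u) (hn : 0 < n) (hL : 0 < L) :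
    HasDerivAt (maxEnergy p L n)
      (4 * u ^ (2 * p - 2) * (n * signedV p (quarterTInv p (u * L / (2 * n))))) u := by
  have hn' : (0 : ℝ) < n := by exact_mod_cast hn
  set β : ℝ → ℝ := fun u => quarterTInv p (u * L / (2 * n)) with hβdef
  have hβ1 : ∀ u > 0, β u < 1 := fun u hu => quarterTInv_lt hp (by positivity)
  have hβ : ContinuousAt β u :=
    ((continuousOn_quarterTInv hp).continuousAt (Ioi_mem_nhds (by positivity))).comp
      (f := fun u => u * L / (2 * n)) (by fun_prop)
  have hS : ContinuousAt (fun u => sgnPow (p - 1) (β u)) u :=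
    (continuous_sgnPow (by linarith)).continuousAt.comp hβ
  have hK : ContinuousAt (fun u => actionK p (β u)) u :=
    ((continuousOn_actionK hp).continuousAt (Iio_mem_nhds (hβ1 u hu))).comp hβ
  have hf := Real.hasDerivAt_rpow_const (x := u) (p := 2 * p) (Or.inl hu.ne')
  have hg := Real.hasDerivAt_rpow_const (x := u) (p := 2 * p - 1) (Or.inl hu.ne')
  have henv := hasDerivAt_envelope
    (P := fun u => sgnPow (p - 1) (β u) * (1 - β u / p.conjExponent) * L)
    (N := fun u => sgnPow (p - 1) (β u) * (2 * n * actionK p (β u))) (by fun_prop) (by fun_prop)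
    hf hg (by
      filter_upwards [Ioi_mem_nhds hu] with y hy
      have hy' : 0 < y := hy
      have h1 := lobeEnergy_le_maxEnergy hp hy' (hβ1 u hu) hn hL
      have h2 := lobeEnergy_le_maxEnergy hp hu (hβ1 y hy') hn hL
      rw [maxEnergy, lobeEnergy_eq hy', lobeEnergy_eq hy'] at h1
      rw [maxEnergy, lobeEnergy_eq hu, lobeEnergy_eq hu] at h2
      exact ⟨h1, h2⟩)
  have hT : quarterT p (β u) = u * L / (2 * n) := quarterT_quarterTInv hp (by positivity)
  have hid := envelope_identity hp (hβ1 u hu)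
  have hpow : u ^ (2 * p - 1) = u ^ (2 * p - 2) * u := by
    rw [← Real.rpow_add_one hu.ne']; ring_nf
  refine (henv.congr_of_eventuallyEq ?_).congr_deriv ?_
  · filter_upwards [Ioi_mem_nhds hu] with y hy
    rw [maxEnergy, lobeEnergy_eq hy]
  · have hLu : L * u = 2 * n * quarterT p (β u) := by rw [hT]; field_simp
    rw [show 2 * p - 1 - 1 = 2 * p - 2 by ring, hpow, signedV]
    change _ = 4 * u ^ (2 * p - 2) * (n * (sgnPow (p - 1) (β u) * momentX p (β u)))
    linear_combination (sgnPow (p - 1) (β u) * (1 - β u / p.conjExponent) * (2 * p) *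
      u ^ (2 * p - 2)) * hLu + (2 * n * sgnPow (p - 1) (β u) * u ^ (2 * p - 2)) * hid

end Reference

/-! ### The balance function and the scalar equation for `λ`. -/

/-- The stationarity function for splitting `[0, L₁ + L₂]` into pieces with `k` and `n` lobes. -/
noncomputable def balance (p L₁ L₂ : ℝ) (k n : ℕ) (u : ℝ) : ℝ :=
  k * signedV p (quarterTInv p (u * L₁ / (2 * k))) +
    n * signedV p (quarterTInv p (u * L₂ / (2 * n)))

/-- The minimal total energy (divided by `p`) at frequency `u`. -/
noncomputable def totalEnergy (p L₁ L₂ : ℝ) (k n : ℕ) (u : ℝ) : ℝ :=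
  maxEnergy p L₁ k u + maxEnergy p L₂ n u

section Balance

variable {p L L₁ L₂ u : ℝ} {k n : ℕ}

theorem signedV_quarterTInv_strictMonoOn (hp : 3 / 2 < p) (hL : 0 < L) (hn : 0 < n) :
    StrictMonoOn (fun u => signedV p (quarterTInv p (u * L / (2 * n)))) (Ioi 0) := by
  intro x hx y hy hxy
  have hn' : (0 : ℝ) < n := by exact_mod_cast hn
  have hx' : 0 < x := hx
  have hy' : 0 < y := hy
  have h1 : 0 < x * L / (2 * n) := by positivity
  have h2 : 0 < y * L / (2 * n) := by positivity
  refine signedV_strictMonoOn hp (quarterTInv_lt hp h1) (quarterTInv_lt hp h2)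
    (quarterTInv_strictMonoOn hp h1 h2 ?_)
  gcongr

theorem continuousOn_signedV_quarterTInv (hp : 3 / 2 < p) (hL : 0 < L) (hn : 0 < n) :
    ContinuousOn (fun u => signedV p (quarterTInv p (u * L / (2 * n)))) (Ioi 0) := by
  have h1 : ∀ u ∈ Ioi (0 : ℝ), 0 < u * L / (2 * n) := fun u hu => by
    have : 0 < u := hu
    positivity
  exact ((continuousOn_signedV hp).comp (continuousOn_quarterTInv hp)
    fun y hy => quarterTInv_lt hp hy).comp (by fun_prop) h1

theorem balance_strictMonoOn (hp : 3 / 2 < p) (hL₁ : 0 < L₁) (hL₂ : 0 < L₂) (hk : 0 < k)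
    (hn : 0 < n) : StrictMonoOn (balance p L₁ L₂ k n) (Ioi 0) := by
  intro x hx y hy hxy
  have h1 := signedV_quarterTInv_strictMonoOn hp hL₁ hk hx hy hxy
  have h2 := signedV_quarterTInv_strictMonoOn hp hL₂ hn hx hy hxy
  simp only at h1 h2
  have hn' : (0 : ℝ) < n := by exact_mod_cast hn
  have hk' : (0 : ℝ) < k := by exact_mod_cast hk
  unfold balance
  gcongr

/-- Each piece has its own frequency at which its parameter `b` is zero. At the smaller of the two
the balance is nonpositive, at the larger nonnegative. -/
theorem exists_balance_eq_zero (hp : 3 / 2 < p) (hL₁ : 0 < L₁) (hL₂ : 0 < L₂) (hk : 0 < k)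
    (hn : 0 < n) : ∃ u > 0, balance p L₁ L₂ k n u = 0 := by
  have hn' : (0 : ℝ) < n := by exact_mod_cast hn
  have hk' : (0 : ℝ) < k := by exact_mod_cast hk
  have hc : ContinuousOn (balance p L₁ L₂ k n) (Ioi 0) :=
    (continuousOn_const.mul (continuousOn_signedV_quarterTInv hp hL₁ hk)).add
      (continuousOn_const.mul (continuousOn_signedV_quarterTInv hp hL₂ hn))
  set τ := quarterT p 0
  have hτ : 0 < τ := quarterT_pos hp one_pos
  have hz : signedV p (quarterTInv p τ) = 0 := by
    rw [quarterTInv_quarterT hp one_pos, signedV_zero hp]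
  have key : ∀ (L : ℝ) (n : ℕ), 0 < L → 0 < n → 0 < 2 * n * τ / L ∧
      signedV p (quarterTInv p (2 * n * τ / L * L / (2 * n))) = 0 := by
    intro L n hL hn
    refine ⟨by positivity, ?_⟩
    have : (n : ℝ) ≠ 0 := by positivity
    rw [show 2 * n * τ / L * L / (2 * n) = τ by field_simp, hz]
  obtain ⟨hu₁, hz₁⟩ := key L₁ k hL₁ hk
  obtain ⟨hu₂, hz₂⟩ := key L₂ n hL₂ hn
  have m1 := (signedV_quarterTInv_strictMonoOn hp hL₁ hk).monotoneOn
  have m2 := (signedV_quarterTInv_strictMonoOn hp hL₂ hn).monotoneOn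
  set u₁ := 2 * k * τ / L₁
  set u₂ := 2 * n * τ / L₂
  have hord := (isPreconnected_Ioi.image _ hc).ordConnected.out
  have e1 : balance p L₁ L₂ k n u₁ = n * signedV p (quarterTInv p (u₁ * L₂ / (2 * n))) := by
    rw [balance, hz₁, mul_zero, zero_add]
  have e2 : balance p L₁ L₂ k n u₂ = k * signedV p (quarterTInv p (u₂ * L₁ / (2 * k))) := by
    rw [balance, hz₂, mul_zero, add_zero]
  rcases le_total u₁ u₂ with h | h
  · have h1 := m1 hu₁ hu₂ h
    have h2 := m2 hu₁ hu₂ h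
    simp only at h1 h2
    rw [hz₁] at h1
    rw [hz₂] at h2
    exact hord (mem_image_of_mem _ hu₁) (mem_image_of_mem _ hu₂)
      ⟨by rw [e1]; exact mul_nonpos_of_nonneg_of_nonpos hn'.le h2, by rw [e2]; positivity⟩
  · have h1 := m1 hu₂ hu₁ h
    have h2 := m2 hu₂ hu₁ h
    simp only at h1 h2
    rw [hz₁] at h1
    rw [hz₂] at h2
    exact hord (mem_image_of_mem _ hu₂) (mem_image_of_mem _ hu₁)
      ⟨by rw [e2]; exact mul_nonpos_of_nonneg_of_nonpos hk'.le h1, by rw [e1]; positivity⟩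

theorem hasDerivAt_totalEnergy (hp : 3 / 2 < p) (hL₁ : 0 < L₁) (hL₂ : 0 < L₂) (hk : 0 < k)
    (hn : 0 < n) (hu : 0 < u) : HasDerivAt (totalEnergy p L₁ L₂ k n)
      (4 * u ^ (2 * p - 2) * balance p L₁ L₂ k n u) u := by
  rw [balance, mul_add]
  exact (hasDerivAt_maxEnergy hp hu hk hL₁).add (hasDerivAt_maxEnergy hp hu hn hL₂)

/-- The total energy has a strict minimum at the zero of the balance function. -/
theorem totalEnergy_lt (hp : 3 / 2 < p) (hL₁ : 0 < L₁) (hL₂ : 0 < L₂) (hk : 0 < k)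
    (hn : 0 < n) {v : ℝ} (hv : 0 < v) (h0 : balance p L₁ L₂ k n v = 0) (hu : 0 < u) (hne : u ≠ v) :
    totalEnergy p L₁ L₂ k n v < totalEnergy p L₁ L₂ k n u := by
  have hd := fun x (hx : 0 < x) => hasDerivAt_totalEnergy hp hL₁ hL₂ hk hn hx
  have hmono := balance_strictMonoOn hp hL₁ hL₂ hk hn
  rcases lt_or_gt_of_ne hne with h | h
  · refine strictAntiOn_of_deriv_neg (convex_Icc u v) (fun x hx =>
      (hd x (hu.trans_le hx.1)).continuousAt.continuousWithinAt) (fun x hx => ?_)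
      ⟨le_rfl, h.le⟩ ⟨h.le, le_rfl⟩ h
    rw [interior_Icc] at hx
    have hx0 : 0 < x := hu.trans hx.1
    rw [(hd x hx0).deriv]
    have h1 := hmono hx0 hv hx.2
    rw [h0] at h1
    exact mul_neg_of_pos_of_neg (mul_pos four_pos (Real.rpow_pos_of_pos hx0 _)) h1
  · refine strictMonoOn_of_deriv_pos (convex_Icc v u) (fun x hx =>
      (hd x (hv.trans_le hx.1)).continuousAt.continuousWithinAt) (fun x hx => ?_)
      ⟨le_rfl, h.le⟩ ⟨h.le, le_rfl⟩ h
    rw [interior_Icc] at hx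
    have hx0 : 0 < x := hv.trans hx.1
    rw [(hd x hx0).deriv]
    have h1 := hmono hv hx0 hx.1
    rw [h0] at h1
    exact mul_pos (mul_pos four_pos (Real.rpow_pos_of_pos hx0 _)) h1

theorem charT_eq (p σ α : ℝ) : charT p σ α = quarterT p (σ * α) := by
  refine intervalIntegral.integral_congr fun t _ => ?_
  simp only [radicand, rad, mul_div_assoc]

theorem charV_eq {σ α : ℝ} : charV p σ α = α ^ (p - 1) * momentX p (σ * α) := by
  rw [charV, momentX, radIntegral]
  congr 1
  refine intervalIntegral.integral_congr fun t _ => ?_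
  simp only [radicand, rad, mul_div_assoc]

theorem charDomain_one : charDomain 1 = Ioo 0 1 := by simp [charDomain]

theorem charDomain_neg_one : charDomain (-1) = Ioi 0 := by
  rw [charDomain, if_neg (by norm_num)]

theorem mem_charDomain_iff {σ α : ℝ} (hσ : σ = 1 ∨ σ = -1) :
    α ∈ charDomain σ ↔ 0 < α ∧ σ * α < 1 := by
  rcases hσ with rfl | rfl
  · rw [charDomain_one, one_mul]; rfl
  · rw [charDomain_neg_one, mem_Ioi]
    exact ⟨fun h => ⟨h, by linarith⟩, fun h => h.1⟩

/-- On the range of `charT p σ`, its inverse is `σ` times the inverse of `quarterT`. -/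
theorem mul_charTInv (hp : 3 / 2 < p) {σ y : ℝ} (hσ : σ = 1 ∨ σ = -1)
    (hy : y ∈ charT p σ '' charDomain σ) :
    charTInv p σ y ∈ charDomain σ ∧ σ * charTInv p σ y = quarterTInv p y := by
  have h1 : charTInv p σ y ∈ charDomain σ := Function.invFunOn_mem hy
  have h2 : charT p σ (charTInv p σ y) = y := Function.invFunOn_eq hy
  refine ⟨h1, ?_⟩
  rw [charT_eq] at h2
  nth_rewrite 2 [← h2]
  exact (quarterTInv_quarterT hp ((mem_charDomain_iff hσ).1 h1).2).symm

theorem mem_image_charT_iff (hp : 3 / 2 < p) {σ y : ℝ} (hσ : σ = 1 ∨ σ = -1) (hy : 0 < y) :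
    y ∈ charT p σ '' charDomain σ ↔ 0 < σ * quarterTInv p y := by
  have hσ2 : σ * σ = 1 := by rcases hσ with rfl | rfl <;> norm_num
  constructor
  · intro h
    obtain ⟨h1, h2⟩ := mul_charTInv hp hσ h
    rw [← h2, ← mul_assoc, hσ2, one_mul]
    exact ((mem_charDomain_iff hσ).1 h1).1
  · intro h
    have e : σ * (σ * quarterTInv p y) = quarterTInv p y := by rw [← mul_assoc, hσ2, one_mul]
    refine ⟨σ * quarterTInv p y, (mem_charDomain_iff hσ).2 ⟨h, ?_⟩, ?_⟩
    · rw [e]; exact quarterTInv_lt hp hy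
    · rw [charT_eq, e, quarterT_quarterTInv hp hy]

theorem charV_charTInv (hp : 3 / 2 < p) {σ y : ℝ} (hσ : σ = 1 ∨ σ = -1)
    (hy : y ∈ charT p σ '' charDomain σ) :
    charV p σ (charTInv p σ y) = σ * signedV p (quarterTInv p y) := by
  obtain ⟨h1, h2⟩ := mul_charTInv hp hσ hy
  have h3 := ((mem_charDomain_iff hσ).1 h1).1
  rw [charV_eq, h2, signedV, ← h2]
  rcases hσ with rfl | rfl
  · rw [one_mul, one_mul, sgnPow_of_nonneg h3.le]
  · rw [neg_one_mul, sgnPow_neg (by linarith), sgnPow_of_nonneg h3.le]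
    ring

theorem nodeSign_eq (i m : ℕ) (T : ℝ) : nodeSign i m T = 1 ∨ nodeSign i m T = -1 := by
  unfold nodeSign
  split_ifs <;> simp

/-- The sign records on which side of the node the lobes are longer on average. -/
theorem nodeSign_mul_pos {i n : ℕ} {T : ℝ} (hi : 0 < i) (hn : 0 < n)
    (h : T ≠ (i : ℝ) / (i + n : ℕ)) : 0 < nodeSign i (i + n) T * (T / i - (1 - T) / n) := by
  have hi' : (0 : ℝ) < i := by exact_mod_cast hi
  have hn' : (0 : ℝ) < n := by exact_mod_cast hn
  have e : T / i - (1 - T) / n = (T - (i : ℝ) / (i + n : ℕ)) * ((i + n) / (i * n)) := by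
    push_cast
    field_simp
    ring
  have hpos : (0 : ℝ) < (i + n) / (i * n) := by positivity
  rw [e, nodeSign]
  rcases lt_or_gt_of_ne h with hlt | hgt
  · rw [if_pos hlt]
    nlinarith [mul_pos (sub_pos.2 hlt) hpos]
  · rw [if_neg hgt.not_gt]
    nlinarith [mul_pos (sub_pos.2 hgt) hpos]

theorem solvesLambdaEquation_iff (hp : 3 / 2 < p) {i n : ℕ} {T : ℝ} (hi : 0 < i) (hn : 0 < n)
    (hT : T ∈ Ioo (0 : ℝ) 1) (hne : T ≠ (i : ℝ) / (i + n : ℕ)) {v : ℝ} (hv : 0 < v)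
    (h0 : balance p T (1 - T) i n v = 0) {lam : ℝ} :
    SolvesLambdaEquation p i (i + n) T lam ↔ lam = v ^ 2 := by
  have hi' : (0 : ℝ) < i := by exact_mod_cast hi
  have hn' : (0 : ℝ) < n := by exact_mod_cast hn
  have hT0 := hT.1
  have hT1 : 0 < 1 - T := sub_pos.2 hT.2
  have hsub : ((i + n : ℕ) : ℝ) - i = n := by push_cast; ring
  have hε := nodeSign_eq i (i + n) T
  have hε' : -nodeSign i (i + n) T = 1 ∨ -nodeSign i (i + n) T = -1 := by
    rcases hε with h | h <;> simp [h]
  have hsign := nodeSign_mul_pos hi hn hne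
  set ε := nodeSign i (i + n) T with hεdef
  have hε0 : ε ≠ 0 := by rcases hε with h | h <;> rw [h] <;> norm_num
  rw [SolvesLambdaEquation, hsub, ← hεdef]
  constructor
  · rintro ⟨hl, h1, h2, h3⟩
    rw [charV_charTInv hp hε h1, charV_charTInv hp hε' h2] at h3
    -- Multiplied by the sign, the balance is the difference of the two sides of the scalar
    -- equation; strict monotonicity then identifies the root.
    have h4 : balance p T (1 - T) i n (√lam) = 0 := by
      refine (mul_eq_zero.1 (?_ : ε * balance p T (1 - T) i n (√lam) = 0)).resolve_left hε0
      rw [balance]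
      linarith
    have h5 : √lam = v := (balance_strictMonoOn hp hT0 hT1 hi hn).injOn
      (Real.sqrt_pos.2 hl) hv (h4.trans h0.symm)
    rw [← h5, Real.sq_sqrt hl.le]
  · rintro rfl
    have hy₁ : 0 < v * T / (2 * i) := by positivity
    have hy₂ : 0 < v * (1 - T) / (2 * n) := by positivity
    rw [Real.sqrt_sq hv.le]
    set b₁ := quarterTInv p (v * T / (2 * i)) with hb₁
    set b₂ := quarterTInv p (v * (1 - T) / (2 * n)) with hb₂
    have hb₁1 : b₁ < 1 := quarterTInv_lt hp hy₁
    have hb₂1 : b₂ < 1 := quarterTInv_lt hp hy₂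
    have hX₁ := momentX_pos hp hb₁1
    have hX₂ := momentX_pos hp hb₂1
    rw [balance, ← hb₁, ← hb₂] at h0
    have hzero := signedV_zero hp
    have hmono := signedV_strictMonoOn hp
    have hinv := quarterTInv_strictMonoOn hp
    -- Longer lobes carry the larger `b`, and a vanishing balance of strictly increasing terms, each
    -- zero at `b = 0`, forces opposite signs. This gives both range conditions.
    have hpos : 0 < ε * b₁ ∧ 0 < -ε * b₂ := by
      have hcmp : v * T / (2 * i) - v * (1 - T) / (2 * n) = v / 2 * (T / i - (1 - T) / n) := by
        field_simp
      rcases hε with h | h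
      · rw [h] at hsign ⊢
        have h12 : b₂ < b₁ := hinv hy₂ hy₁ (by
          rw [← sub_pos, hcmp]; exact mul_pos (by linarith) (by linarith))
        have h13 := hmono hb₂1 hb₁1 h12
        have p1 : 0 < b₁ := by
          by_contra! hle
          have := hmono.monotoneOn hb₁1 (show (0 : ℝ) < 1 from one_pos) hle
          rw [hzero] at this
          nlinarith
        have p2 : b₂ < 0 := by
          by_contra! hle
          have := hmono.monotoneOn (show (0 : ℝ) < 1 from one_pos) hb₂1 hle
          rw [hzero] at this
          nlinarith
        constructor <;> linarith
      · rw [h] at hsign ⊢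
        have h12 : b₁ < b₂ := hinv hy₁ hy₂ (by
          rw [← sub_neg, hcmp]; exact mul_neg_of_pos_of_neg (by linarith) (by linarith))
        have h13 := hmono hb₁1 hb₂1 h12
        have p1 : 0 < b₂ := by
          by_contra! hle
          have := hmono.monotoneOn hb₂1 (show (0 : ℝ) < 1 from one_pos) hle
          rw [hzero] at this
          nlinarith
        have p2 : b₁ < 0 := by
          by_contra! hle
          have := hmono.monotoneOn (show (0 : ℝ) < 1 from one_pos) hb₁1 hle
          rw [hzero] at this
          nlinarith
        constructor <;> linarith
    have m1 := (mem_image_charT_iff hp hε hy₁).2 hpos.1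
    have m2 := (mem_image_charT_iff hp hε' hy₂).2 hpos.2
    refine ⟨by positivity, m1, m2, ?_⟩
    rw [charV_charTInv hp hε m1, charV_charTInv hp hε' m2, ← hb₁, ← hb₂]
    linear_combination ε * h0

end Balance

/-! ### The global lower bound over all spectral parameters. -/

theorem IntervalIntegrable.mono_Icc {f : ℝ → ℝ} {a b c d : ℝ} (h : IntervalIntegrable f volume a b)
    (hac : a ≤ c) (hcd : c ≤ d) (hdb : d ≤ b) : IntervalIntegrable f volume c d :=
  h.mono_set (by
    rw [uIcc_of_le hcd, uIcc_of_le (hac.trans (hcd.trans hdb))]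
    exact Icc_subset_Icc hac hdb)

section Minimality

variable {p T u μ : ℝ} {i n : ℕ} {θ Q : ℝ → ℝ}

theorem totalEnergy_le (hp : 3 / 2 < p) (hT : T ∈ Ioo (0 : ℝ) 1) (hi : 0 < i) (hn : 0 < n)
    (hu : 0 < u) (hQ : IntervalIntegrable (fun x => |Q x| ^ p) volume 0 1)
    (hθ : IsPrimitiveOn θ (fun x => Real.cos (θ x) ^ 2 + (μ - Q x) * Real.sin (θ x) ^ 2) 0 1)
    (h0 : θ 0 = 0) (hθT : θ T = i * Real.pi) (h1 : θ 1 = (i + n : ℕ) * Real.pi)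
    (hμ₁ : 0 ≤ quarterTInv p (u * T / (2 * i)) * (μ - u ^ 2))
    (hμ₂ : 0 ≤ quarterTInv p (u * (1 - T) / (2 * n)) * (μ - u ^ 2)) :
    p * totalEnergy p T (1 - T) i n u ≤ ∫ x in (0 : ℝ)..1, |Q x| ^ p := by
  have hi' : (0 : ℝ) < i := by exact_mod_cast hi
  have hn' : (0 : ℝ) < n := by exact_mod_cast hn
  have hT0 := hT.1
  have hT1 : 0 < 1 - T := sub_pos.2 hT.2
  have hQ₁ := IntervalIntegrable.mono_Icc hQ le_rfl hT.1.le hT.2.le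
  have hQ₂ := IntervalIntegrable.mono_Icc hQ hT.1.le hT.2.le le_rfl
  have e₁ := lobeEnergy_le hp hu (quarterTInv_lt hp (by positivity)) hT0.le hQ₁
    (hθ.mono le_rfl hT.1.le hT.2.le) (n := i) (by rw [h0, hθT, zero_add]) hμ₁
  have e₂ := lobeEnergy_le hp hu (quarterTInv_lt hp (by positivity)) hT.2.le hQ₂
    (hθ.mono hT.1.le hT.2.le le_rfl) (n := n) (by rw [h1, hθT]; push_cast; ring) hμ₂
  rw [sub_zero] at e₁
  rw [← intervalIntegral.integral_add_adjacent_intervals hQ₁ hQ₂, totalEnergy, maxEnergy, maxEnergy,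
    mul_add]
  exact add_le_add e₁ e₂

theorem totalEnergy_lt_of_ne (hp : 3 / 2 < p) (hT : T ∈ Ioo (0 : ℝ) 1) (hi : 0 < i) (hn : 0 < n)
    {v : ℝ} (hv : 0 < v) (hbal : balance p T (1 - T) i n v = 0)
    (hQ : IntervalIntegrable (fun x => |Q x| ^ p) volume 0 1)
    (hθ : IsPrimitiveOn θ (fun x => Real.cos (θ x) ^ 2 + (μ - Q x) * Real.sin (θ x) ^ 2) 0 1)
    (h0 : θ 0 = 0) (hθT : θ T = i * Real.pi) (h1 : θ 1 = (i + n : ℕ) * Real.pi)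
    (hμ : μ ≠ v ^ 2) :
    p * totalEnergy p T (1 - T) i n v < ∫ x in (0 : ℝ)..1, |Q x| ^ p := by
  have hp0 : 0 < p := by linarith
  have hi' : (0 : ℝ) < i := by exact_mod_cast hi
  have hn' : (0 : ℝ) < n := by exact_mod_cast hn
  have hT0 := hT.1
  have hT1 : 0 < 1 - T := sub_pos.2 hT.2
  -- For `μ > 0` compare at the matching frequency `√μ`, where the extra term of the calibration
  -- disappears.
  rcases lt_or_ge 0 μ with hμ0 | hμ0
  · have hsq : μ - √μ ^ 2 = 0 := by rw [Real.sq_sqrt hμ0.le, sub_self]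
    have hne : √μ ≠ v := fun h => hμ (by rw [← h, Real.sq_sqrt hμ0.le])
    have hu := Real.sqrt_pos.2 hμ0
    exact (mul_lt_mul_of_pos_left (totalEnergy_lt hp hT0 hT1 hi hn hv hbal hu hne) hp0).trans_le
      (totalEnergy_le hp hT hi hn hu hQ hθ h0 hθT h1 (by rw [hsq, mul_zero]) (by rw [hsq, mul_zero]))
  · have hτ : 0 < quarterT p 0 := quarterT_pos hp one_pos
    set τ := quarterT p 0 with hτdef
    -- For `μ ≤ 0` no frequency matches. This `u` lies below `v` and is small enough that both
    -- parameters `b` are nonpositive, so `b (μ - u²) ≥ 0` on both pieces.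
    set u := min (v / 2) (min (i * τ / T) (n * τ / (1 - T))) with hudef
    have hu : 0 < u := by positivity
    have huv : u < v := (min_le_left _ _).trans_lt (by linarith)
    have hneg : ∀ {L k : ℝ}, 0 < L → 0 < k → u ≤ k * τ / L →
        quarterTInv p (u * L / (2 * k)) ≤ 0 := by
      intro L k hL hk h
      rw [le_div_iff₀ hL] at h
      have hle : u * L / (2 * k) ≤ τ := by
        rw [div_le_iff₀ (by positivity)]
        nlinarith
      have h3 := (quarterTInv_strictMonoOn hp).monotoneOn
        (show 0 < u * L / (2 * k) by positivity) hτ hle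
      rwa [hτdef, quarterTInv_quarterT hp one_pos] at h3
    have hμu : μ - u ^ 2 ≤ 0 := by nlinarith [sq_nonneg u]
    refine (mul_lt_mul_of_pos_left (totalEnergy_lt hp hT0 hT1 hi hn hv hbal hu huv.ne) hp0).trans_le
      (totalEnergy_le hp hT hi hn hu hQ hθ h0 hθT h1 (mul_nonneg_of_nonpos_of_nonpos
        (hneg hT0 hi' ?_) hμu) (mul_nonneg_of_nonpos_of_nonpos (hneg hT1 hn' ?_) hμu))
    · exact (min_le_right _ _).trans (min_le_left _ _)
    · exact (min_le_right _ _).trans (min_le_right _ _)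

end Minimality

/-! ### The glued reference potential and the equality case. -/

/-- The polar angle which runs along one orbit up to time `T` and along another one afterwards. -/
noncomputable def refAngle (p v b₁ b₂ T : ℝ) (i : ℕ) (x : ℝ) : ℝ :=
  open Classical in
  if x ≤ T then orbitPhase p v b₁ x else orbitPhase p v b₂ (x - T) + i * Real.pi

/-- The potential realized along `refAngle`. -/
noncomputable def refPot (p v b₁ b₂ T : ℝ) (i : ℕ) (x : ℝ) : ℝ :=
  open Classical in
  if x ≤ T then orbitPot p v b₁ (orbitPhase p v b₁ x)
  else orbitPot p v b₂ (orbitPhase p v b₂ (x - T) + i * Real.pi)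

section Glued

variable {p T v b₁ b₂ : ℝ} {i n : ℕ} {θ Q : ℝ → ℝ}

theorem refAngle_of_le {x : ℝ} (hx : x ≤ T) :
    refAngle p v b₁ b₂ T i x = orbitPhase p v b₁ (x - 0) + (0 : ℕ) * Real.pi := by
  rw [refAngle, if_pos hx, Nat.cast_zero, zero_mul, add_zero, sub_zero]

theorem refAngle_of_ge (hp : 3 / 2 < p) (hv : 0 < v) (hb₁ : b₁ < 1) (hb₂ : b₂ < 1) (hi : 0 < i)
    (hL₁ : quarterT p b₁ = v * T / (2 * i)) {x : ℝ} (hx : T ≤ x) :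
    refAngle p v b₁ b₂ T i x = orbitPhase p v b₂ (x - T) + i * Real.pi := by
  rcases eq_or_lt_of_le hx with rfl | hx
  · rw [refAngle, if_pos le_rfl, sub_self, orbitPhase_zero hp hv hb₂, zero_add,
      orbitPhase_length hp hv hb₁ hi hL₁]
  · rw [refAngle, if_neg hx.not_ge]

theorem refPot_of_le {x : ℝ} (hx : x ≤ T) :
    refPot p v b₁ b₂ T i x = orbitPot p v b₁ (refAngle p v b₁ b₂ T i x) := by
  rw [refPot, refAngle, if_pos hx, if_pos hx]

theorem refPot_of_gt {x : ℝ} (hx : T < x) :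
    refPot p v b₁ b₂ T i x = orbitPot p v b₂ (refAngle p v b₁ b₂ T i x) := by
  rw [refPot, refAngle, if_neg hx.not_ge, if_neg hx.not_ge]

theorem measurable_refPot (hp : 3 / 2 < p) (hv : 0 < v) (hb₁ : b₁ < 1) (hb₂ : b₂ < 1) :
    Measurable (refPot p v b₁ b₂ T i) := by
  have h1 := continuous_orbitPot hp hv hb₁
  have h2 := continuous_orbitPot hp hv hb₂
  have h3 := continuous_orbitPhase hp hv hb₁
  have h4 := continuous_orbitPhase hp hv hb₂
  exact Measurable.ite measurableSet_Iic (h1.comp h3).measurable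
    (Continuous.measurable (by fun_prop))

theorem isPrimitiveOn_refAngle (hp : 3 / 2 < p) (hT : T ∈ Ioo (0 : ℝ) 1) (hv : 0 < v) (hb₁ : b₁ < 1)
    (hb₂ : b₂ < 1) (hi : 0 < i) (hL₁ : quarterT p b₁ = v * T / (2 * i)) :
    IsPrimitiveOn (refAngle p v b₁ b₂ T i) (fun x => Real.cos (refAngle p v b₁ b₂ T i x) ^ 2 +
      (v ^ 2 - refPot p v b₁ b₂ T i x) * Real.sin (refAngle p v b₁ b₂ T i x) ^ 2) 0 1 := by
  refine IsPrimitiveOn.trans (c := T) ?_ ?_ hT.1.le hT.2.le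
  · refine ((isPrimitiveOn_orbitPhase hp hv hb₁ hT.1.le 0).congr hT.1.le
      fun x hx => (refAngle_of_le hx.2).symm).congr_ae hT.1.le
      (Filter.Eventually.of_forall fun x hx => ?_)
    rw [orbitSpeed_eq hp hv hb₁, refPot_of_le hx.2.le, refAngle_of_le hx.2.le]
  · refine ((isPrimitiveOn_orbitPhase hp hv hb₂ hT.2.le i).congr hT.2.le
      fun x hx => (refAngle_of_ge hp hv hb₁ hb₂ hi hL₁ hx.1).symm).congr_ae hT.2.le
      (Filter.Eventually.of_forall fun x hx => ?_)
    rw [orbitSpeed_eq hp hv hb₂, refPot_of_gt hx.1, refAngle_of_ge hp hv hb₁ hb₂ hi hL₁ hx.1.le]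

theorem refAngle_zero (hp : 3 / 2 < p) (hT : 0 < T) (hv : 0 < v) (hb₁ : b₁ < 1) :
    refAngle p v b₁ b₂ T i 0 = 0 := by
  rw [refAngle, if_pos hT.le, orbitPhase_zero hp hv hb₁]

theorem refAngle_node (hp : 3 / 2 < p) (hv : 0 < v) (hb₁ : b₁ < 1) (hi : 0 < i)
    (hL₁ : quarterT p b₁ = v * T / (2 * i)) : refAngle p v b₁ b₂ T i T = i * Real.pi := by
  rw [refAngle, if_pos le_rfl, orbitPhase_length hp hv hb₁ hi hL₁]

theorem refAngle_one (hp : 3 / 2 < p) (hT : T < 1) (hv : 0 < v) (hb₂ : b₂ < 1) (hn : 0 < n)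
    (hL₂ : quarterT p b₂ = v * (1 - T) / (2 * n)) :
    refAngle p v b₁ b₂ T i 1 = (i + n : ℕ) * Real.pi := by
  rw [refAngle, if_neg hT.not_ge, orbitPhase_length hp hv hb₂ hn hL₂]
  push_cast
  ring

theorem integral_refPot (hp : 3 / 2 < p) (hT : T ∈ Ioo (0 : ℝ) 1) (hv : 0 < v) (hb₁ : b₁ < 1)
    (hb₂ : b₂ < 1) (hi : 0 < i) (hn : 0 < n) (hL₁ : quarterT p b₁ = v * T / (2 * i))
    (hL₂ : quarterT p b₂ = v * (1 - T) / (2 * n)) :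
    IntervalIntegrable (fun x => |refPot p v b₁ b₂ T i x| ^ p) volume 0 1 ∧
      ∫ x in (0 : ℝ)..1, |refPot p v b₁ b₂ T i x| ^ p =
        p * (lobeEnergy p T i v b₁ + lobeEnergy p (1 - T) n v b₂) := by
  have c₁ := continuous_abs_orbitPot_rpow hp hv hb₁
  have c₂ := continuous_abs_orbitPot_rpow hp hv hb₂
  have d₁ := continuous_orbitPhase hp hv hb₁
  have d₂ := continuous_orbitPhase hp hv hb₂
  have e₁ : EqOn (fun x => |orbitPot p v b₁ (orbitPhase p v b₁ (x - 0) + (0 : ℕ) * Real.pi)| ^ p)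
      (fun x => |refPot p v b₁ b₂ T i x| ^ p) (uIoc 0 T) := fun x hx => by
    rw [uIoc_of_le hT.1.le] at hx
    simp only
    rw [refPot_of_le hx.2, refAngle_of_le hx.2]
  have e₂ : EqOn (fun x => |orbitPot p v b₂ (orbitPhase p v b₂ (x - T) + i * Real.pi)| ^ p)
      (fun x => |refPot p v b₁ b₂ T i x| ^ p) (uIoc T 1) := fun x hx => by
    rw [uIoc_of_le hT.2.le] at hx
    simp only
    rw [refPot_of_gt hx.1, refAngle_of_ge hp hv hb₁ hb₂ hi hL₁ hx.1.le]
  have i₁ : IntervalIntegrable (fun x => |refPot p v b₁ b₂ T i x| ^ p) volume 0 T :=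
    (Continuous.intervalIntegrable (c₁.comp (by fun_prop)) 0 T).congr e₁
  have i₂ : IntervalIntegrable (fun x => |refPot p v b₁ b₂ T i x| ^ p) volume T 1 :=
    (Continuous.intervalIntegrable (c₂.comp (by fun_prop)) T 1).congr e₂
  refine ⟨i₁.trans i₂, ?_⟩
  rw [← intervalIntegral.integral_add_adjacent_intervals i₁ i₂,
    ← intervalIntegral.integral_congr_ae (Filter.Eventually.of_forall e₁),
    ← intervalIntegral.integral_congr_ae (Filter.Eventually.of_forall e₂),
    integral_orbitPot hp hv hb₁ hi hT.1.le (by rwa [sub_zero]),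
    integral_orbitPot hp hv hb₂ hn hT.2.le hL₂, sub_zero, mul_add]

/-- Equality in the sum forces equality on each piece, so `Q` is the orbit potential at the unknown
`θ`. Then `θ` solves the autonomous orbit equation, which identifies it with the reference angle. -/
theorem ae_eq_refPot (hp : 3 / 2 < p) (hT : T ∈ Ioo (0 : ℝ) 1) (hv : 0 < v) (hb₁ : b₁ < 1)
    (hb₂ : b₂ < 1) (hi : 0 < i) (hL₁ : quarterT p b₁ = v * T / (2 * i))
    (hQ : IntervalIntegrable (fun x => |Q x| ^ p) volume 0 1)
    (hθ : IsPrimitiveOn θ (fun x => Real.cos (θ x) ^ 2 + (v ^ 2 - Q x) * Real.sin (θ x) ^ 2) 0 1)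
    (h0 : θ 0 = 0) (hθT : θ T = i * Real.pi) (h1 : θ 1 = (i + n : ℕ) * Real.pi)
    (hle : ∫ x in (0 : ℝ)..1, |Q x| ^ p ≤
      p * (lobeEnergy p T i v b₁ + lobeEnergy p (1 - T) n v b₂)) :
    ∀ᵐ x, x ∈ Ioo (0 : ℝ) 1 → Q x = refPot p v b₁ b₂ T i x := by
  have hQ₁ := IntervalIntegrable.mono_Icc hQ le_rfl hT.1.le hT.2.le
  have hQ₂ := IntervalIntegrable.mono_Icc hQ hT.1.le hT.2.le le_rfl
  have hθ₁ := hθ.mono le_rfl hT.1.le hT.2.le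
  have hθ₂ := hθ.mono hT.1.le hT.2.le le_rfl
  have n₁ : θ T = θ 0 + i * Real.pi := by rw [h0, hθT, zero_add]
  have n₂ : θ 1 = θ T + n * Real.pi := by rw [h1, hθT]; push_cast; ring
  have l₁ := lobeEnergy_le hp hv hb₁ hT.1.le hQ₁ hθ₁ n₁ (by rw [sub_self, mul_zero])
  have l₂ := lobeEnergy_le hp hv hb₂ hT.2.le hQ₂ hθ₂ n₂ (by rw [sub_self, mul_zero])
  rw [← intervalIntegral.integral_add_adjacent_intervals hQ₁ hQ₂] at hle
  rw [sub_zero] at l₁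
  have a₁ := ae_eq_orbitPot hp hv hb₁ hT.1.le hQ₁ hθ₁ n₁ (by rw [sub_zero]; linarith)
  have a₂ := ae_eq_orbitPot hp hv hb₂ hT.2.le hQ₂ hθ₂ n₂ (by linarith)
  have s₁ := eq_orbitPhase hp hv hb₁ hT.1.le (k := 0) (hθ₁.congr_ae hT.1.le (by
    filter_upwards [a₁] with x hx hxm
    rw [hx hxm, orbitSpeed_eq hp hv hb₁])) (by rw [h0, Nat.cast_zero, zero_mul])
  have s₂ := eq_orbitPhase hp hv hb₂ hT.2.le (k := i) (hθ₂.congr_ae hT.2.le (by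
    filter_upwards [a₂] with x hx hxm
    rw [hx hxm, orbitSpeed_eq hp hv hb₂])) hθT
  filter_upwards [a₁, a₂, compl_mem_ae_iff.2 (measure_singleton T)] with x hx₁ hx₂ hxT hx
  rcases lt_or_gt_of_ne (show x ≠ T from hxT) with h | h
  · rw [hx₁ ⟨hx.1, h⟩, refPot_of_le h.le, refAngle_of_le h.le, s₁ ⟨hx.1.le, h.le⟩]
  · rw [hx₂ ⟨h, hx.2⟩, refPot_of_gt h, refAngle_of_ge hp hv hb₁ hb₂ hi hL₁ h.le,
      s₂ ⟨h.le, hx.2.le⟩]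

end Glued

/-! ### Translation between the Lebesgue space and interval integrals. -/

section Lebesgue

variable {p : ℝ}

theorem unitVolume_eq : unitVolume = volume.restrict (Ioc (0 : ℝ) 1) :=
  restrict_Ioc_eq_restrict_Icc.symm

theorem ae_unitVolume_iff {P : ℝ → Prop} :
    (∀ᵐ x ∂unitVolume, P x) ↔ ∀ᵐ x, x ∈ Ioo (0 : ℝ) 1 → P x := by
  rw [unitVolume, ← restrict_Ioo_eq_restrict_Icc, ae_restrict_iff' measurableSet_Ioo]

theorem intervalIntegrable_iff_unitVolume {f : ℝ → ℝ} :
    IntervalIntegrable f volume 0 1 ↔ Integrable f unitVolume := by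
  rw [intervalIntegrable_iff_integrableOn_Ioc_of_le zero_le_one, IntegrableOn, unitVolume_eq]

theorem integral_unitVolume (f : ℝ → ℝ) : ∫ x, f x ∂unitVolume = ∫ x in (0 : ℝ)..1, f x := by
  rw [intervalIntegral.integral_of_le zero_le_one, unitVolume_eq]

theorem intervalIntegrable_lpUnit (hp : 3 / 2 < p) (q : LpUnit p) :
    IntervalIntegrable q volume 0 1 :=
  intervalIntegrable_iff_unitVolume.2 <| (Lp.memLp q).integrable <| by
    rw [← ENNReal.ofReal_one]; exact ENNReal.ofReal_le_ofReal (by linarith)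

theorem memLp_sub_const (q : LpUnit p) (c : ℝ) :
    MemLp (fun x => q x - c) (ENNReal.ofReal p) unitVolume :=
  (Lp.memLp q).sub (memLp_const c)

theorem memLp_iff_intervalIntegrable (hp : 3 / 2 < p) {f : ℝ → ℝ}
    (hf : AEStronglyMeasurable f unitVolume) : MemLp f (ENNReal.ofReal p) unitVolume ↔
      IntervalIntegrable (fun x => |f x| ^ p) volume 0 1 := by
  have hp0 : 0 < p := by linarith
  rw [intervalIntegrable_iff_unitVolume, ← integrable_norm_rpow_iff hf (by simpa using hp0)
    ENNReal.ofReal_ne_top, ENNReal.toReal_ofReal hp0.le]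
  simp only [Real.norm_eq_abs]

theorem intervalIntegrable_abs_sub_rpow (hp : 3 / 2 < p) (q : LpUnit p) (c : ℝ) :
    IntervalIntegrable (fun x => |q x - c| ^ p) volume 0 1 :=
  (memLp_iff_intervalIntegrable hp (memLp_sub_const q c).1).1 (memLp_sub_const q c)

theorem norm_sub_const (hp : 3 / 2 < p) (q : LpUnit p) (c : ℝ) :
    ‖q - Lp.const (ENNReal.ofReal p) unitVolume c‖ =
      (∫ x in (0 : ℝ)..1, |q x - c| ^ p) ^ p⁻¹ := by
  have hp0 : 0 < p := by linarith
  have hae : ⇑(q - Lp.const (ENNReal.ofReal p) unitVolume c) =ᵐ[unitVolume] fun x => q x - c := by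
    filter_upwards [Lp.coeFn_sub q (Lp.const (ENNReal.ofReal p) unitVolume c),
      Lp.coeFn_const (p := ENNReal.ofReal p) (μ := unitVolume) c] with x h1 h2
    rw [h1, Pi.sub_apply, h2, Function.const_apply]
  have h0 : 0 ≤ ∫ x in (0 : ℝ)..1, |q x - c| ^ p :=
    intervalIntegral.integral_nonneg zero_le_one fun x _ => by positivity
  rw [Lp.norm_def, eLpNorm_congr_ae hae, (memLp_sub_const q c).eLpNorm_eq_integral_rpow_norm
    (by simpa using hp0) ENNReal.ofReal_ne_top, ENNReal.toReal_ofReal hp0.le]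
  simp only [Real.norm_eq_abs]
  rw [integral_unitVolume, ENNReal.toReal_ofReal (by positivity)]

theorem norm_sub_const_le_iff (hp : 3 / 2 < p) (q r : LpUnit p) (c : ℝ) :
    ‖q - Lp.const (ENNReal.ofReal p) unitVolume c‖ ≤
        ‖r - Lp.const (ENNReal.ofReal p) unitVolume c‖ ↔
      ∫ x in (0 : ℝ)..1, |q x - c| ^ p ≤ ∫ x in (0 : ℝ)..1, |r x - c| ^ p := by
  have hp0 : 0 < p := by linarith
  have h0 : ∀ q : LpUnit p, 0 ≤ ∫ x in (0 : ℝ)..1, |q x - c| ^ p := fun q =>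
    intervalIntegral.integral_nonneg zero_le_one fun x _ => by positivity
  rw [norm_sub_const hp, norm_sub_const hp,
    Real.rpow_le_rpow_iff (h0 q) (h0 r) (inv_pos.2 hp0)]

end Lebesgue

/-! ### Assembly. -/

theorem existsUnique_solvesProblemP {p : ℝ} (hp : 3 / 2 < p) {i n : ℕ} (hi : 0 < i) (hn : 0 < n)
    {T : ℝ} (hT : T ∈ Ioo (0 : ℝ) 1) (c : ℝ) {v : ℝ} (hv : 0 < v)
    (hbal : balance p T (1 - T) i n v = 0) :
    ∃ qhat : LpUnit p, IsNthEigenvalue qhat (i + n) (c + v ^ 2) ∧ ∀ q : LpUnit p,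
      SolvesProblemP p i (i + n) T (Lp.const (ENNReal.ofReal p) unitVolume c) q ↔ q = qhat := by
  have hi' : (0 : ℝ) < i := by exact_mod_cast hi
  have hn' : (0 : ℝ) < n := by exact_mod_cast hn
  have hT0 := hT.1
  have hT1 : 0 < 1 - T := sub_pos.2 hT.2
  have hy₁ : 0 < v * T / (2 * i) := by positivity
  have hy₂ : 0 < v * (1 - T) / (2 * n) := by positivity
  have hb₁ := quarterTInv_lt hp hy₁
  have hb₂ := quarterTInv_lt hp hy₂
  have hL₁ := quarterT_quarterTInv hp hy₁
  have hL₂ := quarterT_quarterTInv hp hy₂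
  have htot : totalEnergy p T (1 - T) i n v =
      lobeEnergy p T i v (quarterTInv p (v * T / (2 * i))) +
      lobeEnergy p (1 - T) n v (quarterTInv p (v * (1 - T) / (2 * n))) := rfl
  set b₁ := quarterTInv p (v * T / (2 * i))
  set b₂ := quarterTInv p (v * (1 - T) / (2 * n))
  obtain ⟨hint, hval⟩ := integral_refPot hp hT hv hb₁ hb₂ hi hn hL₁ hL₂
  rw [← htot] at hval
  have hmem : MemLp (refPot p v b₁ b₂ T i) (ENNReal.ofReal p) unitVolume :=
    (memLp_iff_intervalIntegrable hp
      (measurable_refPot hp hv hb₁ hb₂).aestronglyMeasurable).2 hint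
  have hmem' : MemLp (fun x => refPot p v b₁ b₂ T i x + c) (ENNReal.ofReal p) unitVolume :=
    hmem.add (memLp_const c)
  set qhat : LpUnit p := hmem'.toLp _
  have hq : ∀ᵐ x, x ∈ Ioo (0 : ℝ) 1 → qhat x - c = refPot p v b₁ b₂ T i x :=
    ae_unitVolume_iff.1 <| by
      filter_upwards [hmem'.coeFn_toLp] with x hx
      rw [show qhat x = _ from hx, add_sub_cancel_right]
  have hangle : IsPruferAngle qhat (c + v ^ 2) (refAngle p v b₁ b₂ T i) :=
    ⟨(isPrimitiveOn_refAngle hp hT hv hb₁ hb₂ hi hL₁).congr_ae zero_le_one (by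
      filter_upwards [hq] with x hx hxm
      rw [← hx hxm]; ring), refAngle_zero hp hT0 hv hb₁⟩
  have hone : refAngle p v b₁ b₂ T i 1 = (i + n : ℕ) * Real.pi :=
    refAngle_one hp hT.2 hv hb₂ hn hL₂
  have hqint := intervalIntegrable_lpUnit hp
  have henergy : ∫ x in (0 : ℝ)..1, |qhat x - c| ^ p = p * totalEnergy p T (1 - T) i n v := by
    rw [← hval, ← integral_unitVolume, ← integral_unitVolume]
    refine integral_congr_ae ?_
    filter_upwards [ae_unitVolume_iff.2 hq] with x hx
    rw [hx]
  have hnode : IsNode qhat i (i + n) T := (isNode_iff (hqint qhat) hT).2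
    ⟨_, _, hangle, refAngle_node hp hv hb₁ hi hL₁, hone⟩
  -- Every competitor either has strictly larger energy or equals the reference potential;
  -- minimality and uniqueness both follow.
  have key : ∀ q : LpUnit p, IsNode q i (i + n) T →
      p * totalEnergy p T (1 - T) i n v < ∫ x in (0 : ℝ)..1, |q x - c| ^ p ∨ q = qhat := by
    intro q hqn
    obtain ⟨ν, θ, hθ, hθT, hθ1⟩ := (isNode_iff (hqint q) hT).1 hqn
    have hprim : IsPrimitiveOn θ (fun x => Real.cos (θ x) ^ 2 +
        ((ν - c) - (q x - c)) * Real.sin (θ x) ^ 2) 0 1 := by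
      simpa only [sub_sub_sub_cancel_right] using hθ.primitive
    have hQ := intervalIntegrable_abs_sub_rpow hp q c
    rcases ne_or_eq (ν - c) (v ^ 2) with hne | heq
    · exact Or.inl (totalEnergy_lt_of_ne hp hT hi hn hv hbal hQ hprim hθ.zero hθT hθ1 hne)
    · rw [heq] at hprim
      refine or_iff_not_imp_left.2 fun hle => Lp.ext (ae_unitVolume_iff.2 ?_)
      have h := ae_eq_refPot hp hT hv hb₁ hb₂ hi hL₁ hQ hprim hθ.zero hθT hθ1
        (by rw [← htot]; exact not_lt.1 hle)
      filter_upwards [h, hq] with x h1 h2 hx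
      linarith [h1 hx, h2 hx]
  refine ⟨qhat, (hangle.isNthEigenvalue_iff (hqint qhat)).2 hone, fun q => ⟨fun ⟨h1, h2⟩ => ?_, ?_⟩⟩
  · refine (key q h1).resolve_left fun hlt => ?_
    have := (norm_sub_const_le_iff hp q qhat c).1 (h2 qhat hnode)
    rw [henergy] at this
    exact hlt.not_ge this
  · rintro rfl
    refine ⟨hnode, fun r hr => (norm_sub_const_le_iff hp _ r c).2 ?_⟩
    rcases key r hr with h | rfl
    · rw [henergy]; exact h.le
    · exact le_rfl

theorem mainTheorem5 (p : ℝ) (hp : 3 / 2 < p) (i m : ℕ) (hi : 1 ≤ i) (him : i < m)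
    (T : ℝ) (hT : T ∈ Set.Ioo (0 : ℝ) 1) (c : ℝ) :
    (T ≠ (i : ℝ) / m → ∃! lam : ℝ, SolvesLambdaEquation p i m T lam) ∧
    (∃! qhat : LpUnit p,
      SolvesProblemP p i m T (MeasureTheory.Lp.const (ENNReal.ofReal p) unitVolume c) qhat) ∧
    (T ≠ (i : ℝ) / m → ∀ (qhat : LpUnit p) (lam : ℝ),
      SolvesProblemP p i m T (MeasureTheory.Lp.const (ENNReal.ofReal p) unitVolume c) qhat →
      SolvesLambdaEquation p i m T lam → IsNthEigenvalue qhat m (c + lam)) := by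
  -- With `n = m - i` lobes to the right of the node, a single root `v` of the balance serves all
  -- three claims; the existence part requires no separate treatment of `T = i / m`.
  obtain ⟨n, rfl⟩ := Nat.exists_eq_add_of_le him.le
  have hn : 0 < n := by omega
  obtain ⟨v, hv, hbal⟩ := exists_balance_eq_zero hp hT.1 (sub_pos.2 hT.2) hi hn
  obtain ⟨qhat, heig, hsol⟩ := existsUnique_solvesProblemP hp hi hn hT c hv hbal
  have hlam := fun (hne : T ≠ (i : ℝ) / (i + n : ℕ)) (lam : ℝ) =>
    solvesLambdaEquation_iff hp hi hn hT hne hv hbal (lam := lam)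
  refine ⟨fun hne => ⟨v ^ 2, (hlam hne _).2 rfl, fun lam => (hlam hne lam).1⟩,
    ⟨qhat, (hsol qhat).2 rfl, fun q => (hsol q).1⟩, fun hne q lam hq hl => ?_⟩
  rw [(hsol q).1 hq, (hlam hne lam).1 hl]
  exact heig
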